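/- **Setting.** Let $\mathfrak X_0$ be an integral normal scheme of finite type over $\operatorname{spec}\mathbb Z$ with function field $K_0$. Let $K$ be an algebraic closure of $K_0$, let $G=\operatorname{Aut}(K/K_0)$, and let $\mathfrak X$ be the normalization of $\mathfrak X_0$ in $K$. Consider the pairs $(\mathfrak x,P)$ with $\mathfrak x\in\mathfrak X$ and $P\in\operatorname{Hom}(\kappa(\mathfrak x)^\times,\mathbb C^\times)$. They carry the topology of pointwise convergence: the coarsest one such that, for every open $U\subset\mathfrak X$ and every $f\in\Gamma(U,\mathcal O)$, the pairs with $\mathfrak x\in U$ form an open set on which $(\mathfrak x,P)\mapsto P(f(\mathfrak x))$ is continuous, where $P(0):=0$. The group $G$ acts from the right by $(\mathfrak x,P)^\sigma=(\mathfrak x^\sigma,P\circ\sigma)$, and $\nu\in\mathcal N=\{1,2,\dots\}$ acts by $F_\nu(\mathfrak x,P)=(\mathfrak x,P\circ(\;)^\nu)$. Let $\mathcal E$ be an admissible condition on pairs $(\mathfrak x,P)$. This means the following. - $\mathcal E$ is stable under $G$ and under all $F_\nu$. - If $(\mathfrak x,P)$ satisfies $\mathcal E$, then $P$ restricted to the roots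 of unity $\mu(\kappa(\mathfrak x))$ has finite kernel. - If $(\mathfrak x,P)$ satisfies $\mathcal E$ and $\operatorname{char}\kappa(\mathfrak x)>0$, then the image of $P$ is not torsion, unless $\kappa(\mathfrak x)^\times$ is torsion. - If $\kappa(\mathfrak x)^\times$ is torsion, then every $P$ with finite kernel satisfies $\mathcal E$. (Examples: "$\ker P$ is finite" and "$\ker P$ is finitely generated".) Let $\mathfrak X^\bullet_{\mathcal E}$ be the space of pairs satisfying $\mathcal E$, with the subspace topology. Let $\mathfrak X^\bullet_{0\mathcal E}=\mathfrak X^\bullet_{\mathcal E}/G$ have the quotient topology. Let $\check{\mathfrak X}_{0\mathcal E}$ be the colimit of the spaces $\mathfrak X^\bullet_{0\mathcal E}$ over $\mathcal N$ ordered by divisibility, with transition maps the $F_\nu$. On it $\mathbb Q^{>0}$ acts, with $\nu$ acting as $F_\nu$. Let $$X_{0\mathcal E}=(\check{\mathfrak X}_{0\mathcal E}\times\mathbb R^{>0})/\mathbb Q^{>0}$$ be the quotient by the diagonal action, with the quotient topology and with the flow $\phi^t[P,u]=[P,e^tu]$. For $\mathfrak x_0\in\mathfrak X_0$ let $\Gamma_{\mathfrak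 x_0}\subset X_{0\mathcal E}$ be the set of points lying over $\mathfrak x_0$ under the natural projection $X_{0\mathcal E}\to\mathfrak X_0$. For $\mathfrak x_0$ closed, the *packet topology* on $\Gamma_{\mathfrak x_0}$ is the finest topology for which $((\mathfrak x,P),u)\mapsto[(\mathfrak x,P),u]$ is continuous, where $u\in\mathbb R^{>0}$ and $(\mathfrak x,P)\in\mathfrak X^\bullet_{\mathcal E}$ runs over the pairs with $\mathfrak x$ over $\mathfrak x_0$ and $P|_{\mu(\kappa(\mathfrak x))}$ injective. **Theorem 4.2.** We have $$\{x\in X_{0\mathcal E}\mid \phi^t(x)=x\text{ for some }t>0\}=\coprod_{\mathfrak x_0}\Gamma_{\mathfrak x_0},$$ where $\mathfrak x_0$ runs over the closed points of $\mathfrak X_0$; in particular the sets $\Gamma_{\mathfrak x_0}$ are pairwise disjoint. For every closed point $\mathfrak x_0$ the following hold. 1. $\Gamma_{\mathfrak x_0}$ is a compact subset of $X_{0\mathcal E}$. 2. $\kappa(\mathfrak x_0)$ is finite, and with $N\mathfrak x_0=|\kappa(\mathfrak x_0)|$ every $x\in\Gamma_{\mathfrak x_0}$ lies on a periodic orbit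 of length $\log N\mathfrak x_0$; that is, $\phi^t(x)=x$ if and only if $t\in\mathbb Z\log N\mathfrak x_0$. 3. In the packet topology $\Gamma_{\mathfrak x_0}$ is compact and Hausdorff, and its inclusion into $X_{0\mathcal E}$ is continuous. 4. Let $p=\operatorname{char}\kappa(\mathfrak x_0)$. Give $\operatorname{Aut}(\overline{\mathbb F}_p^\times)$ the topology of pointwise convergence on the discrete group $\overline{\mathbb F}_p^\times$. Then $\operatorname{Aut}(\overline{\mathbb F}_p)$ is a normal subgroup of $\operatorname{Aut}(\overline{\mathbb F}_p^\times)$, and the quotient $B=\operatorname{Aut}(\overline{\mathbb F}_p^\times)/\operatorname{Aut}(\overline{\mathbb F}_p)$ is compact and Hausdorff. In the packet topology $\Gamma_{\mathfrak x_0}$ is a fibre space over $B$ with fibres the orbits: there is a continuous surjection $\pi:\Gamma_{\mathfrak x_0}\to B$ whose fibres are exactly the $\phi$-orbits in $\Gamma_{\mathfrak x_0}$, and which is locally over $B$ a product with the circle $\mathbb R/\mathbb Z\log N\mathfrak x_0$, such that $\phi^t$ is translation by $t$ on the circle. -/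

import Mathlib

open AlgebraicGeometry CategoryTheory Topology

noncomputable section

namespace ArithmeticFlow

/-- A scheme is normal if all its local rings are integrally closed domains. (For an integral
scheme all local rings are domains.) -/
def IsNormalScheme (X : Scheme.{0}) : Prop :=
  ∀ x : X, IsDomain (X.presheaf.stalk x) ∧ IsIntegrallyClosed (X.presheaf.stalk x)

/-! ### Characters of residue fields -/

/-- A pair `(x, P)` of a point `x` of the scheme `X` and a character `P : κ(x)ˣ → ℂˣ`. -/
structure CharPoint (X : Scheme.{0}) where
  pt : X
  char : (X.residueField pt)ˣ →* ℂˣ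

namespace CharPoint

variable {X Y Z : Scheme.{0}}

/-- The character `P` extended to the residue field by `P(0) = 0`. -/
def extend (p : CharPoint X) (a : X.residueField p.pt) : ℂ :=
  open Classical in if h : a = 0 then 0 else (p.char (Units.mk0 a h) : ℂ)

/-- The value at `(x, P)` of a section `f` over an open neighbourhood of `x`,
namely `P(f(x))`, which is read as `0` if `f(x) = 0`. -/
def eval (p : CharPoint X) (U : X.Opens) (h : p.pt ∈ U) (f : Γ(X, U)) : ℂ :=
  p.extend (X.evaluation U p.pt h f)

/-- The topology of pointwise convergence: the coarsest topology for which the pairs `(x, P)` with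
`x ∈ U` form an open set, and every section `f` over `U` defines a continuous function on it, for
all open `U`. For affine `X = Spec R` it is induced by the inclusion into `ℂ ^ R` that sends
`(x, P)` to the multiplicative map `R → κ(x) → ℂ`. -/
instance : TopologicalSpace (CharPoint X) :=
  TopologicalSpace.generateFrom
    {S | ∃ (U : X.Opens) (f : Γ(X, U)) (V : Set ℂ), IsOpen V ∧
      S = {p | ∃ h : p.pt ∈ U, p.eval U h f ∈ V}}

/-- Functoriality in the scheme: `(x, P) ↦ (h x, P ∘ h^*)`, with `h^* : κ(h x) → κ(x)`. -/
def map (h : X ⟶ Y) (p : CharPoint X) : CharPoint Y where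
  pt := h p.pt
  char := p.char.comp (Units.map (h.residueFieldMap p.pt).hom.toMonoidHom)

lemma map_id (p : CharPoint X) : p.map (𝟙 X) = p := by
  obtain ⟨x, P⟩ := p
  simp only [map, Scheme.residueFieldMap_id]
  rfl

lemma map_comp (g : X ⟶ Y) (h : Y ⟶ Z) (p : CharPoint X) :
    p.map (g ≫ h) = (p.map g).map h := by
  obtain ⟨x, P⟩ := p
  simp only [map, Scheme.residueFieldMap_comp]
  rfl

/-- The Frobenius `F_ν (x, P) = (x, P ∘ (z ↦ z ^ ν))`. -/
def frob (ν : ℕ+) (p : CharPoint X) : CharPoint X where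
  pt := p.pt
  char := p.char.comp (powMonoidHom (ν : ℕ))

lemma frob_one (p : CharPoint X) : p.frob 1 = p := by
  obtain ⟨x, P⟩ := p
  simp only [frob]
  congr 1
  exact MonoidHom.ext fun z => by simp

lemma frob_frob (m n : ℕ+) (p : CharPoint X) : (p.frob n).frob m = p.frob (m * n) := by
  obtain ⟨x, P⟩ := p
  refine congrArg (CharPoint.mk x) ?_
  apply MonoidHom.ext
  intro z
  change P ((z ^ (m : ℕ)) ^ (n : ℕ)) = P (z ^ ((m * n : ℕ+) : ℕ))
  rw [PNat.mul_coe, pow_mul]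

lemma map_frob (ν : ℕ+) (h : X ⟶ Y) (p : CharPoint X) : (p.frob ν).map h = (p.map h).frob ν := by
  obtain ⟨x, P⟩ := p
  refine congrArg (CharPoint.mk (h x)) ?_
  apply MonoidHom.ext
  intro z
  exact congrArg P (map_pow (Units.map (h.residueFieldMap x).hom.toMonoidHom) z (ν : ℕ)).symm

end CharPoint

/-! ### Normalization in an algebraic closure and the Galois action -/

section Normalization

variable (X₀ : Scheme.{0}) [IsIntegral X₀] (K : Type) [Field K] [Algebra X₀.functionField K]

/-- The morphism `Spec K ⟶ X₀` over the generic point. -/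
def geomGenericPoint : Spec (.of K) ⟶ X₀ :=
  Spec.map (CommRingCat.ofHom (algebraMap X₀.functionField K)) ≫
    X₀.fromSpecStalk (genericPoint X₀)

instance : QuasiCompact (geomGenericPoint X₀ K) := by
  unfold geomGenericPoint; infer_instance

instance : QuasiSeparated (geomGenericPoint X₀ K) := by
  unfold geomGenericPoint; infer_instance

/-- The normalization of `X₀` in the extension `K` of its function field. -/
abbrev normalizationIn : Scheme.{0} := (geomGenericPoint X₀ K).normalization

/-- The structure morphism of the normalization. -/
abbrev toBase : normalizationIn X₀ K ⟶ X₀ := (geomGenericPoint X₀ K).fromNormalization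

/-- The automorphism group of `K` over the function field of `X₀`. -/
abbrev GalGroup : Type := K ≃ₐ[X₀.functionField] K

variable {X₀ K}

/-- The automorphism of `Spec K` induced by `σ`. -/
def specGal (σ : GalGroup X₀ K) : Spec (.of K) ⟶ Spec (.of K) :=
  Spec.map (CommRingCat.ofHom (σ : K →+* K))

lemma specGal_comp (σ : GalGroup X₀ K) :
    specGal σ ≫ geomGenericPoint X₀ K = geomGenericPoint X₀ K := by
  unfold specGal geomGenericPoint
  rw [← Category.assoc, ← Spec.map_comp, ← CommRingCat.ofHom_comp]
  congr 3
  ext a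
  simp

/-- The automorphism of the normalization over `X₀` induced by `σ`. -/
def galHom (σ : GalGroup X₀ K) : normalizationIn X₀ K ⟶ normalizationIn X₀ K :=
  (geomGenericPoint X₀ K).normalizationDesc
    (specGal σ ≫ (geomGenericPoint X₀ K).toNormalization) (toBase X₀ K)
    (by rw [Category.assoc, Scheme.Hom.toNormalization_fromNormalization, specGal_comp])

lemma galHom_toBase (σ : GalGroup X₀ K) : galHom σ ≫ toBase X₀ K = toBase X₀ K :=
  Scheme.Hom.normalizationDesc_comp ..

lemma toNormalization_galHom (σ : GalGroup X₀ K) :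
    (geomGenericPoint X₀ K).toNormalization ≫ galHom σ =
      specGal σ ≫ (geomGenericPoint X₀ K).toNormalization :=
  Scheme.Hom.toNormalization_normalizationDesc ..

lemma galHom_one : galHom (1 : GalGroup X₀ K) = 𝟙 _ := by
  refine Scheme.Hom.normalization.hom_ext _ _ _ (toBase X₀ K) ?_ (galHom_toBase 1) (by simp)
  rw [toNormalization_galHom]
  have : specGal (1 : GalGroup X₀ K) = 𝟙 _ := Spec.map_id _
  rw [this]
  simp

lemma galHom_mul (σ τ : GalGroup X₀ K) : galHom (σ * τ) = galHom σ ≫ galHom τ := by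
  refine Scheme.Hom.normalization.hom_ext _ _ _ (toBase X₀ K) ?_ (galHom_toBase _)
    (by rw [Category.assoc, galHom_toBase, galHom_toBase])
  rw [toNormalization_galHom, ← Category.assoc, toNormalization_galHom, Category.assoc,
    toNormalization_galHom, ← Category.assoc]
  congr 1
  exact Spec.map_comp (CommRingCat.ofHom (τ : K →+* K)) (CommRingCat.ofHom (σ : K →+* K))

end Normalization

/-! ### Admissible conditions -/

section System

variable (X₀ : Scheme.{0}) [IsIntegral X₀] (K : Type) [Field K] [Algebra X₀.functionField K]

/-- An admissible condition on the pairs `(x, P)`, where `x` is a point of the normalization of `X₀`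
in `K` and `P` is a character of `κ(x)ˣ`, given as the set of pairs that satisfy it. -/
structure AdmissibleCondition where
  carrier : Set (CharPoint (normalizationIn X₀ K))
  /-- The condition is stable under the Galois group. -/
  gal_mem : ∀ (σ : GalGroup X₀ K), ∀ p ∈ carrier, p.map (galHom σ) ∈ carrier
  /-- The condition is stable under the Frobenius maps. -/
  frob_mem : ∀ (ν : ℕ+), ∀ p ∈ carrier, p.frob ν ∈ carrier
  /-- The restriction of the character to the roots of unity has finite kernel. -/
  finite_ker : ∀ p ∈ carrier, {z | IsOfFinOrder z ∧ p.char z = 1}.Finite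
  /-- In positive characteristic, the image of the character is not torsion, unless the
  multiplicative group of the residue field is torsion. -/
  not_torsion : ∀ p ∈ carrier, ringChar ((normalizationIn X₀ K).residueField p.pt) ≠ 0 →
    (∀ z, IsOfFinOrder (p.char z)) →
    ∀ z : ((normalizationIn X₀ K).residueField p.pt)ˣ, IsOfFinOrder z
  /-- If the multiplicative group of the residue field is torsion, then there is no condition on
  the character but the finiteness of its kernel. -/
  mem_of_torsion : ∀ p : CharPoint (normalizationIn X₀ K),
    (∀ z : ((normalizationIn X₀ K).residueField p.pt)ˣ, IsOfFinOrder z) →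
    {z | p.char z = 1}.Finite → p ∈ carrier

variable {X₀ K} (E : AdmissibleCondition X₀ K)

/-- The space of pairs `(x, P)` that satisfy the condition `E`. -/
abbrev AdmissibleCondition.Points : Type := {p : CharPoint (normalizationIn X₀ K) // p ∈ E.carrier}

/-- The right action `(x, P) ^ σ = (x ^ σ, P ∘ σ)` of the Galois group. -/
instance : MulAction (GalGroup X₀ K)ᵐᵒᵖ E.Points where
  smul σ p := ⟨p.1.map (galHom σ.unop), E.gal_mem _ _ p.2⟩
  one_smul p := Subtype.ext <| by
    change p.1.map (galHom 1) = p.1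
    rw [galHom_one, CharPoint.map_id]
  mul_smul σ τ p := Subtype.ext <| by
    change p.1.map (galHom (τ.unop * σ.unop)) = (p.1.map (galHom τ.unop)).map (galHom σ.unop)
    rw [galHom_mul, CharPoint.map_comp]

lemma gal_smul_val (σ : (GalGroup X₀ K)ᵐᵒᵖ) (p : E.Points) :
    (σ • p).1 = p.1.map (galHom σ.unop) := rfl

/-- The quotient of the space of pairs by the Galois group, with the quotient topology. -/
abbrev WittPoints : Type := MulAction.orbitRel.Quotient (GalGroup X₀ K)ᵐᵒᵖ E.Points

instance : TopologicalSpace (WittPoints E) :=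
  inferInstanceAs (TopologicalSpace (_root_.Quotient _))

namespace WittPoints

variable {E}

/-- The class of a pair. -/
def mk (p : E.Points) : WittPoints E := _root_.Quotient.mk _ p

/-- The Frobenius maps on the quotient. -/
def frob (ν : ℕ+) : WittPoints E → WittPoints E :=
  _root_.Quotient.map' (fun p => ⟨p.1.frob ν, E.frob_mem ν _ p.2⟩) (by
    rintro _ p ⟨σ, rfl⟩
    refine ⟨σ, Subtype.ext ?_⟩
    change (p.1.frob ν).map (galHom σ.unop) = (p.1.map (galHom σ.unop)).frob ν
    exact CharPoint.map_frob ν (galHom σ.unop) p.1)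

lemma frob_one (w : WittPoints E) : frob 1 w = w := by
  induction w using _root_.Quotient.inductionOn' with
  | h p => exact congrArg (_root_.Quotient.mk _) (Subtype.ext (CharPoint.frob_one p.1))

lemma frob_frob (m n : ℕ+) (w : WittPoints E) : frob m (frob n w) = frob (m * n) w := by
  induction w using _root_.Quotient.inductionOn' with
  | h p => exact congrArg (_root_.Quotient.mk _) (Subtype.ext (CharPoint.frob_frob m n p.1))

/-- The point of `X₀` below the class of `(x, P)`. -/
def base : WittPoints E → X₀ :=
  _root_.Quotient.lift (fun p : E.Points => toBase X₀ K p.1.pt) (by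
    rintro _ p ⟨σ, rfl⟩
    change (galHom σ.unop ≫ toBase X₀ K) p.1.pt = _
    rw [galHom_toBase])

lemma base_frob (ν : ℕ+) (w : WittPoints E) : (frob ν w).base = w.base := by
  induction w using _root_.Quotient.inductionOn' with
  | h p => rfl

end WittPoints

/-! ### The colimit over the Frobenius maps -/

/-- The relation that defines the colimit: `(a, w)` is identified with `(a μ, F_μ w)`. -/
def colimRel (z w : Σ _ : ℕ+, WittPoints E) : Prop :=
  ∃ μ : ℕ+, w = ⟨z.1 * μ, WittPoints.frob μ z.2⟩

/-- The colimit of the spaces `WittPoints E`, indexed by the positive integers ordered by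
divisibility, with transition map `F_μ` from the index `a` to the index `a μ`. It carries the
colimit topology. The class of `(a, w)` is to be thought of as `F_a⁻¹ w`. -/
def Leaf : Type := Quot (colimRel E)

instance : TopologicalSpace (Leaf E) := inferInstanceAs (TopologicalSpace (Quot _))

/-- Positive rational numbers. -/
abbrev PosRat : Type := {q : ℚ // 0 < q}

/-- Positive real numbers. -/
abbrev PosReal : Type := {u : ℝ // 0 < u}

/-- The numerator of a positive rational number. -/
def PosRat.num (q : PosRat) : ℕ+ := ⟨q.1.num.toNat, by
  have := Rat.num_pos.2 q.2
  omega⟩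

/-- The denominator of a positive rational number. -/
def PosRat.den (q : PosRat) : ℕ+ := ⟨q.1.den, q.1.den_pos⟩

lemma PosRat.num_div_den (q : PosRat) : ((q.num : ℕ) : ℚ) / ((q.den : ℕ) : ℚ) = q.1 := by
  have h : (q.num : ℕ) = q.1.num.toNat := rfl
  have h' : ((q.1.num.toNat : ℤ)) = q.1.num := Int.toNat_of_nonneg (Rat.num_pos.2 q.2).le
  conv_rhs => rw [← Rat.num_div_den q.1]
  rw [h, ← h']
  rfl

lemma PosRat.num_mul (q r : PosRat) :
    (q * r).num * (q.den * r.den) = q.num * r.num * (q * r).den := by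
  have h1 := q.num_div_den
  have h2 := r.num_div_den
  have h3 := (q * r).num_div_den
  have e : (q * r).1 = q.1 * r.1 := rfl
  have d1 : ((q.den : ℕ) : ℚ) ≠ 0 := by exact_mod_cast q.den.ne_zero
  have d2 : ((r.den : ℕ) : ℚ) ≠ 0 := by exact_mod_cast r.den.ne_zero
  have d3 : (((q * r).den : ℕ) : ℚ) ≠ 0 := by exact_mod_cast (q * r).den.ne_zero
  rw [e, ← h1, ← h2] at h3
  field_simp at h3
  apply PNat.coe_injective
  push_cast
  have h4 : (((q * r).num : ℕ) : ℚ) * ((q.den : ℕ) * (r.den : ℕ)) =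
      (q.num : ℕ) * (r.num : ℕ) * ((q * r).den : ℕ) := by linarith
  exact_mod_cast h4

namespace Leaf

variable {E}

/-- The class of `(a, w)`. -/
def mk (a : ℕ+) (w : WittPoints E) : Leaf E := Quot.mk _ ⟨a, w⟩

lemma mk_frob (a μ : ℕ+) (w : WittPoints E) : mk (a * μ) (w.frob μ) = mk a w :=
  (Quot.sound ⟨μ, rfl⟩).symm

/-- The rational number `m / n` acts by `F_m ∘ F_n⁻¹`. -/
def ratAct (q : PosRat) : Leaf E → Leaf E :=
  Quot.map (fun z => ⟨z.1 * q.den, z.2.frob q.num⟩) (by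
    rintro ⟨a, w⟩ _ ⟨μ, rfl⟩
    refine ⟨μ, ?_⟩
    simp only [WittPoints.frob_frob]
    rw [mul_right_comm, mul_comm q.num μ])

/-- The action of the positive rational numbers on the colimit. -/
instance : MulAction PosRat (Leaf E) where
  smul := ratAct
  one_smul z := by
    induction z using Quot.inductionOn with
    | h z =>
      change mk (z.1 * PosRat.den 1) (z.2.frob (PosRat.num 1)) = mk z.1 z.2
      have : PosRat.num 1 = PosRat.den 1 := rfl
      rw [this, mk_frob]
  mul_smul q r z := by
    induction z using Quot.inductionOn with
    | h z =>
      change mk (z.1 * (q * r).den) (z.2.frob (q * r).num) =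
        mk (z.1 * r.den * q.den) ((z.2.frob r.num).frob q.num)
      rw [WittPoints.frob_frob, ← mk_frob _ (q.den * r.den),
        ← mk_frob (z.1 * r.den * q.den) (q * r).den, WittPoints.frob_frob, WittPoints.frob_frob,
        mul_comm (q.den * r.den), PosRat.num_mul]
      congr 1
      · rw [mul_comm q.den r.den, mul_assoc, mul_assoc, mul_assoc,
          mul_comm (q * r).den, mul_assoc]
      · rw [mul_comm]

lemma smul_mk (q : PosRat) (a : ℕ+) (w : WittPoints E) :
    q • mk a w = mk (a * q.den) (w.frob q.num) := rfl

/-- The point of `X₀` below a point of the colimit. -/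
def base : Leaf E → X₀ :=
  Quot.lift (fun z => z.2.base) (by
    rintro ⟨a, w⟩ _ ⟨μ, rfl⟩
    exact (WittPoints.base_frob μ w).symm)

lemma base_smul (q : PosRat) (z : Leaf E) : (q • z).base = z.base := by
  induction z using Quot.inductionOn with
  | h z => exact WittPoints.base_frob _ _

end Leaf

/-! ### The flow -/

/-- Positive rational numbers act on positive real numbers by multiplication. -/
instance : MulAction PosRat PosReal where
  smul q u := ⟨(q.1 : ℝ) * u.1, mul_pos (by exact_mod_cast q.2) u.2⟩
  one_smul u := Subtype.ext <| by
    change (((1 : ℚ) : ℝ)) * u.1 = u.1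
    simp
  mul_smul q r u := Subtype.ext <| by
    change (((q.1 * r.1 : ℚ) : ℝ)) * u.1 = q.1 * (r.1 * u.1)
    push_cast
    ring

/-- The quotient of `Leaf E × ℝ_{>0}` by the diagonal action of the positive rational numbers, with
the quotient topology. -/
abbrev FlowSpace : Type := MulAction.orbitRel.Quotient PosRat (Leaf E × PosReal)

instance : TopologicalSpace (FlowSpace E) :=
  inferInstanceAs (TopologicalSpace (_root_.Quotient _))

namespace FlowSpace

variable {E}

/-- The class `[P, u]`. -/
def mk (z : Leaf E) (u : PosReal) : FlowSpace E := _root_.Quotient.mk _ (z, u)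

/-- The flow `φ^t [P, u] = [P, e^t u]`. -/
def flow (t : ℝ) : FlowSpace E → FlowSpace E :=
  _root_.Quotient.map' (fun z => (z.1, ⟨Real.exp t * z.2.1, mul_pos (Real.exp_pos t) z.2.2⟩)) (by
    rintro _ ⟨z, u⟩ ⟨q, rfl⟩
    refine ⟨q, Prod.ext rfl (Subtype.ext ?_)⟩
    change (q.1 : ℝ) * (Real.exp t * u.1) = Real.exp t * (q.1 * u.1)
    ring)

/-- The point of `X₀` below a point of the flow space: `[F_a⁻¹ (x, P), u]` lies over the image of
`x` in `X₀`. -/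
def base : FlowSpace E → X₀ :=
  _root_.Quotient.lift (fun z => z.1.base) (by
    rintro _ ⟨z, u⟩ ⟨q, rfl⟩
    exact Leaf.base_smul q z)

lemma base_flow (t : ℝ) (z : FlowSpace E) : (z.flow t).base = z.base := by
  induction z using _root_.Quotient.inductionOn' with
  | h z => rfl

end FlowSpace

/-! ### The packets -/

/-- The packet over `x₀`: the set of all points of the flow space over `x₀`. -/
def packet (x₀ : X₀) : Set (FlowSpace E) := {z | z.base = x₀}

/-- The space of pairs `(x, P)` over `x₀` for which `P` is injective on the roots of unity. -/
abbrev InjPoints (x₀ : X₀) : Type :=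
  {p : E.Points // toBase X₀ K p.1.pt = x₀ ∧ Set.InjOn p.1.char {z | IsOfFinOrder z}}

/-- The packet over `x₀` as a space of its own, see below for its topology. -/
def Packet (x₀ : X₀) : Type := {z : FlowSpace E // z ∈ packet E x₀}

namespace Packet

variable {E} {x₀ : X₀}

/-- The inclusion into the flow space. -/
def incl (z : Packet E x₀) : FlowSpace E := z.1

/-- The map `((x, P), u) ↦ [(x, P), u]`. -/
def ofInj (z : InjPoints E x₀ × PosReal) : Packet E x₀ :=
  ⟨FlowSpace.mk (Leaf.mk 1 (WittPoints.mk z.1.1)) z.2, z.1.2.1⟩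

/-- The topology of the packet as a quotient of the space of pairs `((x, P), u)`, where `P` is
injective on the roots of unity and `u > 0`. -/
instance : TopologicalSpace (Packet E x₀) := TopologicalSpace.coinduced ofInj inferInstance

/-- The flow on the packet. -/
def flow (t : ℝ) (z : Packet E x₀) : Packet E x₀ :=
  ⟨z.1.flow t, (FlowSpace.base_flow t z.1).trans z.2⟩

end Packet

end System

/-! ### The base of the fibration -/

/-- The algebraic closure of the prime field with `p` elements. -/
abbrev FpBar (p : ℕ) [Fact p.Prime] : Type := AlgebraicClosure (ZMod p)

/-- The map that restricts a field automorphism to the multiplicative group. -/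
def autToUnits (p : ℕ) [Fact p.Prime] : RingAut (FpBar p) →* MulAut (FpBar p)ˣ where
  toFun σ := Units.mapEquiv σ.toMulEquiv
  map_one' := by ext; rfl
  map_mul' _ _ := by ext; rfl

/-- The topology of pointwise convergence on the automorphism group of the discrete group of units
of the algebraic closure of a finite field. -/
abbrev autUnitsTopology (p : ℕ) [Fact p.Prime] : TopologicalSpace (MulAut (FpBar p)ˣ) :=
  TopologicalSpace.induced (fun f z => f z)
    (@Pi.topologicalSpace (FpBar p)ˣ (fun _ => (FpBar p)ˣ) (fun _ => ⊥))

/-- The quotient of the group of automorphisms of the multiplicative group of the algebraic closure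
of the prime field by the group of field automorphisms. -/
def AutQuotient (p : ℕ) [Fact p.Prime] : Type := MulAut (FpBar p)ˣ ⧸ (autToUnits p).range

/-- The quotient topology. -/
instance (p : ℕ) [Fact p.Prime] : TopologicalSpace (AutQuotient p) :=
  TopologicalSpace.coinduced
    (QuotientGroup.mk : MulAut (FpBar p)ˣ → MulAut (FpBar p)ˣ ⧸ (autToUnits p).range)
    (autUnitsTopology p)

end ArithmeticFlow

end

/-! Over a closed point with residue field of `q = p ^ f` elements, every residue field of the
normalization is an algebraic closure of the prime field. Its multiplicative group is torsion, so
every character with finite kernel is admissible there. Such a character is an injective one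
composed with a power map `z ↦ z ^ c`, and the power map can be traded for a rescaling of `u`. Hence
every point of the packet is the class of some `((x, P), u)` with `P` injective
(`LiesOver.ofInj_surjective`).

Fix a homomorphism `ψ₀` from the sections over an affine open set to `FpBar p` over the point, and
an injective character `χ₀`. The Galois group is transitive on the points of the normalization over
the given one, and injective characters differ by automorphisms, so the packet is a quotient of
`Aut(FpBarˣ) × ℝ_{>0}` by way of `(α, u) ↦ [(ψ₀, χ₀ ∘ α), u]`. By `LiesOver.toPacket_eq_iff`, `(α,
u)` and `(β, v)` have the same image if and only if `β ^ (p ^ i) = (α ∘ γ) ^ (p ^ j)` and `p ^ j * u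
= p ^ i * v` for some `i`, `j` and some field automorphism `γ` that fixes the subfield with `q`
elements. Only powers of `p` occur: the exponents that relate two pairs have the same part prime to
`p`, as one sees on roots of unity, and this common part cancels.

It follows that the class of `α` modulo field automorphisms is an invariant, while `log u` is
defined modulo `log q` once it is corrected by a phase `c α` that grows by `log p` under Frobenius
(`FpBar.exists_phase`). The coordinates `([α], log u - c α)` identify the packet with the product of
`AutQuotient p` and the circle `ℝ / ℤ log q`; a continuous bijection from a compact to a Hausdorff
space is a homeomorphism, and the flow is translation on the circle (`LiesOver.exists_homeomorph`).
The fibration is therefore even globally trivial, and the claims on packets can be read off.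

Conversely, a periodic point yields `m ≠ n` with `F_m` and `F_n` equal on the class of a pair
(`isOfFinOrder_of_frob_eq`), that is, `P(b) ^ m = P(σ b) ^ n` for some Galois element `σ` and all
sections `b`. In characteristic zero, roots of unity of large order force `m = n`. In positive
characteristic, `σ` has finite orbits on sections, so iteration makes all values of `P` torsion.
Admissibility then makes the residue field torsion, and its point lies over a closed point. -/

noncomputable section

namespace ArithmeticFlow

/-! ### Equality in the colimit and in the flow space -/

section System

variable {X₀ : Scheme.{0}} [IsIntegral X₀] {K : Type} [Field K] [Algebra X₀.functionField K]
  {E : AdmissibleCondition X₀ K}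

namespace Leaf

/-- Two points of the colimit agree if and only if they agree at some common index. -/
lemma mk_eq_mk_iff {a b : ℕ+} {w v : WittPoints E} :
    mk a w = mk b v ↔ ∃ c d : ℕ+, a * c = b * d ∧ w.frob c = v.frob d := by
  constructor
  · intro h
    have key : ∀ y z : Σ _ : ℕ+, WittPoints E, Relation.EqvGen (colimRel E) y z →
        ∃ c d : ℕ+, y.1 * c = z.1 * d ∧ y.2.frob c = z.2.frob d := by
      intro y z hyz
      induction hyz with
      | rel y z h =>
        obtain ⟨μ, rfl⟩ := h
        exact ⟨μ, 1, by simp, by simp [WittPoints.frob_one]⟩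
      | refl y => exact ⟨1, 1, rfl, rfl⟩
      | symm y z _ ih =>
        obtain ⟨c, d, h1, h2⟩ := ih
        exact ⟨d, c, h1.symm, h2.symm⟩
      | trans x y z _ _ ih1 ih2 =>
        obtain ⟨c, d, h1, h2⟩ := ih1
        obtain ⟨c', d', h3, h4⟩ := ih2
        refine ⟨c' * c, d * d', ?_, ?_⟩
        · rw [mul_comm c' c, ← mul_assoc, h1, mul_right_comm, h3, mul_comm d d', mul_assoc]
        · rw [← WittPoints.frob_frob, h2, WittPoints.frob_frob, mul_comm c' d,
            ← WittPoints.frob_frob, h4, WittPoints.frob_frob]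
    exact key _ _ (Quot.eqvGen_exact h)
  · rintro ⟨c, d, h1, h2⟩
    rw [← mk_frob a c, ← mk_frob b d, h1, h2]

end Leaf

lemma WittPoints.mk_eq_mk_iff {p q : E.Points} :
    WittPoints.mk p = WittPoints.mk q ↔ ∃ σ : GalGroup X₀ K, q.1.map (galHom σ) = p.1 := by
  refine ⟨fun h => ?_, fun ⟨σ, h⟩ => ?_⟩
  · obtain ⟨σ, h⟩ := MulAction.orbitRel_apply.1 (_root_.Quotient.exact h)
    exact ⟨σ.unop, congrArg Subtype.val h⟩
  · exact _root_.Quotient.sound (MulAction.orbitRel_apply.2 ⟨MulOpposite.op σ, Subtype.ext h⟩)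

lemma WittPoints.mk_surjective : Function.Surjective (WittPoints.mk (E := E)) :=
  fun w => _root_.Quotient.exists_rep w

namespace FlowSpace

lemma mk_smul_smul (q : PosRat) (z : Leaf E) (u : PosReal) : mk (q • z) (q • u) = mk z u :=
  _root_.Quotient.sound (MulAction.orbitRel_apply.2 ⟨q, rfl⟩)

/-- The rational number that carries the second representative to the first is `m / n`. The fraction
need not be reduced: equality in the colimit holds only after a further Frobenius map, which
multiplies `m` and `n` by a common factor. -/
lemma mk_eq_mk_iff {w w' : WittPoints E} {u u' : PosReal} :
    mk (Leaf.mk 1 w) u = mk (Leaf.mk 1 w') u' ↔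
      ∃ m n : ℕ+, w'.frob m = w.frob n ∧ (n : ℝ) * u.1 = m * u'.1 := by
  constructor
  · intro h
    obtain ⟨r, h⟩ := MulAction.orbitRel_apply.1 (_root_.Quotient.exact h)
    have h1 : r • Leaf.mk 1 w' = Leaf.mk 1 w := congrArg Prod.fst h
    have h2 : (r.1 : ℝ) * u'.1 = u.1 := congrArg (fun x : Leaf E × PosReal => x.2.1) h
    rw [Leaf.smul_mk, Leaf.mk_eq_mk_iff] at h1
    obtain ⟨c, d, h3, h4⟩ := h1
    rw [one_mul, one_mul] at h3
    refine ⟨c * r.num, d, by rw [← WittPoints.frob_frob, h4], ?_⟩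
    rw [← h2, ← h3, ← r.num_div_den]
    have : ((r.den : ℕ) : ℝ) ≠ 0 := by exact_mod_cast r.den.ne_zero
    push_cast
    field_simp
  · rintro ⟨m, n, h1, h2⟩
    have hm : (0 : ℚ) < m := by exact_mod_cast m.pos
    have hn : (0 : ℚ) < n := by exact_mod_cast n.pos
    set r : PosRat := ⟨m / n, div_pos hm hn⟩ with hr
    have h3 : r.num * n = m * r.den := by
      have h := r.num_div_den
      have hd : ((r.den : ℕ) : ℚ) ≠ 0 := by exact_mod_cast r.den.ne_zero
      have hv : r.1 = (m : ℚ) / n := rfl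
      rw [hv, div_eq_div_iff hd hn.ne'] at h
      apply PNat.coe_injective
      exact_mod_cast h
    have h4 : r • Leaf.mk 1 w' = Leaf.mk 1 w := by
      rw [Leaf.smul_mk, Leaf.mk_eq_mk_iff]
      refine ⟨n, r.den * n, by rw [one_mul, one_mul], ?_⟩
      rw [WittPoints.frob_frob, mul_comm n, h3, mul_comm m, ← WittPoints.frob_frob, h1,
        WittPoints.frob_frob]
    have h5 : r • u' = u := by
      apply Subtype.ext
      change (((m : ℚ) / n : ℚ) : ℝ) * u'.1 = u.1
      have : ((n : ℕ) : ℝ) ≠ 0 := by exact_mod_cast n.ne_zero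
      push_cast
      field_simp
      linarith
    rw [← h4, ← h5, mk_smul_smul]

/-- The index `a` stands for `F_a⁻¹`, so the diagonal action of the integer `a` removes it at the
cost of replacing `u` by `a u`. -/
lemma exists_eq_mk (z : FlowSpace E) :
    ∃ (w : WittPoints E) (u : PosReal), z = mk (Leaf.mk 1 w) u := by
  induction z using _root_.Quotient.inductionOn' with
  | h z =>
    obtain ⟨l, u⟩ := z
    induction l using Quot.inductionOn with
    | h l =>
      obtain ⟨a, w⟩ := l
      have ha : (0 : ℚ) < a := by exact_mod_cast a.pos
      let r : PosRat := ⟨a, ha⟩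
      have h1 : r.num = a := by
        apply PNat.coe_injective
        simp [r, PosRat.num]
      have h2 : r.den = 1 := by
        apply PNat.coe_injective
        simp [r, PosRat.den]
      refine ⟨w, r • u, ?_⟩
      change mk (Leaf.mk a w) u = _
      rw [← mk_smul_smul r, Leaf.smul_mk, h1, h2, mul_one]
      congr 1
      conv_rhs => rw [← Leaf.mk_frob 1 a, one_mul]

lemma continuous_mk_points :
    Continuous fun y : E.Points × PosReal => mk (Leaf.mk 1 (WittPoints.mk y.1)) y.2 := by
  have h1 : Continuous (WittPoints.mk (E := E)) := continuous_quotient_mk'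
  have h2 : Continuous (Leaf.mk (E := E) 1) := continuous_quot_mk.comp continuous_sigmaMk
  have h3 : Continuous fun y : Leaf E × PosReal => mk y.1 y.2 := continuous_quotient_mk'
  exact h3.comp (((h2.comp h1).comp continuous_fst).prodMk continuous_snd)

end FlowSpace

namespace Packet

variable {x₀ : X₀}

lemma continuous_ofInj : Continuous (ofInj (E := E) (x₀ := x₀)) := continuous_coinduced_rng

lemma continuous_incl : Continuous (incl (E := E) (x₀ := x₀)) := by
  refine continuous_coinduced_dom.2 ?_
  exact FlowSpace.continuous_mk_points.comp
    ((continuous_subtype_val.comp continuous_fst).prodMk continuous_snd)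

lemma range_incl : Set.range (incl (E := E) (x₀ := x₀)) = packet E x₀ := Subtype.range_coe

end Packet

end System

/-! ### Characters of fields, extended by zero -/

section ExtendChar

variable {F F' : Type*} [Field F] [Field F']

/-- A character of the units of a field, extended by zero. -/
def extendChar (χ : Fˣ →* ℂˣ) (a : F) : ℂ :=
  open Classical in if h : a = 0 then 0 else (χ (Units.mk0 a h) : ℂ)

variable (χ : Fˣ →* ℂˣ)

@[simp] lemma extendChar_zero : extendChar χ 0 = 0 := by simp [extendChar]

@[simp] lemma extendChar_units (z : Fˣ) : extendChar χ z = χ z := by simp [extendChar]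

@[simp] lemma extendChar_eq_zero {a : F} : extendChar χ a = 0 ↔ a = 0 := by
  by_cases h : a = 0 <;> simp [extendChar, h]

@[simp] lemma extendChar_one : extendChar χ 1 = 1 := by
  simpa using extendChar_units χ 1

lemma extendChar_mul (a b : F) : extendChar χ (a * b) = extendChar χ a * extendChar χ b := by
  rcases eq_or_ne a 0 with rfl | ha
  · simp
  rcases eq_or_ne b 0 with rfl | hb
  · simp
  lift a to Fˣ using ha.isUnit
  lift b to Fˣ using hb.isUnit
  rw [← Units.val_mul, extendChar_units, extendChar_units, extendChar_units, map_mul, Units.val_mul]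

lemma extendChar_comp (f : F' →+* F) (a : F') :
    extendChar (χ.comp (Units.map (f : F' →* F))) a = extendChar χ (f a) := by
  rcases eq_or_ne a 0 with rfl | ha
  · simp
  lift a to F'ˣ using ha.isUnit
  rw [extendChar_units]
  exact (extendChar_units χ (Units.map (f : F' →* F) a)).symm

lemma extendChar_comp_pow (n : ℕ) (hn : n ≠ 0) (a : F) :
    extendChar (χ.comp (powMonoidHom n)) a = extendChar χ a ^ n := by
  rcases eq_or_ne a 0 with rfl | ha
  · simp [hn]
  lift a to Fˣ using ha.isUnit
  simp

end ExtendChar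

/-! ### Pairs as points with values of sections -/

namespace CharPoint

variable {X Y : Scheme.{0}}

lemma eval_eq (p : CharPoint X) (U : X.Opens) (h : p.pt ∈ U) (f : Γ(X, U)) :
    p.eval U h f = extendChar p.char (X.evaluation U p.pt h f) := rfl

lemma eval_eq_zero (p : CharPoint X) (U : X.Opens) (h : p.pt ∈ U) (f : Γ(X, U)) :
    p.eval U h f = 0 ↔ p.pt ∉ X.basicOpen f := by
  rw [eval_eq, extendChar_eq_zero, Scheme.evaluation_eq_zero_iff_notMem_basicOpen]

lemma eval_mul (p : CharPoint X) (U : X.Opens) (h : p.pt ∈ U) (f g : Γ(X, U)) :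
    p.eval U h (f * g) = p.eval U h f * p.eval U h g := by
  rw [eval_eq, map_mul, extendChar_mul, eval_eq, eval_eq]

lemma eval_one (p : CharPoint X) (U : X.Opens) (h : p.pt ∈ U) :
    p.eval U h 1 = 1 := by
  rw [eval_eq, map_one, extendChar_one]

lemma eval_pow (p : CharPoint X) (U : X.Opens) (h : p.pt ∈ U) (f : Γ(X, U)) (n : ℕ) :
    p.eval U h (f ^ n) = p.eval U h f ^ n := by
  induction n with
  | zero => simp [eval_one]
  | succ n ih => rw [pow_succ, eval_mul, ih, pow_succ]

lemma eval_res (p : CharPoint X) {U V : X.Opens} (hUV : U ≤ V) (h : p.pt ∈ U) (f : Γ(X, V)) :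
    p.eval U h (X.presheaf.map (homOfLE hUV).op f) = p.eval V (hUV h) f := by
  rw [eval_eq, eval_eq]
  congr 1
  simp only [Scheme.evaluation, CommRingCat.comp_apply]
  rw [TopCat.Presheaf.germ_res_apply]

lemma eval_map (p : CharPoint X) (h : X ⟶ Y) (U : Y.Opens) (hU : h p.pt ∈ U) (f : Γ(Y, U)) :
    (p.map h).eval U hU f = p.eval (h ⁻¹ᵁ U) hU (h.app U f) := by
  refine (extendChar_comp p.char (h.residueFieldMap p.pt).hom _).trans ?_
  exact congrArg (extendChar p.char) (Scheme.evaluation_naturality_apply h p.pt hU f)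

lemma eval_frob (p : CharPoint X) (ν : ℕ+) (U : X.Opens) (h : p.pt ∈ U) (f : Γ(X, U)) :
    (p.frob ν).eval U h f = p.eval U h f ^ (ν : ℕ) :=
  extendChar_comp_pow p.char ν ν.ne_zero _

lemma isOpen_eval (U : X.Opens) (f : Γ(X, U)) {V : Set ℂ} (hV : IsOpen V) :
    IsOpen {p : CharPoint X | ∃ h : p.pt ∈ U, p.eval U h f ∈ V} :=
  TopologicalSpace.isOpen_generateFrom_of_mem ⟨U, f, V, hV, rfl⟩

end CharPoint

/-- Points of an affine open set are determined by the basic open sets that contain them. -/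
lemma eq_of_forall_mem_basicOpen_iff {X : Scheme.{0}} {W : X.Opens} (hW : IsAffineOpen W) {x y : X}
    (hx : x ∈ W) (hy : y ∈ W) (h : ∀ f : Γ(X, W), x ∈ X.basicOpen f ↔ y ∈ X.basicOpen f) : x = y := by
  refine Inseparable.eq (inseparable_iff_forall_isOpen.2 fun V hV => ⟨fun hxV => ?_, fun hyV => ?_⟩)
  · obtain ⟨f, hf1, hf2⟩ := hW.exists_basicOpen_le (V := ⟨V, hV⟩) ⟨x, hxV⟩ hx
    exact hf1 ((h f).1 hf2)
  · obtain ⟨f, hf1, hf2⟩ := hW.exists_basicOpen_le (V := ⟨V, hV⟩) ⟨y, hyV⟩ hy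
    exact hf1 ((h f).2 hf2)

/-- Elements of the residue field at a point of an affine open set are quotients of values of
sections. -/
lemma exists_evaluation_div {X : Scheme.{0}} {W : X.Opens} (hW : IsAffineOpen W) {x : X}
    (hx : x ∈ W) (z : X.residueField x) :
    ∃ b c : Γ(X, W), X.evaluation W x hx c ≠ 0 ∧
      z * X.evaluation W x hx c = X.evaluation W x hx b := by
  obtain ⟨y, rfl⟩ := X.residue_surjective x z
  let := TopCat.Presheaf.algebra_section_stalk X.presheaf (⟨x, hx⟩ : W)
  have := hW.isLocalization_stalk ⟨x, hx⟩
  obtain ⟨⟨b, c⟩, h⟩ := IsLocalization.surj (hW.primeIdealOf ⟨x, hx⟩).asIdeal.primeCompl y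
  refine ⟨b, c, ?_, ?_⟩
  · have hc : IsUnit (X.presheaf.germ W x hx c) :=
      IsLocalization.map_units (X.presheaf.stalk x) c
    exact (hc.map (X.residue x).hom).ne_zero
  · have h' : y * X.presheaf.germ W x hx c = X.presheaf.germ W x hx b := h
    simp only [Scheme.evaluation, CommRingCat.comp_apply]
    rw [← h', map_mul]

namespace CharPoint

variable {X : Scheme.{0}} {W : X.Opens} (hW : IsAffineOpen W)
include hW

/-- Points over an affine open set are determined by the values of the sections. -/
lemma ext_of_eval {p q : CharPoint X} (hp : p.pt ∈ W) (hq : q.pt ∈ W)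
    (h : ∀ f, p.eval W hp f = q.eval W hq f) : p = q := by
  have hpt : p.pt = q.pt := eq_of_forall_mem_basicOpen_iff hW hp hq fun f => by
    rw [← not_iff_not, ← eval_eq_zero p W hp, h, eval_eq_zero]
  obtain ⟨x, P⟩ := p
  obtain ⟨y, Q⟩ := q
  obtain rfl : x = y := hpt
  congr 1
  ext z
  obtain ⟨b, c, hc, hz⟩ := exists_evaluation_div hW hp (z : X.residueField x)
  have h1 : extendChar P (X.evaluation W x hp b) = extendChar Q (X.evaluation W x hp b) := h b
  have h2 : extendChar P (X.evaluation W x hp c) = extendChar Q (X.evaluation W x hp c) := h c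
  rw [← hz, extendChar_mul, extendChar_mul, h2, extendChar_units, extendChar_units] at h1
  exact mul_right_cancel₀ (by simpa using hc) h1

/-- A map to the space of pairs over an affine open set is continuous if the values of all sections
are. -/
lemma continuous_of_eval {T : Type*} [TopologicalSpace T] {Θ : T → CharPoint X}
    (hΘ : ∀ t, (Θ t).pt ∈ W) (h : ∀ f, Continuous fun t => (Θ t).eval W (hΘ t) f) :
    Continuous Θ := by
  refine continuous_generateFrom_iff.2 ?_
  rintro _ ⟨U, f, V, hV, rfl⟩
  rw [isOpen_iff_mem_nhds]
  rintro t ⟨htU, ht⟩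
  -- On a basic open set of `g` around the point, `f` is a fraction `b / g ^ n`, so its value is a
  -- quotient of values of sections over `W`. Nearby points stay in this set because the value of
  -- `g` at `Θ t` is nonzero.
  obtain ⟨g, hgU, hg⟩ := hW.exists_basicOpen_le (V := U) ⟨(Θ t).pt, htU⟩ (hΘ t)
  have := hW.isLocalization_basicOpen g
  obtain ⟨⟨b, ⟨_, n, rfl⟩⟩, hb⟩ := IsLocalization.surj (Submonoid.powers g)
    (X.presheaf.map (homOfLE hgU).op f)
  have hb' : X.presheaf.map (homOfLE hgU).op f *
      X.presheaf.map (homOfLE (X.basicOpen_le g)).op (g ^ n) =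
      X.presheaf.map (homOfLE (X.basicOpen_le g)).op b := hb
  have key : ∀ s, (Θ s).eval W (hΘ s) g ≠ 0 → ∃ hs : (Θ s).pt ∈ U,
      (Θ s).eval U hs f = (Θ s).eval W (hΘ s) b / (Θ s).eval W (hΘ s) g ^ n := by
    intro s hs
    have hsg : (Θ s).pt ∈ X.basicOpen g := by
      by_contra hn
      exact hs ((eval_eq_zero _ _ _ _).2 hn)
    refine ⟨hgU hsg, ?_⟩
    rw [eq_div_iff (pow_ne_zero n hs), ← eval_pow, ← eval_res _ hgU hsg,
      ← eval_res _ (X.basicOpen_le g) hsg, ← eval_res _ (X.basicOpen_le g) hsg, ← hb', eval_mul]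
  have ht0 : (Θ t).eval W (hΘ t) g ≠ 0 := fun h0 => (eval_eq_zero _ _ _ _).1 h0 hg
  have hc : ContinuousAt (fun s => (Θ s).eval W (hΘ s) b / (Θ s).eval W (hΘ s) g ^ n) t :=
    (h b).continuousAt.div ((h g).continuousAt.pow n) (pow_ne_zero n ht0)
  obtain ⟨ht', hval⟩ := key t ht0
  have hmem := hc.preimage_mem_nhds (hV.mem_nhds (hval ▸ ht))
  filter_upwards [hmem, (h g).continuousAt.preimage_mem_nhds (isOpen_ne.mem_nhds ht0)] with s h1 h2
  obtain ⟨hsU, hs⟩ := key s h2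
  exact ⟨hsU, by rw [hs]; exact h1⟩

/-- The pairs over an affine open set form a Hausdorff space. -/
lemma t2Space_of_isAffineOpen {T : Type*} [TopologicalSpace T] {Θ : T → CharPoint X}
    (hc : Continuous Θ) (hinj : Function.Injective Θ) (hΘ : ∀ t, (Θ t).pt ∈ W) : T2Space T := by
  refine ⟨fun s t hst => ?_⟩
  obtain ⟨f, hf⟩ : ∃ f, (Θ s).eval W (hΘ s) f ≠ (Θ t).eval W (hΘ t) f := by
    by_contra! hn
    exact hst (hinj (ext_of_eval hW (hΘ s) (hΘ t) hn))
  obtain ⟨V, V', hV, hV', h1, h2, hd⟩ := t2_separation hf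
  refine ⟨_, _, (isOpen_eval W f hV).preimage hc, (isOpen_eval W f hV').preimage hc,
    ⟨hΘ s, h1⟩, ⟨hΘ t, h2⟩, ?_⟩
  rw [Set.disjoint_left]
  rintro r ⟨h3, h4⟩ ⟨_, h5⟩
  exact Set.disjoint_left.1 hd h4 h5

end CharPoint

/-! ### Pairs given by points with values in a field -/

section OfField

variable {X : Scheme.{0}} {W : X.Opens} (hW : IsAffineOpen W) {F : Type} [Field F]

/-- The field-valued point of a scheme given by a homomorphism from the ring of sections over an
affine open set. -/
def fieldPoint (ψ : Γ(X, W) →+* F) : Spec (.of F) ⟶ X :=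
  Spec.map (CommRingCat.ofHom ψ) ≫ hW.fromSpec

lemma fieldPoint_mem (ψ : Γ(X, W) →+* F) (y : Spec (.of F)) : fieldPoint hW ψ y ∈ W := by
  have h : hW.fromSpec (Spec.map (CommRingCat.ofHom ψ) y) ∈ Set.range hW.fromSpec := ⟨_, rfl⟩
  rw [hW.range_fromSpec] at h
  exact h

/-- The embedding of the residue field that belongs to a field-valued point. -/
def fieldPointMap (ψ : Γ(X, W) →+* F) :
    X.residueField (fieldPoint hW ψ (IsLocalRing.closedPoint F)) →+* F :=
  (X.descResidueField (Scheme.stalkClosedPointTo (fieldPoint hW ψ))).hom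

lemma fieldPointMap_evaluation (ψ : Γ(X, W) →+* F) (b : Γ(X, W)) :
    fieldPointMap hW ψ (X.evaluation W _ (fieldPoint_mem hW ψ _) b) = ψ b := by
  have h : X.evaluation W _ (fieldPoint_mem hW ψ _) ≫
      X.descResidueField (Scheme.stalkClosedPointTo (fieldPoint hW ψ)) = CommRingCat.ofHom ψ := by
    -- The two ring maps are compared after `Spec` and the monomorphism `hW.fromSpec`, where both
    -- become `fieldPoint hW ψ`.
    rw [Scheme.evaluation, Category.assoc, Scheme.residue_descResidueField, ← Spec.map_inj,
      ← cancel_mono hW.fromSpec, Spec.map_comp, Category.assoc]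
    have h1 := Scheme.Spec_stalkClosedPointTo_fromSpecStalk (fieldPoint hW ψ)
    have h2 := hW.fromSpecStalk_eq_fromSpecStalk (fieldPoint_mem hW ψ (IsLocalRing.closedPoint F))
    refine (congrArg (Spec.map (Scheme.stalkClosedPointTo (fieldPoint hW ψ)) ≫ ·) ?_).trans h1
    exact h2
  exact congr($h b)

/-- The pair given by a homomorphism to a field and a character of its group of units. -/
def CharPoint.ofHom (ψ : Γ(X, W) →+* F) (χ : Fˣ →* ℂˣ) : CharPoint X where
  pt := fieldPoint hW ψ (IsLocalRing.closedPoint F)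
  char := χ.comp (Units.map (fieldPointMap hW ψ : _ →* F))

lemma CharPoint.ofHom_mem (ψ : Γ(X, W) →+* F) (χ : Fˣ →* ℂˣ) : (ofHom hW ψ χ).pt ∈ W :=
  fieldPoint_mem hW ψ _

lemma CharPoint.eval_ofHom (ψ : Γ(X, W) →+* F) (χ : Fˣ →* ℂˣ) (b : Γ(X, W)) :
    (ofHom hW ψ χ).eval W (ofHom_mem hW ψ χ) b = extendChar χ (ψ b) := by
  rw [eval_eq, ← fieldPointMap_evaluation hW ψ b]
  exact extendChar_comp χ (fieldPointMap hW ψ) _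

end OfField

/-! ### Fields whose multiplicative group is torsion -/

section Torsion

variable {L M : Type*} [Field L] [Field M]

lemma isOfFinOrder_units_of_isIntegral (k : Type*) [Field k] [Finite k] [Algebra k L]
    [Algebra.IsIntegral k L] (z : Lˣ) : IsOfFinOrder z := by
  have hz : IsIntegral k (z : L) := Algebra.IsIntegral.isIntegral _
  have := IntermediateField.adjoin.finiteDimensional hz
  have : Finite (IntermediateField.adjoin k {(z : L)}) := Module.finite_of_finite k
  let y : IntermediateField.adjoin k {(z : L)} :=
    ⟨z, IntermediateField.mem_adjoin_simple_self k (z : L)⟩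
  have hy : y ≠ 0 := fun h => z.ne_zero (congrArg Subtype.val h)
  have h1 : IsOfFinOrder (Units.mk0 y hy) := isOfFinOrder_of_finite _
  have h2 := MonoidHom.isOfFinOrder (Units.map (algebraMap (IntermediateField.adjoin k {(z : L)}) L : _ →* L)) h1
  have h3 : Units.map (algebraMap (IntermediateField.adjoin k {(z : L)}) L : _ →* L)
      (Units.mk0 y hy) = z := Units.ext rfl
  rwa [h3] at h2

/-- In a field `X ^ n - 1` has at most `n` roots, so an element of order `n` generates all of them.
For torsion `Lˣ`, every endomorphism is therefore a power map on each cyclic subgroup. -/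
lemma exists_pow_eq_of_pow_orderOf_eq_one {z w : Lˣ} (hz : IsOfFinOrder z)
    (hw : w ^ orderOf z = 1) : ∃ i : ℕ, w = z ^ i := by
  have : NeZero (orderOf z) := ⟨hz.orderOf_pos.ne'⟩
  obtain ⟨i, -, hi⟩ := (IsPrimitiveRoot.coe_units_iff.2 (IsPrimitiveRoot.orderOf z)).eq_pow_of_pow_eq_one
    (ξ := (w : L)) (by rw [← Units.val_pow_eq_pow_val, hw, Units.val_one])
  exact ⟨i, Units.ext (by rw [← hi, Units.val_pow_eq_pow_val])⟩

lemma exists_map_eq_pow (hL : ∀ z : Lˣ, IsOfFinOrder z) (f : Lˣ →* Lˣ) (z : Lˣ) :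
    ∃ i : ℕ, f z = z ^ i :=
  exists_pow_eq_of_pow_orderOf_eq_one (hL z) (by rw [← map_pow, pow_orderOf_eq_one, map_one])

/-- Power maps commute. This is why the group of field automorphisms is normal in the group of
automorphisms of the units. -/
lemma monoidHom_comm (hL : ∀ z : Lˣ, IsOfFinOrder z) (f g : Lˣ →* Lˣ) (z : Lˣ) :
    f (g z) = g (f z) := by
  obtain ⟨i, hi⟩ := exists_map_eq_pow hL f z
  obtain ⟨j, hj⟩ := exists_map_eq_pow hL g z
  rw [hj, hi, map_pow, map_pow, hi, hj, ← pow_mul, ← pow_mul, mul_comm]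

/-- The image of an injective character contains all values of other characters. -/
lemma exists_char_eq (hL : ∀ z : Lˣ, IsOfFinOrder z) {χ : Lˣ →* Mˣ}
    (hχ : Function.Injective χ) (χ' : Lˣ →* Mˣ) (z : Lˣ) : ∃ w, χ w = χ' z := by
  obtain ⟨i, hi⟩ := exists_pow_eq_of_pow_orderOf_eq_one (z := χ z) (w := χ' z)
    (χ.isOfFinOrder (hL z)) (by rw [orderOf_injective χ hχ, ← map_pow, pow_orderOf_eq_one, map_one])
  exact ⟨z ^ i, by rw [map_pow, hi]⟩

lemma bijective_of_injective_monoidHom (hL : ∀ z : Lˣ, IsOfFinOrder z) {f : Lˣ →* Lˣ}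
    (hf : Function.Injective f) : Function.Bijective f :=
  ⟨hf, fun z => exists_char_eq hL hf (MonoidHom.id _) z⟩

/-- Injective characters differ by automorphisms. -/
lemma exists_mulAut_char (hL : ∀ z : Lˣ, IsOfFinOrder z) {χ χ' : Lˣ →* Mˣ}
    (hχ : Function.Injective χ) (hχ' : Function.Injective χ') :
    ∃ α : MulAut Lˣ, ∀ z, χ' z = χ (α z) := by
  choose f hf using exists_char_eq hL hχ χ'
  let g : Lˣ →* Lˣ := MonoidHom.mk' f fun a b => hχ (by rw [hf, map_mul, map_mul, hf, hf])
  have hg : Function.Injective g := fun a b hab => hχ' (by rw [← hf, ← hf]; exact congrArg χ hab)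
  exact ⟨MulEquiv.ofBijective g (bijective_of_injective_monoidHom hL hg), fun z => (hf z).symm⟩

/-- A finite subgroup of the units of a field consists of all elements whose order divides its
order. -/
lemma mem_iff_pow_card_eq_one (H : Subgroup Lˣ) [Finite H] (z : Lˣ) :
    z ∈ H ↔ z ^ Nat.card H = 1 := by
  constructor
  · intro hz
    exact congrArg Subtype.val (pow_card_eq_one' (x := (⟨z, hz⟩ : H)))
  · intro hz
    have : NeZero (Nat.card H) := ⟨Nat.card_pos.ne'⟩
    have hle : H ≤ rootsOfUnity (Nat.card H) L := fun w hw => by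
      rw [mem_rootsOfUnity]
      exact congrArg Subtype.val (pow_card_eq_one' (x := (⟨w, hw⟩ : H)))
    have : Nat.card (rootsOfUnity (Nat.card H) L) ≤ Nat.card H :=
      card_rootsOfUnity L (Nat.card H)
    rw [Subgroup.eq_of_le_of_card_ge hle this]
    exact hz

end Torsion

/-! ### Automorphisms of the multiplicative group of `FpBar p` -/

section MulAut

variable (p : ℕ) [Fact p.Prime]

lemma FpBar.isOfFinOrder (z : (FpBar p)ˣ) : IsOfFinOrder z :=
  isOfFinOrder_units_of_isIntegral (ZMod p) z

lemma FpBar.mulAut_mul_comm (α β : MulAut (FpBar p)ˣ) : α * β = β * α :=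
  MulEquiv.ext fun z => monoidHom_comm (FpBar.isOfFinOrder p) α.toMonoidHom β.toMonoidHom z

instance FpBar.normal (N : Subgroup (MulAut (FpBar p)ˣ)) : N.Normal :=
  ⟨fun n hn g => by rwa [mulAut_mul_comm, inv_mul_cancel_left]⟩

attribute [local instance] autUnitsTopology

local instance : TopologicalSpace (FpBar p)ˣ := ⊥

local instance : DiscreteTopology (FpBar p)ˣ := ⟨rfl⟩

lemma FpBar.isInducing_coe :
    IsInducing (fun (f : MulAut (FpBar p)ˣ) (z : (FpBar p)ˣ) => f z) := ⟨rfl⟩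

lemma FpBar.continuous_apply (z : (FpBar p)ˣ) : Continuous fun f : MulAut (FpBar p)ˣ => f z :=
  (_root_.continuous_apply z).comp (isInducing_coe p).continuous

lemma FpBar.continuous_of_apply {T : Type*} [TopologicalSpace T] {f : T → MulAut (FpBar p)ˣ}
    (h : ∀ z, Continuous fun t => f t z) : Continuous f :=
  (isInducing_coe p).continuous_iff.2 (continuous_pi h)

instance : T2Space (MulAut (FpBar p)ˣ) :=
  T2Space.of_injective_continuous (fun _ _ h => MulEquiv.ext (congrFun h))
    (FpBar.isInducing_coe p).continuous

/-- Automorphisms preserve orders, and only finitely many elements have a given order. The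
automorphisms are thus the multiplicative maps in a product of finite sets, and multiplicativity is
a closed condition. Preserving orders gives injectivity, and surjectivity follows by
`bijective_of_injective_monoidHom`. -/
instance : CompactSpace (MulAut (FpBar p)ˣ) := by
  have hL := FpBar.isOfFinOrder p
  rw [← isCompact_univ_iff, (FpBar.isInducing_coe p).isCompact_iff]
  have hC : IsCompact (Set.pi Set.univ fun z : (FpBar p)ˣ => {w : (FpBar p)ˣ | orderOf w = orderOf z}) := by
    refine isCompact_univ_pi fun z => Set.Finite.isCompact ?_
    have : NeZero (orderOf z) := ⟨(hL z).orderOf_pos.ne'⟩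
    have hfin : Finite (rootsOfUnity (orderOf z) (FpBar p)) := inferInstance
    refine (Set.finite_coe_iff.1 hfin).subset ?_
    intro w hw
    rw [SetLike.mem_coe, mem_rootsOfUnity, ← (hw : orderOf w = orderOf z), pow_orderOf_eq_one]
  have hD : IsClosed {f : (FpBar p)ˣ → (FpBar p)ˣ | ∀ a b, f (a * b) = f a * f b} := by
    simp only [Set.ofPred_forall]
    refine isClosed_iInter fun a => isClosed_iInter fun b => isClosed_eq (_root_.continuous_apply _) ?_
    have h2 : Continuous fun x : (FpBar p)ˣ × (FpBar p)ˣ => x.1 * x.2 :=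
      continuous_of_discreteTopology
    have h3 : Continuous fun f : (FpBar p)ˣ → (FpBar p)ˣ => (f a, f b) :=
      (_root_.continuous_apply a).prodMk (_root_.continuous_apply b)
    exact h2.comp h3
  convert! hC.inter_right hD using 1
  ext f
  constructor
  · rintro ⟨α, -, rfl⟩
    exact ⟨fun z _ => α.orderOf_eq z, map_mul α⟩
  · rintro ⟨h1, h2⟩
    let g : (FpBar p)ˣ →* (FpBar p)ˣ := MonoidHom.mk' f h2
    have hg : Function.Injective g := (injective_iff_map_eq_one g).2 fun a ha => by
      have h3 : orderOf (g a) = orderOf a := h1 a trivial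
      rwa [ha, orderOf_one, eq_comm, orderOf_eq_one_iff] at h3
    exact ⟨MulEquiv.ofBijective g (bijective_of_injective_monoidHom hL hg), trivial, rfl⟩

instance : IsTopologicalGroup (MulAut (FpBar p)ˣ) where
  continuous_mul := by
    refine FpBar.continuous_of_apply p fun z => ?_
    rw [continuous_discrete_rng]
    intro w
    rw [isOpen_iff_mem_nhds]
    rintro ⟨f, g⟩ h
    have h1 := (isOpen_discrete {g z}).preimage (FpBar.continuous_apply p z)
    have h2 := (isOpen_discrete {f (g z)}).preimage (FpBar.continuous_apply p (g z))
    filter_upwards [(h2.prod h1).mem_nhds ⟨rfl, rfl⟩]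
    rintro ⟨f', g'⟩ ⟨h3, h4⟩
    have h : f (g z) = w := h
    have h3 : f' (g z) = f (g z) := h3
    have h4 : g' z = g z := h4
    change f' (g' z) = w
    rw [h4, h3, h]
  continuous_inv := by
    refine FpBar.continuous_of_apply p fun z => ?_
    rw [continuous_discrete_rng]
    intro w
    convert! (isOpen_discrete {z}).preimage (FpBar.continuous_apply p w) using 1
    ext f
    change f.symm z = w ↔ f w = z
    rw [MulEquiv.symm_apply_eq, eq_comm]

/-- An automorphism of an algebraic extension has an open neighbourhood on which the image of a
given element does not change. -/
lemma isOpen_apply_eq (k K : Type*) [Field k] [Field K] [Algebra k K] [Algebra.IsIntegral k K]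
    (x y : K) : IsOpen {σ : K ≃ₐ[k] K | σ x = y} := by
  rw [isOpen_iff_mem_nhds]
  intro σ hσ
  have h := ((stabilizer_isOpen_of_isIntegral (K := k) x).preimage
    (continuous_const_mul σ⁻¹)).mem_nhds (x := σ) (by simp)
  filter_upwards [h] with τ hτ
  have h1 : σ⁻¹ (τ x) = x := hτ
  have h2 : σ x = y := hσ
  change τ x = y
  rw [← h2, ← congrArg σ h1]
  exact (σ.apply_symm_apply _).symm

/-- Field automorphisms fix the prime field, so the range is a continuous image of a profinite
Galois group, hence compact in a Hausdorff space. -/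
lemma isClosed_range_autToUnits : IsClosed ((autToUnits p).range : Set (MulAut (FpBar p)ˣ)) := by
  let r : (FpBar p ≃ₐ[ZMod p] FpBar p) → MulAut (FpBar p)ˣ :=
    fun σ => autToUnits p σ.toRingEquiv
  have hr : Continuous r := by
    refine FpBar.continuous_of_apply p fun z => ?_
    rw [continuous_discrete_rng]
    intro w
    convert! isOpen_apply_eq (ZMod p) (FpBar p) z w using 1
    ext σ
    exact Units.ext_iff
  have : Set.range r = ((autToUnits p).range : Set (MulAut (FpBar p)ˣ)) := by
    ext α
    constructor
    · rintro ⟨σ, rfl⟩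
      exact ⟨_, rfl⟩
    · rintro ⟨σ, rfl⟩
      exact ⟨AlgEquiv.ofRingEquiv (f := σ) (fun x => by
        exact congrArg (fun f : ZMod p →+* FpBar p => f x) (Subsingleton.elim
          ((σ : FpBar p →+* FpBar p).comp (algebraMap (ZMod p) (FpBar p)))
          (algebraMap (ZMod p) (FpBar p)))), rfl⟩
  rw [← this]
  exact (isCompact_range hr).isClosed

/-- The projection to the quotient of the group of automorphisms. -/
def AutQuotient.mk (α : MulAut (FpBar p)ˣ) : AutQuotient p := QuotientGroup.mk α

lemma AutQuotient.continuous_mk : Continuous (AutQuotient.mk p) := continuous_coinduced_rng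

lemma AutQuotient.mk_surjective : Function.Surjective (AutQuotient.mk p) :=
  QuotientGroup.mk_surjective

lemma AutQuotient.mk_eq_mk_iff {α β : MulAut (FpBar p)ˣ} :
    AutQuotient.mk p α = AutQuotient.mk p β ↔ ∃ σ, β = α * autToUnits p σ := by
  refine QuotientGroup.eq.trans ?_
  constructor
  · rintro ⟨σ, hσ⟩
    exact ⟨σ, by rw [hσ, mul_inv_cancel_left]⟩
  · rintro ⟨σ, rfl⟩
    exact ⟨σ, by rw [inv_mul_cancel_left]⟩

instance : CompactSpace (AutQuotient p) :=
  inferInstanceAs (CompactSpace (MulAut (FpBar p)ˣ ⧸ (autToUnits p).range))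

instance : T2Space (AutQuotient p) := by
  have := isClosed_range_autToUnits p
  exact inferInstanceAs (T2Space (MulAut (FpBar p)ˣ ⧸ (autToUnits p).range))

end MulAut

/-! ### Characters of the units of `FpBar p` -/

section Characters

variable {L : Type*} [Field L]

/-- If a homomorphism has finite kernel on the roots of unity, then this kernel consists of all
roots of unity of some fixed order. -/
lemma exists_pow_eq_one_iff_of_finite {N : Type*} [Group N] (χ : Lˣ →* N)
    (h : {z | IsOfFinOrder z ∧ χ z = 1}.Finite) :
    ∃ c : ℕ, 0 < c ∧ ∀ z, IsOfFinOrder z → (χ z = 1 ↔ z ^ c = 1) := by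
  let H : Subgroup Lˣ := CommGroup.torsion Lˣ ⊓ χ.ker
  have : Finite H := h
  refine ⟨Nat.card H, Nat.card_pos, fun z hz => ?_⟩
  rw [← mem_iff_pow_card_eq_one H]
  exact ⟨fun h1 => ⟨hz, h1⟩, fun h1 => h1.2⟩

variable (p : ℕ) [hp : Fact p.Prime]

lemma FpBar.exists_pow_eq (z : (FpBar p)ˣ) {n : ℕ} (hn : 0 < n) : ∃ w : (FpBar p)ˣ, w ^ n = z := by
  obtain ⟨w, hw⟩ := IsAlgClosed.exists_pow_nat_eq (z : FpBar p) hn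
  have hw0 : w ≠ 0 := by
    rintro rfl
    rw [zero_pow hn.ne'] at hw
    exact z.ne_zero hw.symm
  exact ⟨Units.mk0 w hw0, Units.ext hw⟩

/-- A character with finite kernel is the composition of a power map and an injective character. -/
lemma FpBar.exists_injective_comp_pow {N : Type*} [Group N] (χ : (FpBar p)ˣ →* N)
    (h : {z | χ z = 1}.Finite) :
    ∃ (c : ℕ+) (χ' : (FpBar p)ˣ →* N), Function.Injective χ' ∧ ∀ z, χ z = χ' (z ^ (c : ℕ)) := by
  obtain ⟨c, hc, hχ⟩ := exists_pow_eq_one_iff_of_finite χ (h.subset fun z hz => hz.2)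
  replace hχ := fun z => hχ z (FpBar.isOfFinOrder p z)
  choose r hr using fun z : (FpBar p)ˣ => exists_pow_eq p z hc
  have key : ∀ z w, z ^ c = w ^ c → χ z = χ w := fun z w hzw => by
    rw [← div_eq_one, ← map_div, hχ, div_pow, hzw, div_self']
  -- The value of `χ'` at `z` is that of `χ` at any `c`-th root of `z`; the choice does not matter
  -- because the kernel of `χ` consists of the `c`-th roots of unity.
  let χ' : (FpBar p)ˣ →* N := MonoidHom.mk' (fun z => χ (r z)) fun a b => by
    rw [← map_mul]
    exact key _ _ (by rw [hr, mul_pow, hr, hr])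
  refine ⟨⟨c, hc⟩, χ', (injective_iff_map_eq_one _).2 fun z hz => ?_, fun z => key _ _ (hr _).symm⟩
  rw [← hr z, ← hχ]
  exact hz

/-- The multiplicative group of an algebraic closure of a finite field embeds into that of the
complex numbers. -/
lemma FpBar.exists_injective_char : ∃ χ : (FpBar p)ˣ →* ℂˣ, Function.Injective χ := by
  -- Teichmüller representatives embed the units into the fraction field of the Witt vectors, which
  -- has characteristic zero. Their images are roots of unity, hence lie in the subfield of elements
  -- algebraic over `ℚ`, and this subfield embeds into `ℂ`.
  let T := WittVector p (FpBar p)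
  have hT : CharZero T := by
    have hpT : (p : T) ≠ 0 := WittVector.p_nonzero p (FpBar p)
    obtain ⟨ℓ, hℓ⟩ := CharP.exists T
    rcases CharP.char_is_prime_or_zero T ℓ with h | rfl
    · exfalso
      have h1 : (ℓ : T) = 0 := CharP.cast_eq_zero T ℓ
      have h2 : (ℓ : FpBar p) = 0 := by
        rw [← map_natCast (WittVector.constantCoeff (p := p) (R := FpBar p)), h1, map_zero]
      rw [CharP.cast_eq_zero_iff (FpBar p) p, Nat.prime_dvd_prime_iff_eq hp.out h] at h2
      exact hpT (h2 ▸ h1)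
    · exact CharP.charP_to_charZero T
  let Q := FractionRing T
  have : CharZero Q := charZero_of_injective_algebraMap (IsFractionRing.injective T Q)
  let A := algebraicClosure ℚ Q
  let f : (FpBar p)ˣ →* Q :=
    ((algebraMap T Q : T →* Q).comp (WittVector.teichmuller p)).comp (Units.coeHom (FpBar p))
  have hf : Function.Injective f := fun a b hab => by
    have h1 := IsFractionRing.injective T Q hab
    have h2 : (WittVector.teichmuller p (a : FpBar p)).coeff 0 =
        (WittVector.teichmuller p (b : FpBar p)).coeff 0 := congrArg (fun x : T => x.coeff 0) h1
    rw [WittVector.teichmuller_coeff_zero, WittVector.teichmuller_coeff_zero] at h2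
    exact Units.ext h2
  have hfA : ∀ z, f z ∈ A.toSubfield.toSubmonoid := fun z => by
    have h1 : IsOfFinOrder (f z) := f.isOfFinOrder (FpBar.isOfFinOrder p z)
    obtain ⟨n, hn, h2⟩ := isOfFinOrder_iff_pow_eq_one.1 h1
    have h3 : IsIntegral ℚ (f z) := IsIntegral.of_pow hn (by rw [h2]; exact isIntegral_one)
    exact mem_algebraicClosure_iff.2 h3.isAlgebraic
  let g : (FpBar p)ˣ →* A := f.codRestrict A.toSubfield.toSubmonoid hfA
  have hg : Function.Injective g := fun a b hab => hf (congrArg Subtype.val hab)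
  have : Algebra.IsAlgebraic ℚ A := algebraicClosure.isAlgebraic ℚ Q
  let φ : A →ₐ[ℚ] ℂ := IsAlgClosed.lift
  refine ⟨((φ : A →* ℂ).comp g).toHomUnits, fun a b hab => hg (φ.injective ?_)⟩
  exact congrArg Units.val hab

lemma FpBar.exists_orderOf_eq {n : ℕ} (hn : ¬ p ∣ n) : ∃ z : (FpBar p)ˣ, orderOf z = n := by
  have : NeZero (n : FpBar p) := ⟨fun h => hn ((CharP.cast_eq_zero_iff (FpBar p) p n).1 h)⟩
  obtain ⟨ζ, hζ⟩ := HasEnoughRootsOfUnity.exists_primitiveRoot (FpBar p) n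
  have hn0 : n ≠ 0 := by
    rintro rfl
    exact hn (dvd_zero p)
  lift ζ to (FpBar p)ˣ using hζ.isUnit hn0
  exact ⟨ζ, (IsPrimitiveRoot.coe_units_iff.1 hζ).eq_orderOf.symm⟩

/-- Injective endomorphisms whose powers with different exponents agree. -/
lemma FpBar.exists_pow_prime_of_pow_eq_pow {β γ : (FpBar p)ˣ →* (FpBar p)ˣ}
    (hβ : Function.Injective β) (hγ : Function.Injective γ) {m n : ℕ} (hm : 0 < m) (hn : 0 < n)
    (h : ∀ z, β z ^ m = γ z ^ n) :
    ∃ i j k : ℕ, 0 < k ∧ m = p ^ i * k ∧ n = p ^ j * k ∧ ∀ z, β z ^ p ^ i = γ z ^ p ^ j := by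
  have key : ∀ z : (FpBar p)ˣ, z ^ m = 1 ↔ z ^ n = 1 := fun z => by
    rw [← (injective_iff_map_eq_one' β).1 hβ, map_pow, h, ← map_pow,
      (injective_iff_map_eq_one' γ).1 hγ]
  obtain ⟨i, m', hm', rfl⟩ := Nat.exists_eq_pow_mul_and_not_dvd hm.ne' p hp.out.ne_one
  obtain ⟨j, n', hn', rfl⟩ := Nat.exists_eq_pow_mul_and_not_dvd hn.ne' p hp.out.ne_one
  -- An element whose order is the part prime to `p` of one exponent shows, by `key`, that this part
  -- divides the other exponent.
  have e : m' = n' := by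
    apply Nat.dvd_antisymm
    · obtain ⟨z, hz⟩ := exists_orderOf_eq p hm'
      have h1 := (key z).1 (orderOf_dvd_iff_pow_eq_one.1 (hz ▸ Dvd.intro_left _ rfl))
      rw [← orderOf_dvd_iff_pow_eq_one, hz] at h1
      exact (((Nat.Prime.coprime_iff_not_dvd hp.out).2 hm').symm.pow_right j).dvd_of_dvd_mul_left h1
    · obtain ⟨z, hz⟩ := exists_orderOf_eq p hn'
      have h1 := (key z).2 (orderOf_dvd_iff_pow_eq_one.1 (hz ▸ Dvd.intro_left _ rfl))
      rw [← orderOf_dvd_iff_pow_eq_one, hz] at h1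
      exact (((Nat.Prime.coprime_iff_not_dvd hp.out).2 hn').symm.pow_right i).dvd_of_dvd_mul_left h1
  subst e
  have hm0 : 0 < m' := Nat.pos_of_mul_pos_left hm
  refine ⟨i, j, m', hm0, rfl, rfl, fun z => ?_⟩
  -- Every element is an `m'`-th power, so the common factor `m'` of the exponents cancels.
  obtain ⟨w, rfl⟩ := exists_pow_eq p z hm0
  have h1 := h w
  rw [map_pow, map_pow, ← pow_mul, ← pow_mul, mul_comm m', mul_comm m', h1]

/-- Automorphisms of `FpBar p` act on finite subfields as powers of the Frobenius. -/
lemma FpBar.exists_ringAut_apply_eq_pow (g : RingAut (FpBar p)) (x : FpBar p) :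
    ∃ d : ℕ, g x = x ^ p ^ d := by
  let σ : FpBar p ≃ₐ[ZMod p] FpBar p := AlgEquiv.ofRingEquiv (f := g) fun x =>
    congrArg (fun f : ZMod p →+* FpBar p => f x) (Subsingleton.elim
      ((g : FpBar p →+* FpBar p).comp (algebraMap (ZMod p) (FpBar p)))
      (algebraMap (ZMod p) (FpBar p)))
  have hx : IsIntegral (ZMod p) x := Algebra.IsIntegral.isIntegral _
  let k := IntermediateField.adjoin (ZMod p) {x}
  have : FiniteDimensional (ZMod p) k := IntermediateField.adjoin.finiteDimensional hx
  have : Finite k := Module.finite_of_finite (ZMod p)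
  obtain ⟨d, hd⟩ := (FiniteField.bijective_frobeniusAlgEquivOfAlgebraic_pow (ZMod p) k).2
    (σ.restrictNormal k)
  let y : k := ⟨x, IntermediateField.mem_adjoin_simple_self (ZMod p) x⟩
  refine ⟨d, ?_⟩
  have h1 : algebraMap k (FpBar p) (σ.restrictNormal k y) = σ x := σ.restrictNormal_commutes k y
  rw [← hd] at h1
  have h2 : (FiniteField.frobeniusAlgEquivOfAlgebraic (ZMod p) k ^ (d : ℕ)) y = y ^ p ^ (d : ℕ) := by
    rw [AlgEquiv.coe_pow, FiniteField.coe_frobeniusAlgEquivOfAlgebraic_iterate, ZMod.card]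
  simp only at h1
  rw [h2, map_pow] at h1
  exact h1.symm

end Characters

/-- Modulo `p ^ f - 1` a power of `p` depends only on its exponent modulo `f`, and for `f > 1` the
numbers `p ^ r` with `r < f` are distinct and smaller than the modulus. For `f = 1` this bound can
fail (`p = 2` has modulus `1`), but the conclusion is empty. -/
lemma modEq_of_pow_modEq {p f M N : ℕ} (hp : 2 ≤ p) (hf : 0 < f)
    (h : p ^ M ≡ p ^ N [MOD p ^ f - 1]) : M ≡ N [MOD f] := by
  have h1 : 1 < p ^ f := Nat.one_lt_pow hf.ne' hp
  have hone : p ^ f ≡ 1 [MOD p ^ f - 1] :=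
    ((Nat.modEq_iff_dvd' h1.le).2 dvd_rfl).symm
  have hred : ∀ K, p ^ K ≡ p ^ (K % f) [MOD p ^ f - 1] := fun K => by
    conv_lhs => rw [← Nat.div_add_mod K f, pow_add, pow_mul]
    simpa using (hone.pow (K / f)).mul_right (p ^ (K % f))
  have h2 : p ^ (M % f) ≡ p ^ (N % f) [MOD p ^ f - 1] := (hred M).symm.trans (h.trans (hred N))
  rcases Nat.eq_or_lt_of_le (Nat.succ_le_of_lt hf) with h3 | h3
  · rw [← h3]
    exact Nat.modEq_one
  · have hlt : ∀ K, p ^ (K % f) < p ^ f - 1 := fun K => by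
      have h4 : K % f ≤ f - 1 := by have := Nat.mod_lt K hf; omega
      have h5 : p ^ (K % f) ≤ p ^ (f - 1) := Nat.pow_le_pow_right (by omega) h4
      have h6 : p ^ f = p ^ (f - 1) * p := by rw [← pow_succ]; congr 1; omega
      have h7 : p ≤ p ^ (f - 1) := Nat.le_self_pow (by omega) p
      have h8 : p ^ (f - 1) * 2 ≤ p ^ (f - 1) * p := Nat.mul_le_mul_left _ hp
      omega
    exact Nat.pow_right_injective hp (h2.eq_of_lt_of_lt (hlt M) (hlt N))

/-! ### Frobenius on finite subfields and the phase -/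

section Phase

variable (p : ℕ) [hp : Fact p.Prime]

attribute [local instance] autUnitsTopology

local instance : TopologicalSpace (FpBar p)ˣ := ⊥

local instance : DiscreteTopology (FpBar p)ˣ := ⟨rfl⟩

/-- The finite subfields of `FpBar p` have a primitive element. -/
lemma FpBar.exists_generator {f : ℕ} (hf : 0 < f) :
    ∃ ζ : (FpBar p)ˣ, orderOf ζ = p ^ f - 1 ∧
      ∀ z : (FpBar p)ˣ, z ^ p ^ f = z ↔ ∃ i : ℕ, z = ζ ^ i := by
  have h1 : 1 < p ^ f := Nat.one_lt_pow hf.ne' hp.out.one_lt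
  have hndvd : ¬ p ∣ p ^ f - 1 := fun h => by
    have h2 : p ∣ p ^ f := dvd_pow_self p hf.ne'
    have h3 := (Nat.dvd_sub_iff_right h1.le h2).1 h
    exact hp.out.one_lt.ne' (Nat.dvd_one.1 h3)
  obtain ⟨ζ, hζ⟩ := exists_orderOf_eq p hndvd
  have hpow : ∀ z : (FpBar p)ˣ, z ^ p ^ f = z ↔ z ^ orderOf ζ = 1 := fun z => by
    rw [hζ]
    conv_lhs => rw [← Nat.sub_add_cancel h1.le, pow_succ]
    exact mul_eq_right
  refine ⟨ζ, hζ, fun z => ⟨fun hz => ?_, ?_⟩⟩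
  · exact exists_pow_eq_of_pow_orderOf_eq_one (isOfFinOrder p ζ) ((hpow z).1 hz)
  · rintro ⟨i, rfl⟩
    rw [hpow, pow_right_comm, pow_orderOf_eq_one, one_pow]

/-- Automorphisms of `FpBar p` act on a finite subfield as a power of the Frobenius. -/
lemma FpBar.exists_ringAut_eq_pow (g : RingAut (FpBar p)) {f : ℕ} (hf : 0 < f) :
    ∃ d : ℕ, ∀ z : (FpBar p)ˣ, z ^ p ^ f = z → g z = z ^ p ^ d := by
  obtain ⟨ζ, -, h⟩ := exists_generator p hf
  obtain ⟨d, hd⟩ := exists_ringAut_apply_eq_pow p g ζ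
  refine ⟨d, fun z hz => ?_⟩
  obtain ⟨i, rfl⟩ := (h z).1 hz
  rw [Units.val_pow_eq_pow_val, map_pow, hd, pow_right_comm]

/-- A function on the group of automorphisms of the multiplicative group that increases by `log p`
under the Frobenius, modulo the logarithm of `p ^ f`. -/
lemma FpBar.exists_phase {f q : ℕ} (hf : 0 < f) (hq : q = p ^ f) :
    ∃ c : MulAut (FpBar p)ˣ → AddCircle (Real.log q), Continuous c ∧
      ∀ (α β : MulAut (FpBar p)ˣ) (i j : ℕ),
        (∀ z, z ^ q = z → β z ^ p ^ i = α z ^ p ^ j) →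
        c β + ((i * Real.log p : ℝ) : AddCircle (Real.log q)) =
          c α + ((j * Real.log p : ℝ) : AddCircle (Real.log q)) := by
  obtain ⟨ζ, hζ, hgen⟩ := exists_generator p hf
  rw [← hq] at hgen
  -- The phase is measured against a chosen representative `o α` of each class modulo Frobenius
  -- powers on the subfield with `q` elements. If `α ^ (p ^ a) = (o α) ^ (p ^ b)` there, the phase
  -- of `α` is `(b - a) log p`. The difference `b - a` is unique modulo `f` by `modEq_of_pow_modEq`,
  -- and `f log p = log q`.
  let S : Setoid (MulAut (FpBar p)ˣ) :=
    { r := fun α β => ∃ i j : ℕ, ∀ z, z ^ q = z → β z ^ p ^ i = α z ^ p ^ j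
      iseqv :=
        { refl := fun α => ⟨0, 0, fun z _ => rfl⟩
          symm := fun ⟨i, j, h⟩ => ⟨j, i, fun z hz => (h z hz).symm⟩
          trans := fun {α β γ} ⟨i, j, h⟩ ⟨k, l, h'⟩ => ⟨k + i, j + l, fun z hz => by
            rw [pow_add, pow_mul, h' z hz, pow_right_comm, h z hz, pow_add, pow_mul]⟩ } }
  let o : MulAut (FpBar p)ˣ → MulAut (FpBar p)ˣ := fun α => (Quotient.mk S α).out
  have ho : ∀ α, ∃ i j : ℕ, ∀ z, z ^ q = z → α z ^ p ^ i = o α z ^ p ^ j := fun α =>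
    Quotient.exact (Quotient.out_eq (Quotient.mk S α))
  choose a b hab using ho
  let c : MulAut (FpBar p)ˣ → AddCircle (Real.log q) := fun α =>
    (((b α - a α) * Real.log p : ℝ) : AddCircle (Real.log q))
  have hc : ∀ (α β : MulAut (FpBar p)ˣ) (i j : ℕ),
      (∀ z, z ^ q = z → β z ^ p ^ i = α z ^ p ^ j) →
      c β + ((i * Real.log p : ℝ) : AddCircle (Real.log q)) =
        c α + ((j * Real.log p : ℝ) : AddCircle (Real.log q)) := by
    intro α β i j h
    have hoo : o β = o α := congrArg Quotient.out (Quotient.sound (s := S) ⟨j, i, fun z hz =>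
      (h z hz).symm⟩)
    have hζq : ζ ^ q = ζ := (hgen ζ).2 ⟨1, (pow_one ζ).symm⟩
    have e1 := hab α ζ hζq
    have e2 := hab β ζ hζq
    have e3 := h ζ hζq
    rw [hoo] at e2
    have e4 : o α ζ ^ (p ^ (b β + i + a α)) = o α ζ ^ (p ^ (b α + j + a β)) := by
      have hsplit : ∀ (x : (FpBar p)ˣ) (k l m : ℕ),
          x ^ p ^ (k + l + m) = ((x ^ p ^ k) ^ p ^ l) ^ p ^ m := fun x k l m => by
        rw [pow_add, pow_add, pow_mul, pow_mul]
      rw [hsplit, hsplit, ← e1, ← e2, pow_right_comm (β ζ), e3, pow_right_comm (α ζ) (p ^ a α),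
        pow_right_comm _ (p ^ a α)]
    rw [pow_eq_pow_iff_modEq, MulEquiv.orderOf_eq, hζ] at e4
    have e6 := (Nat.modEq_iff_dvd).1 (modEq_of_pow_modEq hp.out.two_le hf e4)
    obtain ⟨k, hk⟩ := e6
    rw [← sub_eq_zero, ← AddCircle.coe_add, ← AddCircle.coe_add, ← AddCircle.coe_sub,
      AddCircle.coe_eq_zero_iff]
    refine ⟨-k, ?_⟩
    have hlog : Real.log q = f * Real.log p := by rw [hq, Nat.cast_pow, Real.log_pow]
    have hk' : ((b α : ℝ) + j + a β) - (b β + i + a α) = f * k := by exact_mod_cast hk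
    rw [zsmul_eq_mul, hlog]
    push_cast
    linear_combination Real.log p * hk'
  refine ⟨c, ?_, hc⟩
  -- The phase depends only on the value at the generator `ζ`, so it is locally constant.
  rw [continuous_iff_continuousAt]
  intro α
  have h1 : {β : MulAut (FpBar p)ˣ | β ζ = α ζ} ∈ 𝓝 α :=
    ((isOpen_discrete {α ζ}).preimage (FpBar.continuous_apply p ζ)).mem_nhds rfl
  refine (continuousAt_const (y := c α)).congr ?_
  filter_upwards [h1] with β hβ
  have h2 := hc α β 0 0 fun z hz => by
    obtain ⟨i, rfl⟩ := (hgen z).1 hz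
    rw [map_pow, map_pow, show β ζ = α ζ from hβ]
  simpa using h2.symm

end Phase

/-! ### Galois action on integral extensions of a normal ring -/

section Galois

/-- An algebraically closed algebraic extension is Galois over the perfect closure of the base
field. -/
instance isGalois_perfectClosure (k K : Type*) [Field k] [Field K] [Algebra k K] [IsAlgClosed K]
    [Algebra.IsAlgebraic k K] : IsGalois (perfectClosure k K) K := by
  have : Algebra.IsAlgebraic (perfectClosure k K) K := Algebra.IsAlgebraic.tower_top (K := k) _
  have : IsAlgClosure (perfectClosure k K) K := ⟨inferInstance, inferInstance⟩
  have : Normal (perfectClosure k K) K := IsAlgClosure.normal _ _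
  exact { }

variable {R B k K : Type*} [CommRing R] [CommRing B] [Field k] [Field K]
  [Algebra k K] [IsAlgClosed K] [Algebra.IsAlgebraic k K] [Algebra R k] [IsFractionRing R k]
  [IsIntegrallyClosed R] [MulSemiringAction (K ≃ₐ[perfectClosure k K] K) B]
  {ι : B →+* K} (hι : Function.Injective ι)
  (hact : ∀ (σ : K ≃ₐ[perfectClosure k K] K) (b : B), ι (σ • b) = σ (ι b))
  {ρ : R →+* B} (hρ : ρ.IsIntegral) (hρι : ∀ r, ι (ρ r) = algebraMap k K (algebraMap R k r))

include hι hact hρ hρι in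
/-- Invariant elements are purely inseparable over the base. -/
lemma exists_pow_eq_of_forall_smul_eq (b : B)
    (hb : ∀ σ : K ≃ₐ[perfectClosure k K] K, σ • b = b) :
    ∃ (n : ℕ) (r : R), b ^ ringExpChar k ^ n = ρ r := by
  have h1 : ι b ∈ Set.range (algebraMap (perfectClosure k K) K) :=
    (InfiniteGalois.mem_range_algebraMap_iff_fixed _).2 fun σ => by rw [← hact, hb]
  obtain ⟨y, hy⟩ := h1
  obtain ⟨n, x, hx⟩ := mem_perfectClosure_iff.1 y.2
  have hy' : (y : K) = ι b := hy
  rw [hy'] at hx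
  have hx' : IsIntegral R x := by
    let := ((algebraMap k K).comp (algebraMap R k)).toAlgebra
    have : IsScalarTower R k K := IsScalarTower.of_algebraMap_eq' rfl
    rw [← isIntegral_algebraMap_iff (algebraMap k K).injective, hx, ← map_pow]
    obtain ⟨f, hf, hf0⟩ := hρ (b ^ ringExpChar k ^ n)
    refine ⟨f, hf, ?_⟩
    have hcomp : algebraMap R K = ι.comp ρ := RingHom.ext fun r => (hρι r).symm
    rw [hcomp, ← Polynomial.hom_eval₂, hf0, map_zero]
  obtain ⟨r, hr⟩ := IsIntegrallyClosed.isIntegral_iff.1 hx'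
  refine ⟨n, r, hι ?_⟩
  rw [map_pow, ← hx, hρι, hr]

variable (B k K) in
/-- The subring of invariants. -/
abbrev invariants : Subring B := FixedPoints.subring B (K ≃ₐ[perfectClosure k K] K)

instance : Algebra.IsInvariant (invariants B k K) B (K ≃ₐ[perfectClosure k K] K) :=
  ⟨fun b hb => ⟨⟨b, hb⟩, rfl⟩⟩

omit [IsAlgClosed K] in
include hact hι in
/-- The Galois group acts continuously on integral elements. -/
lemma continuousSMul_discrete [TopologicalSpace B] [DiscreteTopology B] :
    ContinuousSMul (K ≃ₐ[perfectClosure k K] K) B := by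
  refine ⟨continuous_prod_of_discrete_right.2 fun b => ?_⟩
  rw [continuous_discrete_rng]
  intro c
  convert! isOpen_apply_eq (perfectClosure k K) K (ι b) (ι c) using 1
  ext σ
  change σ • b = c ↔ σ (ι b) = ι c
  rw [← hact, hι.eq_iff]

variable {F : Type*} [Field F]

include hι hact hρ hρι in
/-- The Galois group acts transitively on the homomorphisms to a field with given kernel on the base
ring, up to the kernel. -/
lemma exists_gal_ker_eq (ψ ψ' : B →+* F) (h : ∀ r, ψ (ρ r) = 0 ↔ ψ' (ρ r) = 0) :
    ∃ σ : K ≃ₐ[perfectClosure k K] K, ∀ b, ψ' b = 0 ↔ ψ (σ • b) = 0 := by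
  let : TopologicalSpace B := ⊥
  have : DiscreteTopology B := ⟨rfl⟩
  have := continuousSMul_discrete hι hact
  -- Some power of each invariant comes from `R`, so a prime ideal of the invariants is determined
  -- by its trace on `R`.
  have hker : (RingHom.ker ψ).under (invariants B k K) =
      (RingHom.ker ψ').under (invariants B k K) := by
    ext ⟨b, hb⟩
    change ψ b = 0 ↔ ψ' b = 0
    obtain ⟨n, r, hr⟩ := exists_pow_eq_of_forall_smul_eq hι hact hρ hρι b hb
    have hne : ringExpChar k ^ n ≠ 0 := pow_ne_zero _ (expChar_ne_zero k _)
    rw [← pow_eq_zero_iff hne, ← map_pow, hr, h, ← hr, map_pow, pow_eq_zero_iff hne]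
  have : (RingHom.ker ψ).IsPrime := RingHom.ker_isPrime ψ
  have : (RingHom.ker ψ').IsPrime := RingHom.ker_isPrime ψ'
  obtain ⟨σ, hσ⟩ := Algebra.IsInvariant.exists_smul_of_under_eq_of_profinite
    (G := K ≃ₐ[perfectClosure k K] K) (RingHom.ker ψ) (RingHom.ker ψ') hker
  refine ⟨σ⁻¹, fun b => ?_⟩
  rw [← RingHom.mem_ker, hσ, Ideal.mem_pointwise_smul_iff_inv_smul_mem, RingHom.mem_ker]

include hι hact hρ hρι in
/-- Automorphisms of the residue field lift to the Galois group. -/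
lemma exists_gal_apply_eq (ψ : B →+* F) (hψ : Function.Surjective ψ) (τ : F ≃+* F)
    (hτ : ∀ r, τ (ψ (ρ r)) = ψ (ρ r)) :
    ∃ σ : K ≃ₐ[perfectClosure k K] K, ∀ b, ψ (σ • b) = τ (ψ b) := by
  let : TopologicalSpace B := ⊥
  have : DiscreteTopology B := ⟨rfl⟩
  have := continuousSMul_discrete hι hact
  have : (RingHom.ker ψ).IsPrime := RingHom.ker_isPrime ψ
  have hfix : ∀ b ∈ invariants B k K, τ (ψ b) = ψ b := by
    intro b hb
    obtain ⟨n, r, hr⟩ := exists_pow_eq_of_forall_smul_eq hι hact hρ hρι b hb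
    have h1 : τ (ψ b) ^ ringExpChar k ^ n = ψ b ^ ringExpChar k ^ n := by
      rw [← map_pow, ← map_pow, hr, hτ]
    -- Only a power of the invariant is known to come from `R`. The root is recovered because
    -- Frobenius is injective on `F` when the characteristic is positive; otherwise the exponent is
    -- one.
    obtain ⟨q, hq⟩ := ExpChar.exists k
    rw [ringExpChar.eq k q] at h1
    rcases hq with _ | hq
    · simpa using h1
    · have : Fact q.Prime := ⟨hq⟩
      have : CharP K q := charP_of_injective_algebraMap (algebraMap k K).injective q
      have hB : (q : B) = 0 := hι (by rw [map_natCast, CharP.cast_eq_zero, map_zero])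
      have hF : (q : F) = 0 := by rw [← map_natCast ψ, hB, map_zero]
      have : CharP F q := (CharP.charP_iff_prime_eq_zero hq).2 hF
      exact iterateFrobenius_inj F q n (by simpa [iterateFrobenius_def] using h1)
  let e := RingHom.quotientKerEquivOfSurjective hψ
  let P : Ideal (invariants B k K) := (RingHom.ker ψ).under (invariants B k K)
  let τ' : (B ⧸ RingHom.ker ψ) ≃ₐ[invariants B k K ⧸ P] (B ⧸ RingHom.ker ψ) :=
    AlgEquiv.ofRingEquiv (f := (e.trans τ).trans e.symm) (by
      intro x
      obtain ⟨a, rfl⟩ := Ideal.Quotient.mk_surjective x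
      change e.symm (τ (e (Ideal.Quotient.mk (RingHom.ker ψ) a))) =
        Ideal.Quotient.mk (RingHom.ker ψ) a
      rw [RingEquiv.symm_apply_eq]
      exact hfix a a.2)
  obtain ⟨σ, hσ⟩ := Ideal.Quotient.stabilizerHom_surjective_of_profinite
    (G := K ≃ₐ[perfectClosure k K] K) P (RingHom.ker ψ) τ'
  refine ⟨σ, fun b => ?_⟩
  have h1 := DFunLike.congr_fun hσ (Ideal.Quotient.mk (RingHom.ker ψ) b)
  rw [Ideal.Quotient.stabilizerHom_apply] at h1
  have h2 : e (Ideal.Quotient.mk (RingHom.ker ψ) (σ • b)) =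
      e (e.symm (τ (e (Ideal.Quotient.mk (RingHom.ker ψ) b)))) := congrArg e h1
  rw [RingEquiv.apply_symm_apply] at h2
  exact h2

end Galois

/-! ### Roots in integrally closed rings -/

section Splitting

open Polynomial

variable {B K F : Type*} [CommRing B] [Field K] [IsAlgClosed K] [CommRing F] [IsDomain F]
  {ι : B →+* K} (hι : Function.Injective ι)
  (hint : ∀ x : K, ι.IsIntegralElem x → x ∈ Set.range ι)
include hι hint

/-- If `B` is integrally closed in an algebraically closed field, then the roots of monic
polynomials over `B` in quotients of `B` come from roots in `B`. -/
lemma exists_root_of_eval₂_eq_zero (ψ : B →+* F) {f : B[X]} (hf : f.Monic) {y : F}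
    (hy : f.eval₂ ψ y = 0) : ∃ b, ψ b = y ∧ f.eval b = 0 := by
  have hsplit : (f.map ι).Splits := IsAlgClosed.splits _
  have hroots : ∀ x ∈ (f.map ι).roots, ∃ b, ι b = x := fun x hx =>
    hint x ⟨f, hf, by
      rw [eval₂_eq_eval_map]
      exact (mem_roots'.1 hx).2⟩
  choose! g hg using hroots
  -- The roots of `f` in `K` are integral over `B`, so they lie in `B` and `f` splits over `B`
  -- already.
  have hprod : f = ((f.map ι).roots.map fun x => X - C (g x)).prod := by
    apply map_injective ι hι
    conv_lhs => rw [hsplit.eq_prod_roots_of_monic (hf.map ι)]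
    rw [Polynomial.map_multiset_prod, Multiset.map_map]
    refine congrArg Multiset.prod (Multiset.map_congr rfl fun x hx => ?_)
    simp [hg x hx]
  have heval : f.eval₂ ψ y = ((f.map ι).roots.map fun x => y - ψ (g x)).prod := by
    conv_lhs => rw [hprod]
    rw [eval₂_multiset_prod, Multiset.map_map]
    refine congrArg Multiset.prod (Multiset.map_congr rfl fun x hx => ?_)
    simp
  rw [hy, eq_comm, Multiset.prod_eq_zero_iff, Multiset.mem_map] at heval
  obtain ⟨x, hx, hxy⟩ := heval
  refine ⟨g x, (sub_eq_zero.1 hxy).symm, hι ?_⟩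
  rw [map_zero, ← eval₂_hom, hg x hx, eval₂_eq_eval_map]
  exact (mem_roots'.1 hx).2

end Splitting

/-- The sections over an affine open set of a normal integral scheme are integrally closed. -/
lemma IsNormalScheme.isIntegrallyClosed {X : Scheme.{0}} [IsIntegral X] (hX : IsNormalScheme X)
    {U : X.Opens} (hU : IsAffineOpen U) [Nonempty U] : IsIntegrallyClosed Γ(X, U) := by
  have := functionField_isFractionRing_of_isAffineOpen X U hU
  refine (isIntegrallyClosed_iff X.functionField).2 fun {x} hx => ?_
  -- The ideal of denominators of `x`. At each prime, the local ring is integrally closed and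
  -- contains `x`, so some denominator avoids that prime; hence the ideal is the unit ideal.
  let I : Ideal Γ(X, U) :=
    { carrier := {d | ∃ b : Γ(X, U), algebraMap Γ(X, U) X.functionField d * x =
        algebraMap Γ(X, U) X.functionField b}
      add_mem' := by
        rintro a b ⟨c, hc⟩ ⟨d, hd⟩
        exact ⟨c + d, by rw [map_add, map_add, add_mul, hc, hd]⟩
      zero_mem' := ⟨0, by simp⟩
      smul_mem' := by
        rintro a b ⟨c, hc⟩
        exact ⟨a * c, by rw [smul_eq_mul, map_mul, map_mul, mul_assoc, hc]⟩ }
  have hI : I = ⊤ := by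
    by_contra hne
    obtain ⟨P, hP, hIP⟩ := Ideal.exists_le_maximal I hne
    let y : PrimeSpectrum Γ(X, U) := ⟨P, hP.isPrime⟩
    have hy : hU.fromSpec y ∈ U := by
      have h : hU.fromSpec y ∈ Set.range hU.fromSpec := ⟨_, rfl⟩
      rwa [hU.range_fromSpec] at h
    let := TopCat.Presheaf.algebra_section_stalk X.presheaf (⟨hU.fromSpec y, hy⟩ : U)
    have hloc := hU.isLocalization_stalk' y hy
    have hst : IsScalarTower Γ(X, U) (X.presheaf.stalk (hU.fromSpec y)) X.functionField :=
      functionField_isScalarTower X U ⟨hU.fromSpec y, hy⟩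
    have hcl := (hX (hU.fromSpec y)).2
    obtain ⟨s, hs⟩ := IsIntegrallyClosed.isIntegral_iff.1
      (hx.tower_top (A := X.presheaf.stalk (hU.fromSpec y)))
    obtain ⟨⟨b, c⟩, hbc⟩ := @IsLocalization.surj _ _ y.asIdeal.primeCompl _ _ _ hloc s
    refine c.2 (hIP ⟨b, ?_⟩)
    have e : ∀ d : Γ(X, U), algebraMap (X.presheaf.stalk (hU.fromSpec y)) X.functionField
        (algebraMap Γ(X, U) (X.presheaf.stalk (hU.fromSpec y)) d) =
        algebraMap Γ(X, U) X.functionField d := fun d =>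
      (@IsScalarTower.algebraMap_apply Γ(X, U) (X.presheaf.stalk (hU.fromSpec y)) X.functionField
        _ _ _ _ _ _ hst d).symm
    have h1 := congrArg (algebraMap (X.presheaf.stalk (hU.fromSpec y)) X.functionField) hbc
    have h2 := (map_mul (algebraMap (X.presheaf.stalk (hU.fromSpec y)) X.functionField) s _).symm.trans h1
    rw [hs] at h2
    rw [mul_comm]
    exact ((congrArg (x * ·) (e c)).symm.trans h2).trans (e b)
  obtain ⟨b, hb⟩ : (1 : Γ(X, U)) ∈ I := hI ▸ Submodule.mem_top
  exact ⟨b, by rw [← hb, map_one, one_mul]⟩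

lemma CharPoint.eval_map_appLE {X Y : Scheme.{0}} (p : CharPoint X) (h : X ⟶ Y) {V : X.Opens}
    {U : Y.Opens} (hp : p.pt ∈ V) (e : V ≤ h ⁻¹ᵁ U) (f : Γ(Y, U)) :
    (p.map h).eval U (e hp) f = p.eval V hp ((h.appLE U V e).hom f) := by
  refine (eval_map p h U (e hp) f).trans ?_
  exact (eval_res p e hp (h.app U f)).symm

/-! ### Sections at ring-valued points -/

section SectionMap

variable {Y Z : Scheme.{0}} {A A' : CommRingCat.{0}}

/-- The homomorphism on sections that belongs to a ring-valued point. -/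
def sectionMap (f : Spec A ⟶ Y) (V : Y.Opens) (h : ⊤ ≤ f ⁻¹ᵁ V) : Γ(Y, V) ⟶ A :=
  f.appLE V ⊤ h ≫ (Scheme.ΓSpecIso A).hom

lemma sectionMap_comp (f : Spec A ⟶ Y) (g : Y ⟶ Z) (V : Z.Opens) (h : ⊤ ≤ (f ≫ g) ⁻¹ᵁ V) :
    sectionMap (f ≫ g) V h = g.app V ≫ sectionMap f (g ⁻¹ᵁ V) h := by
  unfold sectionMap
  rw [Scheme.Hom.comp_appLE, Category.assoc]

lemma sectionMap_map_comp (φ : A ⟶ A') (f : Spec A ⟶ Y) (V : Y.Opens) (h : ⊤ ≤ f ⁻¹ᵁ V)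
    (h' : ⊤ ≤ (Spec.map φ ≫ f) ⁻¹ᵁ V) :
    sectionMap (Spec.map φ ≫ f) V h' = sectionMap f V h ≫ φ := by
  unfold sectionMap
  have h1 := Scheme.Hom.appLE_comp_appLE (Spec.map φ) f V ⊤ ⊤ h le_top
  rw [← h1, Category.assoc, Category.assoc]
  congr 1
  have h2 := Scheme.ΓSpecIso_naturality φ
  rw [← h2, Scheme.Hom.appTop, Scheme.Hom.app_eq_appLE]
  rfl

lemma sectionMap_congr {f g : Spec A ⟶ Y} (hfg : f = g) (V : Y.Opens) (h : ⊤ ≤ f ⁻¹ᵁ V)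
    (h' : ⊤ ≤ g ⁻¹ᵁ V) : sectionMap f V h = sectionMap g V h' := by
  subst hfg; rfl

lemma sectionMap_fromSpecStalk (x : Y) (V : Y.Opens) (hx : x ∈ V)
    (h : ⊤ ≤ Y.fromSpecStalk x ⁻¹ᵁ V) :
    sectionMap (Y.fromSpecStalk x) V h = Y.presheaf.germ V x hx := by
  unfold sectionMap
  rw [Scheme.Hom.appLE, Scheme.fromSpecStalk_app hx]
  simp only [Category.assoc]
  rw [← Functor.map_comp_assoc]
  have h1 : ∀ (f : Opposite.op (⊤ : (Spec (Y.presheaf.stalk x)).Opens) ⟶ Opposite.op ⊤),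
      (Spec (Y.presheaf.stalk x)).presheaf.map f = 𝟙 _ := fun f => by
    rw [Subsingleton.elim f (𝟙 _), CategoryTheory.Functor.map_id]
  rw [h1]
  simp

lemma sectionMap_app {f : Spec A ⟶ Y} {g : Y ⟶ Z} {k : Spec A ⟶ Z} (hk : f ≫ g = k) (V : Z.Opens)
    (h : ⊤ ≤ f ⁻¹ᵁ g ⁻¹ᵁ V) (h' : ⊤ ≤ k ⁻¹ᵁ V) (a : Γ(Z, V)) :
    (sectionMap f (g ⁻¹ᵁ V) h).hom ((g.app V).hom a) = (sectionMap k V h').hom a := by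
  subst hk
  exact congr($((sectionMap_comp f g V h).symm) a)

lemma sectionMap_appLE {f : Spec A ⟶ Y} {g : Y ⟶ Y} {φ : A ⟶ A} (hk : f ≫ g = Spec.map φ ≫ f)
    (V : Y.Opens) (h : ⊤ ≤ f ⁻¹ᵁ V) (e : V ≤ g ⁻¹ᵁ V) (a : Γ(Y, V)) :
    (sectionMap f V h).hom ((g.appLE V V e).hom a) = φ.hom ((sectionMap f V h).hom a) := by
  have h2 : ⊤ ≤ (Spec.map φ ≫ f) ⁻¹ᵁ V := fun _ _ => h trivial
  have h3 : ⊤ ≤ (f ≫ g) ⁻¹ᵁ V := hk ▸ h2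
  have h1 : g.appLE V V e ≫ sectionMap f V h = sectionMap f V h ≫ φ := by
    refine Eq.trans ?_ (sectionMap_map_comp φ f V h h2)
    refine Eq.trans ?_ (sectionMap_congr hk V h3 h2)
    unfold sectionMap
    rw [Scheme.Hom.appLE_comp_appLE_assoc]
  exact congr($h1 a)

end SectionMap

/-! ### Sections of the normalization as a subring of `K` -/

section Normalization

variable {X₀ : Scheme.{0}} [IsIntegral X₀] {K : Type} [Field K] [Algebra X₀.functionField K]

lemma genericPoint_mem (U : X₀.Opens) [Nonempty U] : genericPoint X₀ ∈ U :=
  ((genericPoint_spec X₀).mem_open_set_iff U.isOpen).mpr (by simpa using ‹Nonempty U›)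

lemma preimage_fromSpecStalk (U : X₀.Opens) [Nonempty U] :
    ⊤ ≤ X₀.fromSpecStalk (genericPoint X₀) ⁻¹ᵁ U := by
  intro y _
  have h2 : y = IsLocalRing.closedPoint X₀.functionField :=
    @Subsingleton.elim (PrimeSpectrum X₀.functionField) _ _ _
  change X₀.fromSpecStalk (genericPoint X₀) y ∈ U
  rw [h2, Scheme.fromSpecStalk_closedPoint]
  exact genericPoint_mem U

lemma preimage_geomGenericPoint (U : X₀.Opens) [Nonempty U] :
    ⊤ ≤ geomGenericPoint X₀ K ⁻¹ᵁ U :=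
  fun _ _ => preimage_fromSpecStalk U trivial

variable (K) in
/-- The part of the normalization over an open set. -/
abbrev overOpen (U : X₀.Opens) : (normalizationIn X₀ K).Opens := toBase X₀ K ⁻¹ᵁ U

lemma top_le_preimage_over (U : X₀.Opens) [Nonempty U] :
    ⊤ ≤ (geomGenericPoint X₀ K).toNormalization ⁻¹ᵁ overOpen K U := by
  rw [← Scheme.Hom.comp_preimage, Scheme.Hom.toNormalization_fromNormalization]
  exact preimage_geomGenericPoint U

/-- Sections of the normalization as elements of the field. -/
def toField (U : X₀.Opens) [Nonempty U] : Γ(normalizationIn X₀ K, overOpen K U) →+* K :=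
  (sectionMap (geomGenericPoint X₀ K).toNormalization (overOpen K U) (top_le_preimage_over U)).hom

/-- Sections of the base as sections of the normalization. -/
def fromBase (U : X₀.Opens) : Γ(X₀, U) →+* Γ(normalizationIn X₀ K, overOpen K U) :=
  ((toBase X₀ K).app U).hom

lemma fromBase_isIntegral {U : X₀.Opens} (hU : IsAffineOpen U) :
    (fromBase (K := K) U).IsIntegral :=
  IsIntegralHom.isIntegral_app (toBase X₀ K) U hU

lemma isAffineOpen_over {U : X₀.Opens} (hU : IsAffineOpen U) : IsAffineOpen (overOpen K U) :=
  hU.preimage (toBase X₀ K)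

lemma toField_fromBase (U : X₀.Opens) [Nonempty U] (r : Γ(X₀, U)) :
    toField (K := K) U (fromBase U r) =
      algebraMap X₀.functionField K (algebraMap Γ(X₀, U) X₀.functionField r) := by
  have h3 : sectionMap (geomGenericPoint X₀ K) U (preimage_geomGenericPoint U) =
      X₀.germToFunctionField U ≫ CommRingCat.ofHom (algebraMap X₀.functionField K) := by
    refine (sectionMap_map_comp _ _ _ (preimage_fromSpecStalk U) _).trans ?_
    exact congrArg (· ≫ CommRingCat.ofHom (algebraMap X₀.functionField K))
      (sectionMap_fromSpecStalk _ _ (genericPoint_mem U) _)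
  refine (sectionMap_app (Scheme.Hom.toNormalization_fromNormalization (geomGenericPoint X₀ K)) U
    (top_le_preimage_over U) (preimage_geomGenericPoint U) r).trans ?_
  exact congr($h3 r)

/-- The preimage of a nonempty open set in `Spec K` is everything. Its ring of sections is
identified with `K` here, so that the description of the normalization as an integral closure in
that ring can be transferred to `toField`. -/
lemma toField_eq_comp (U : X₀.Opens) [Nonempty U] :
    ∃ j : Γ(Spec (.of K), geomGenericPoint X₀ K ⁻¹ᵁ U) ≃+* K,
      (∀ b, toField (K := K) U b = j ((geomGenericPoint X₀ K).toNormalization.appLE (overOpen K U) _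
        (by simp [← Scheme.Hom.comp_preimage]) b)) ∧
      ∀ r, j ((geomGenericPoint X₀ K).app U r) = toField U (fromBase U r) := by
  let i := ((Spec (.of K)).presheaf.mapIso
    (eqToIso (top_le_iff.1 (preimage_geomGenericPoint (K := K) U)).symm).op ≪≫
      Scheme.ΓSpecIso (.of K))
  have h1 : ∀ b, toField (K := K) U b = i.commRingCatIsoToRingEquiv
      ((geomGenericPoint X₀ K).toNormalization.appLE (overOpen K U) _
        (by simp [← Scheme.Hom.comp_preimage]) b) := by
    intro b
    have h : sectionMap (geomGenericPoint X₀ K).toNormalization (overOpen K U)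
        (top_le_preimage_over U) = (geomGenericPoint X₀ K).toNormalization.appLE (overOpen K U) _
        (by simp [← Scheme.Hom.comp_preimage]) ≫ i.hom := by
      simp only [i, Iso.trans_hom, Functor.mapIso_hom, Iso.op_hom, eqToIso.hom]
      rw [Scheme.Hom.appLE_map_assoc]
      rfl
    exact congr($h b)
  refine ⟨i.commRingCatIsoToRingEquiv, h1, fun r => ?_⟩
  rw [h1]
  congr 1
  have h : (geomGenericPoint X₀ K).app U = (toBase X₀ K).app U ≫
      (geomGenericPoint X₀ K).toNormalization.appLE (overOpen K U) _
        (by simp [← Scheme.Hom.comp_preimage]) := by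
    rw [Scheme.Hom.app_eq_appLE, Scheme.Hom.app_eq_appLE, Scheme.Hom.appLE_comp_appLE]
    simp only [Scheme.Hom.toNormalization_fromNormalization]
  exact congr($h r)

lemma toField_injective {U : X₀.Opens} [Nonempty U] (hU : IsAffineOpen U) :
    Function.Injective (toField (K := K) U) := by
  obtain ⟨j, h1, -⟩ := toField_eq_comp (K := K) U
  intro a b hab
  rw [h1, h1, j.injective.eq_iff] at hab
  let := ((geomGenericPoint X₀ K).app U).hom.toAlgebra
  have h2 := (geomGenericPoint X₀ K).normalizationObjIso_hom_val hU
  rw [← h2] at hab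
  exact ((geomGenericPoint X₀ K).normalizationObjIso hU).commRingCatIsoToRingEquiv.injective
    (Subtype.val_injective hab)

/-- The image of the sections in the field is integrally closed. -/
lemma mem_range_toField {U : X₀.Opens} [Nonempty U] (hU : IsAffineOpen U) {x : K}
    (hx : (toField (K := K) U).IsIntegralElem x) : x ∈ Set.range (toField (K := K) U) := by
  obtain ⟨j, h1, h2⟩ := toField_eq_comp (K := K) U
  have h3 : ((toField (K := K) U).comp (fromBase U)).IsIntegralElem x := by
    let := (fromBase (K := K) U).toAlgebra
    let := (toField (K := K) U).toAlgebra
    let := ((toField (K := K) U).comp (fromBase U)).toAlgebra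
    have : IsScalarTower Γ(X₀, U) Γ(normalizationIn X₀ K, overOpen K U) K :=
      IsScalarTower.of_algebraMap_eq fun _ => rfl
    have : Algebra.IsIntegral Γ(X₀, U) Γ(normalizationIn X₀ K, overOpen K U) :=
      ⟨fromBase_isIntegral hU⟩
    exact isIntegral_trans (R := Γ(X₀, U)) (A := Γ(normalizationIn X₀ K, overOpen K U)) x hx
  let := ((geomGenericPoint X₀ K).app U).hom.toAlgebra
  have h4 : IsIntegral Γ(X₀, U) (j.symm x) := by
    obtain ⟨f, hf, hf0⟩ := h3
    refine ⟨f, hf, j.injective ?_⟩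
    rw [map_zero, ← hf0]
    refine (Polynomial.hom_eval₂ f _ (j : _ →+* K) (j.symm x)).trans ?_
    have e1 : (j : _ →+* K) (j.symm x) = x := j.apply_symm_apply x
    rw [e1]
    congr 1
    exact RingHom.ext h2
  have h5 := (geomGenericPoint X₀ K).normalizationObjIso_hom_val hU
  let I := ((geomGenericPoint X₀ K).normalizationObjIso hU).commRingCatIsoToRingEquiv
  have h6 : ∀ b, (geomGenericPoint X₀ K).toNormalization.appLE (overOpen K U) _
        (by simp [← Scheme.Hom.comp_preimage]) b = (I b).1 := fun b => congr($h5.symm b)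
  refine ⟨I.symm ⟨j.symm x, h4⟩, ?_⟩
  rw [h1, h6, I.apply_symm_apply, j.apply_symm_apply]

lemma galHom_preimage_over (U : X₀.Opens) (σ : GalGroup X₀ K) :
    overOpen K U ≤ galHom σ ⁻¹ᵁ overOpen K U := by
  rw [← Scheme.Hom.comp_preimage, galHom_toBase]

/-- The action of the Galois group on sections. -/
def galRingHom (U : X₀.Opens) (σ : GalGroup X₀ K) :
    Γ(normalizationIn X₀ K, overOpen K U) →+* Γ(normalizationIn X₀ K, overOpen K U) :=
  ((galHom σ).appLE _ _ (galHom_preimage_over U σ)).hom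

lemma toField_galRingHom (U : X₀.Opens) [Nonempty U] (σ : GalGroup X₀ K)
    (b : Γ(normalizationIn X₀ K, overOpen K U)) :
    toField U (galRingHom U σ b) = σ (toField U b) := by
  exact sectionMap_appLE (φ := CommRingCat.ofHom (σ : K →+* K)) (toNormalization_galHom σ) _ _ _ b

lemma galRingHom_fromBase {U : X₀.Opens} [Nonempty U] (hU : IsAffineOpen U) (σ : GalGroup X₀ K)
    (r : Γ(X₀, U)) : galRingHom U σ (fromBase (K := K) U r) = fromBase U r := by
  apply toField_injective hU
  rw [toField_galRingHom, toField_fromBase, AlgEquiv.commutes]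

lemma galRingHom_one {U : X₀.Opens} [Nonempty U] (hU : IsAffineOpen U)
    (b : Γ(normalizationIn X₀ K, overOpen K U)) : galRingHom U 1 b = b := by
  apply toField_injective hU
  rw [toField_galRingHom, AlgEquiv.one_apply]

lemma galRingHom_mul {U : X₀.Opens} [Nonempty U] (hU : IsAffineOpen U) (σ τ : GalGroup X₀ K)
    (b : Γ(normalizationIn X₀ K, overOpen K U)) :
    galRingHom U (σ * τ) b = galRingHom U σ (galRingHom U τ b) := by
  apply toField_injective hU
  rw [toField_galRingHom, toField_galRingHom, toField_galRingHom, AlgEquiv.mul_apply]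

lemma map_galHom_mem {U : X₀.Opens} (σ : GalGroup X₀ K) {p : CharPoint (normalizationIn X₀ K)}
    (hp : p.pt ∈ overOpen K U) : (p.map (galHom σ)).pt ∈ overOpen K U :=
  galHom_preimage_over U σ hp

lemma CharPoint.eval_map_galHom (U : X₀.Opens) (σ : GalGroup X₀ K)
    (p : CharPoint (normalizationIn X₀ K)) (hp : p.pt ∈ overOpen K U)
    (b : Γ(normalizationIn X₀ K, overOpen K U)) :
    (p.map (galHom σ)).eval (overOpen K U) (map_galHom_mem σ hp) b =
      p.eval (overOpen K U) hp (galRingHom U σ b) :=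
  CharPoint.eval_map_appLE p (galHom σ) hp (galHom_preimage_over U σ) b

end Normalization

/-! ### Residue fields of closed points -/

instance : IsJacobsonRing ℤ := by
  refine isJacobsonRing_iff_prime_eq.2 fun P hP => ?_
  rcases eq_or_ne P ⊥ with rfl | h
  · refine le_antisymm (fun x hx => ?_) Ideal.le_jacobson
    rw [Ideal.mem_jacobson_bot] at hx
    -- The factor `3` matters: `3 x + 1 = ±1` forces `x = 0`, while `2 x + 1 = -1` would allow `x =
    -- -1`.
    have h3 := Int.isUnit_iff.1 (hx 3)
    rw [Ideal.mem_bot]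
    omega
  · have := hP.isMaximal h
    exact Ideal.jacobson_eq_self_of_isMaximal

/-- A field that is finitely generated as a ring is finite. -/
lemma finite_of_ringHom_finiteType {F : Type*} [Field F] (f : ℤ →+* F) (hf : f.FiniteType) :
    Finite F := by
  have : Algebra.FiniteType ℤ F := by
    rw [Subsingleton.elim f (algebraMap ℤ F)] at hf
    exact RingHom.finiteType_algebraMap.1 hf
  have : Algebra.IsIntegral ℤ F := by
    have := finite_of_finite_type_of_isJacobsonRing ℤ F
    infer_instance
  obtain ⟨p, hp⟩ := CharP.exists F
  rcases CharP.char_is_prime_or_zero F p with h | rfl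
  · have := Fact.mk h
    let := ZMod.algebra F p
    have : Module.Finite ℤ F := finite_of_finite_type_of_isJacobsonRing ℤ F
    have : Module.Finite (ZMod p) F := Module.Finite.of_restrictScalars_finite ℤ (ZMod p) F
    exact Module.finite_of_finite (ZMod p)
  · exfalso
    have := CharP.charP_to_charZero F
    refine Int.not_isField (isField_of_isIntegral_of_isField (S := F) ?_ (Field.toIsField F))
    exact (RingHom.injective_int (algebraMap ℤ F))

/-- The inclusion of a closed point is a closed immersion, so its residue field is of finite type
over `ℤ`, and the Nullstellensatz over `ℤ` applies. -/
lemma finite_residueField {X : Scheme.{0}} (s : X ⟶ Spec (.of ℤ)) [LocallyOfFiniteType s] {x : X}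
    (hx : IsClosed {x}) : Finite (X.residueField x) := by
  have := isClosed_singleton_iff_isClosedImmersion.1 hx
  obtain ⟨φ, hφ⟩ := Spec.map_surjective (X.fromSpecResidueField x ≫ s)
  have h : LocallyOfFiniteType (Spec.map φ) := by rw [hφ]; infer_instance
  exact finite_of_ringHom_finiteType φ.hom
    ((HasRingHomProperty.Spec_iff (P := @LocallyOfFiniteType)).1 h)

/-- A point is closed if the multiplicative group of its residue field is torsion. -/
lemma isClosed_singleton_of_isOfFinOrder {X : Scheme.{0}} {x : X}
    (h : ∀ z : (X.residueField x)ˣ, IsOfFinOrder z) : IsClosed {x} := by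
  refine closure_subset_iff_isClosed.1 fun y hy => ?_
  have hxy : x ⤳ y := specializes_iff_mem_closure.2 hy
  obtain ⟨_, ⟨W, hW, rfl⟩, hyW, -⟩ :=
    X.isBasis_affineOpens.exists_subset_of_mem_open (Set.mem_univ y) isOpen_univ
  have hxW : x ∈ W := hxy.mem_open W.2 hyW
  refine (eq_of_forall_mem_basicOpen_iff hW hxW hyW fun f => ⟨fun hf => ?_, fun hf =>
    hxy.mem_open (X.basicOpen f).2 hf⟩).symm
  have h0 : X.evaluation W x hxW f ≠ 0 := (X.evaluation_ne_zero_iff_mem_basicOpen x hxW f).2 hf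
  -- A section that is nonzero at `x` satisfies `f ^ n = 1` there. The zero of `f ^ n - 1` persists
  -- at the specialization `y`, so `f` cannot vanish at `y`.
  obtain ⟨n, hn, h1⟩ := (h (Units.mk0 _ h0)).exists_pow_eq_one
  have h2 : X.evaluation W x hxW (f ^ n - 1) = 0 := by
    rw [map_sub, map_pow, map_one, sub_eq_zero]
    simpa using congrArg Units.val h1
  have h3 : X.evaluation W y hyW (f ^ n - 1) = 0 := by
    rw [Scheme.evaluation_eq_zero_iff_notMem_basicOpen] at h2 ⊢
    exact fun h4 => h2 (hxy.mem_open (X.basicOpen (f ^ n - 1)).2 h4)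
  rw [← Scheme.evaluation_ne_zero_iff_mem_basicOpen X y hyW]
  intro h4
  rw [map_sub, map_pow, map_one, h4, zero_pow hn.ne', zero_sub, neg_eq_zero] at h3
  exact one_ne_zero h3

/-! ### Residue fields and surjectivity of the normalization -/

section Normalization

variable {X₀ : Scheme.{0}} [IsIntegral X₀] {K : Type} [Field K] [Algebra X₀.functionField K]

lemma evaluation_fromBase {U : X₀.Opens} {x : normalizationIn X₀ K} (hx : x ∈ overOpen K U)
    (r : Γ(X₀, U)) :
    (normalizationIn X₀ K).evaluation (overOpen K U) x hx (fromBase U r) =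
      ((toBase X₀ K).residueFieldMap x).hom (X₀.evaluation U (toBase X₀ K x) hx r) :=
  (Scheme.evaluation_naturality_apply (toBase X₀ K) x hx r).symm

/-- The residue fields of the normalization are integral over those of the base. -/
lemma residueFieldMap_isIntegral (x : normalizationIn X₀ K) :
    ((toBase X₀ K).residueFieldMap x).hom.IsIntegral := by
  obtain ⟨_, ⟨U, hU, rfl⟩, hxU, -⟩ :=
    X₀.isBasis_affineOpens.exists_subset_of_mem_open (Set.mem_univ (toBase X₀ K x)) isOpen_univ
  have key : ∀ b : Γ(normalizationIn X₀ K, overOpen K U),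
      ((toBase X₀ K).residueFieldMap x).hom.IsIntegralElem
        ((normalizationIn X₀ K).evaluation (overOpen K U) x hxU b) := by
    intro b
    obtain ⟨f, hf, hf0⟩ := fromBase_isIntegral hU b
    refine ⟨f.map (X₀.evaluation U (toBase X₀ K x) hxU).hom, hf.map _, ?_⟩
    have h1 := congrArg ((normalizationIn X₀ K).evaluation (overOpen K U) x hxU).hom hf0
    rw [map_zero, Polynomial.hom_eval₂] at h1
    rw [Polynomial.eval₂_map]
    refine Eq.trans ?_ h1
    congr 1
    exact RingHom.ext fun r => (evaluation_fromBase hxU r).symm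
  intro z
  obtain ⟨b, c, hc, hz⟩ := exists_evaluation_div (isAffineOpen_over (K := K) hU) hxU z
  have hz' : z = (normalizationIn X₀ K).evaluation (overOpen K U) x hxU b *
      ((normalizationIn X₀ K).evaluation (overOpen K U) x hxU c)⁻¹ := by
    rw [← hz, mul_inv_cancel_right₀ hc]
  rw [hz']
  let := ((toBase X₀ K).residueFieldMap x).hom.toAlgebra
  have hb : IsIntegral (X₀.residueField (toBase X₀ K x)) _ := key b
  have hc' : IsIntegral (X₀.residueField (toBase X₀ K x)) _ := key c
  exact hb.mul hc'.inv

lemma geomGenericPoint_apply (y : Spec (.of K)) : geomGenericPoint X₀ K y = genericPoint X₀ := by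
  have h2 : Spec.map (CommRingCat.ofHom (algebraMap X₀.functionField K)) y =
      IsLocalRing.closedPoint X₀.functionField :=
    @Subsingleton.elim (PrimeSpectrum X₀.functionField) _ _ _
  change X₀.fromSpecStalk (genericPoint X₀)
    (Spec.map (CommRingCat.ofHom (algebraMap X₀.functionField K)) y) = _
  rw [h2, Scheme.fromSpecStalk_closedPoint]

/-- The integral morphism is closed, and its image contains the generic point. -/
lemma toBase_surjective : Function.Surjective (toBase X₀ K) := by
  have h1 : IsClosedMap (toBase X₀ K) := (toBase X₀ K).isClosedMap
  have h2 : ∃ y, toBase X₀ K y = genericPoint X₀ := by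
    have y : Spec (.of K) := (inferInstance : Nonempty (PrimeSpectrum K)).some
    refine ⟨(geomGenericPoint X₀ K).toNormalization y, ?_⟩
    rw [← geomGenericPoint_apply y, ← Scheme.Hom.comp_apply,
      Scheme.Hom.toNormalization_fromNormalization]
  obtain ⟨y, hy⟩ := h2
  rw [← Set.range_eq_univ, ← h1.isClosed_range.closure_eq, Set.eq_univ_iff_forall]
  intro x
  have h3 := (genericPoint_spec X₀).specializes (Set.mem_univ x)
  rw [← hy] at h3
  have h4 : ({toBase X₀ K y} : Set X₀) ⊆ Set.range (toBase X₀ K) := by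
    rintro _ rfl
    exact ⟨y, rfl⟩
  exact closure_mono h4 (specializes_iff_mem_closure.1 h3)

end Normalization

/-! ### The Galois group and homomorphisms over a point -/

section GaloisAction

variable {X₀ : Scheme.{0}} [IsIntegral X₀] (hX₀ : IsNormalScheme X₀) {K : Type} [Field K]
  [Algebra X₀.functionField K] [IsAlgClosure X₀.functionField K] {U : X₀.Opens} [Nonempty U]
  (hU : IsAffineOpen U)

variable (X₀ K) in
/-- The automorphism group of `K` over the perfect closure of the function field. -/
abbrev PerfGalGroup : Type := K ≃ₐ[perfectClosure X₀.functionField K] K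

/-- The map to the Galois group over the function field. -/
abbrev PerfGalGroup.toGal (σ : PerfGalGroup X₀ K) : GalGroup X₀ K :=
  σ.restrictScalars X₀.functionField

include hU in
variable (K) in
/-- The action of the Galois group on the sections. -/
@[reducible] def perfGalAction :
    MulSemiringAction (PerfGalGroup X₀ K) Γ(normalizationIn X₀ K, overOpen K U) where
  smul σ b := galRingHom U σ.toGal b
  one_smul b := galRingHom_one hU b
  mul_smul σ τ b := galRingHom_mul hU σ.toGal τ.toGal b
  smul_zero σ := map_zero (galRingHom U σ.toGal)
  smul_add σ := map_add (galRingHom U σ.toGal)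
  smul_one σ := map_one (galRingHom U σ.toGal)
  smul_mul σ := map_mul (galRingHom U σ.toGal)

variable {F : Type} [Field F]

include hX₀ hU in
lemma exists_galRingHom_ker_eq (ψ ψ' : Γ(normalizationIn X₀ K, overOpen K U) →+* F)
    (h : ∀ r, ψ (fromBase U r) = 0 ↔ ψ' (fromBase U r) = 0) :
    ∃ σ : PerfGalGroup X₀ K, ∀ b, ψ' b = 0 ↔ ψ (galRingHom U σ.toGal b) = 0 := by
  let := perfGalAction K hU
  have := hX₀.isIntegrallyClosed hU
  have := functionField_isFractionRing_of_isAffineOpen X₀ U hU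
  have : IsAlgClosed K := IsAlgClosure.isAlgClosed X₀.functionField
  have : Algebra.IsAlgebraic X₀.functionField K := IsAlgClosure.isAlgebraic
  exact exists_gal_ker_eq (R := Γ(X₀, U)) (k := X₀.functionField) (toField_injective hU)
    (fun (σ : PerfGalGroup X₀ K) b => toField_galRingHom U σ.toGal b) (fromBase_isIntegral hU) (toField_fromBase U) ψ ψ' h

include hX₀ hU in
lemma exists_galRingHom_apply_eq {ψ : Γ(normalizationIn X₀ K, overOpen K U) →+* F}
    (hψ : Function.Surjective ψ) (τ : F ≃+* F) (hτ : ∀ r, τ (ψ (fromBase U r)) = ψ (fromBase U r)) :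
    ∃ σ : PerfGalGroup X₀ K, ∀ b, ψ (galRingHom U σ.toGal b) = τ (ψ b) := by
  let := perfGalAction K hU
  have := hX₀.isIntegrallyClosed hU
  have := functionField_isFractionRing_of_isAffineOpen X₀ U hU
  have : IsAlgClosed K := IsAlgClosure.isAlgClosed X₀.functionField
  have : Algebra.IsAlgebraic X₀.functionField K := IsAlgClosure.isAlgebraic
  exact exists_gal_apply_eq (R := Γ(X₀, U)) (k := X₀.functionField) (toField_injective hU)
    (fun (σ : PerfGalGroup X₀ K) b => toField_galRingHom U σ.toGal b) (fromBase_isIntegral hU) (toField_fromBase U)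
    ψ hψ τ hτ

include hU in
lemma isOpen_galRingHom_eq (b c : Γ(normalizationIn X₀ K, overOpen K U)) :
    IsOpen {σ : PerfGalGroup X₀ K | galRingHom U σ.toGal b = c} := by
  have : Algebra.IsAlgebraic X₀.functionField K := IsAlgClosure.isAlgebraic
  have : Algebra.IsAlgebraic (perfectClosure X₀.functionField K) K :=
    Algebra.IsAlgebraic.tower_top (K := X₀.functionField) _
  convert! isOpen_apply_eq (perfectClosure X₀.functionField K) K (toField U b) (toField U c) using 1
  ext σ
  change galRingHom U σ.toGal b = c ↔ σ.toGal (toField U b) = toField U c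
  rw [← toField_galRingHom, (toField_injective hU).eq_iff]

include hU in
/-- The orbits of the Galois group on sections are finite. -/
lemma exists_galRingHom_pow_eq (σ : GalGroup X₀ K)
    (b : Γ(normalizationIn X₀ K, overOpen K U)) :
    ∃ n : ℕ, 0 < n ∧ galRingHom U (σ ^ n) b = b := by
  have : Algebra.IsAlgebraic X₀.functionField K := IsAlgClosure.isAlgebraic
  have hx : IsIntegral X₀.functionField (toField U b) := Algebra.IsIntegral.isIntegral _
  have hmem : ∀ n : ℕ, (σ ^ n) (toField U b) ∈
      (minpoly X₀.functionField (toField U b)).rootSet K := fun n => by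
    rw [Polynomial.mem_rootSet_of_ne (minpoly.ne_zero hx), Polynomial.aeval_algEquiv,
      AlgHom.comp_apply, minpoly.aeval, map_zero]
  obtain ⟨i, -, j, -, hij, h⟩ := Set.infinite_univ.exists_lt_map_eq_of_mapsTo
    (fun n _ => hmem n) (Polynomial.rootSet_finite _ _)
  refine ⟨j - i, by omega, toField_injective hU ?_⟩
  rw [toField_galRingHom]
  refine (σ ^ i).injective ?_
  rw [← AlgEquiv.mul_apply, ← pow_add, Nat.add_sub_cancel' hij.le]
  exact h.symm

include hU in
lemma exists_section_root (ψ : Γ(normalizationIn X₀ K, overOpen K U) →+* F)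
    {f : Polynomial Γ(normalizationIn X₀ K, overOpen K U)} (hf : f.Monic) {y : F}
    (hy : f.eval₂ ψ y = 0) : ∃ b, ψ b = y ∧ f.eval b = 0 := by
  have : IsAlgClosed K := IsAlgClosure.isAlgClosed X₀.functionField
  exact exists_root_of_eval₂_eq_zero (toField_injective hU) (fun x hx => mem_range_toField hU hx)
    ψ hf hy

/-- A homomorphism lies over a point if it induces the same prime ideal of the base. -/
def LiesOver (ψ : Γ(normalizationIn X₀ K, overOpen K U) →+* F) (x₀ : X₀) : Prop :=
  ∃ h : x₀ ∈ U, ∀ r, ψ (fromBase U r) = 0 ↔ X₀.evaluation U x₀ h r = 0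

omit [IsAlgClosure X₀.functionField K] [Nonempty U] in
lemma LiesOver.toBase_eq {ψ : Γ(normalizationIn X₀ K, overOpen K U) →+* F} {x₀ : X₀}
    (h : LiesOver ψ x₀) (χ : Fˣ →* ℂˣ) :
    toBase X₀ K (CharPoint.ofHom (isAffineOpen_over hU) ψ χ).pt = x₀ := by
  obtain ⟨hx, h⟩ := h
  have hmem := CharPoint.ofHom_mem (isAffineOpen_over hU) ψ χ
  refine eq_of_forall_mem_basicOpen_iff hU hmem hx fun r => ?_
  rw [← Scheme.evaluation_ne_zero_iff_mem_basicOpen X₀ _ hmem,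
    ← Scheme.evaluation_ne_zero_iff_mem_basicOpen X₀ _ hx, not_iff_not, ← h,
    ← extendChar_eq_zero χ, ← CharPoint.eval_ofHom (isAffineOpen_over hU), CharPoint.eval_eq,
    extendChar_eq_zero, evaluation_fromBase]
  exact (map_eq_zero _).symm

omit [IsAlgClosure X₀.functionField K] [Nonempty U] in
lemma liesOver_toBase {x : normalizationIn X₀ K} (hx : x ∈ overOpen K U)
    (i : (normalizationIn X₀ K).residueField x →+* F) :
    LiesOver (i.comp ((normalizationIn X₀ K).evaluation (overOpen K U) x hx).hom)
      (toBase X₀ K x) := by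
  refine ⟨hx, fun r => ?_⟩
  rw [RingHom.comp_apply, map_eq_zero]
  refine (congrArg (· = 0) (evaluation_fromBase hx r)).to_iff.trans ?_
  exact map_eq_zero _

omit [IsAlgClosure X₀.functionField K] in
include hU in
lemma LiesOver.galRingHom {ψ : Γ(normalizationIn X₀ K, overOpen K U) →+* F} {x₀ : X₀}
    (h : LiesOver ψ x₀) (σ : GalGroup X₀ K) : LiesOver (ψ.comp (galRingHom U σ)) x₀ := by
  obtain ⟨hx, h⟩ := h
  refine ⟨hx, fun r => ?_⟩
  rw [RingHom.comp_apply, galRingHom_fromBase hU, h]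

omit [IsAlgClosure X₀.functionField K] [Nonempty U] in
include hU in
/-- The embedding of the residue field of the base. -/
lemma LiesOver.exists_residueField_hom {ψ : Γ(normalizationIn X₀ K, overOpen K U) →+* F} {x₀ : X₀}
    (h : LiesOver ψ x₀) : ∃ (hx : x₀ ∈ U) (j : X₀.residueField x₀ →+* F),
      ∀ r, ψ (fromBase U r) = j (X₀.evaluation U x₀ hx r) := by
  have h1 := h.toBase_eq hU 1
  subst h1
  refine ⟨CharPoint.ofHom_mem (isAffineOpen_over hU) ψ 1,
    (fieldPointMap (isAffineOpen_over hU) ψ).comp ((toBase X₀ K).residueFieldMap _).hom,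
    fun r => ?_⟩
  rw [← fieldPointMap_evaluation (isAffineOpen_over hU) ψ]
  exact congrArg _ (evaluation_fromBase _ r)

end GaloisAction

/-- The elements of a finite subfield of the algebraic closure of the prime field. -/
lemma FpBar.pow_card_eq_iff (p : ℕ) [Fact p.Prime] {k : Type*} [Field k] [Finite k]
    (j : k →+* FpBar p) (y : FpBar p) : y ^ Nat.card k = y ↔ ∃ z, y = j z := by
  classical
  have := Fintype.ofFinite k
  constructor
  · intro hy
    by_contra! hn
    let P : Polynomial (FpBar p) := Polynomial.X ^ Nat.card k - Polynomial.X
    have hP : P ≠ 0 := FiniteField.X_pow_card_sub_X_ne_zero _ Finite.one_lt_card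
    have hdeg : P.natDegree = Nat.card k :=
      FiniteField.X_pow_card_sub_X_natDegree_eq _ Finite.one_lt_card
    have hsub : insert y (Finset.univ.image j) ⊆ P.roots.toFinset := by
      intro x hx
      rw [Multiset.mem_toFinset, Polynomial.mem_roots hP]
      rw [Finset.mem_insert, Finset.mem_image] at hx
      rcases hx with rfl | ⟨z, -, rfl⟩
      · simp [P, hy, -Nat.card_eq_fintype_card]
      · simp [P, ← map_pow, FiniteField.pow_card]
    have h1 := (Finset.card_le_card hsub).trans (Multiset.toFinset_card_le _)
    rw [Finset.card_insert_of_notMem (by simpa [eq_comm] using hn),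
      Finset.card_image_of_injective _ j.injective, Finset.card_univ, ← Nat.card_eq_fintype_card]
      at h1
    have h2 := P.card_roots'
    omega
  · rintro ⟨z, rfl⟩
    rw [← map_pow, Nat.card_eq_fintype_card, FiniteField.pow_card]

/-- Surjective homomorphisms to a field with the same kernel differ by an automorphism. -/
lemma exists_ringAut_of_ker_eq {B F : Type*} [CommRing B] [Field F] {φ φ' : B →+* F}
    (hφ : Function.Surjective φ) (hφ' : Function.Surjective φ') (h : ∀ b, φ b = 0 ↔ φ' b = 0) :
    ∃ τ : RingAut F, ∀ b, φ' b = τ (φ b) := by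
  have hker : RingHom.ker φ = RingHom.ker φ' := by
    ext b
    exact h b
  refine ⟨((RingHom.quotientKerEquivOfSurjective hφ).symm.trans
    (Ideal.quotEquivOfEq hker)).trans (RingHom.quotientKerEquivOfSurjective hφ'), fun b => ?_⟩
  have h1 : (RingHom.quotientKerEquivOfSurjective hφ).symm (φ b) = Ideal.Quotient.mk _ b := by
    rw [RingEquiv.symm_apply_eq]
    rfl
  change φ' b = (RingHom.quotientKerEquivOfSurjective hφ')
    (Ideal.quotEquivOfEq hker ((RingHom.quotientKerEquivOfSurjective hφ).symm (φ b)))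
  rw [h1]
  rfl

/-! ### Homomorphisms to `FpBar p` over a closed point -/

section ClosedPoint

variable {X₀ : Scheme.{0}} [IsIntegral X₀] (hX₀ : IsNormalScheme X₀) {K : Type} [Field K]
  [Algebra X₀.functionField K] [IsAlgClosure X₀.functionField K] {U : X₀.Opens} [Nonempty U]
  (hU : IsAffineOpen U) {p : ℕ} [Fact p.Prime]

include hU in
-- A nonzero element of `FpBar p` is a root of some `X ^ n - 1`, and such roots lift to sections by
-- `exists_section_root`.
lemma surjective_hom_fpBar (ψ : Γ(normalizationIn X₀ K, overOpen K U) →+* FpBar p) :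
    Function.Surjective ψ := by
  intro y
  rcases eq_or_ne y 0 with rfl | hy
  · exact ⟨0, map_zero ψ⟩
  obtain ⟨n, hn, h⟩ := (FpBar.isOfFinOrder p (Units.mk0 y hy)).exists_pow_eq_one
  have h' : y ^ n = 1 := by simpa using congrArg Units.val h
  obtain ⟨b, hb, -⟩ := exists_section_root hU ψ (Polynomial.monic_X_pow_sub_C 1 hn.ne') (y := y)
    (by simp [h'])
  exact ⟨b, hb⟩

omit [IsAlgClosure X₀.functionField K] in
lemma isOfFinOrder_of_finite {x : normalizationIn X₀ K} (h : Finite (X₀.residueField (toBase X₀ K x)))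
    (z : ((normalizationIn X₀ K).residueField x)ˣ) : IsOfFinOrder z := by
  let := ((toBase X₀ K).residueFieldMap x).hom.toAlgebra
  have : Algebra.IsIntegral (X₀.residueField (toBase X₀ K x))
    ((normalizationIn X₀ K).residueField x) := ⟨residueFieldMap_isIntegral x⟩
  exact isOfFinOrder_units_of_isIntegral (X₀.residueField (toBase X₀ K x)) z

include hU in
/-- The residue fields over a finite field are algebraic closures of it. -/
lemma exists_residueField_bijective {x : normalizationIn X₀ K} (hx : toBase X₀ K x ∈ U)
    [Finite (X₀.residueField (toBase X₀ K x))] [CharP (X₀.residueField (toBase X₀ K x)) p] :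
    ∃ i : (normalizationIn X₀ K).residueField x →+* FpBar p, Function.Bijective i := by
  have hchar : CharP ((normalizationIn X₀ K).residueField x) p :=
    charP_of_injective_ringHom ((toBase X₀ K).residueFieldMap x).hom.injective p
  let := ZMod.algebra ((normalizationIn X₀ K).residueField x) p
  have halg : Algebra.IsAlgebraic (ZMod p) ((normalizationIn X₀ K).residueField x) := by
    refine ⟨fun z => IsIntegral.isAlgebraic ?_⟩
    rcases eq_or_ne z 0 with rfl | hz
    · exact isIntegral_zero
    obtain ⟨n, hn, h⟩ := (isOfFinOrder_of_finite inferInstance (Units.mk0 z hz)).exists_pow_eq_one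
    have h' : z ^ n = 1 := by simpa using congrArg Units.val h
    exact IsIntegral.of_pow hn (h' ▸ isIntegral_one)
  let i : (normalizationIn X₀ K).residueField x →ₐ[ZMod p] FpBar p := IsAlgClosed.lift
  refine ⟨i.toRingHom, i.toRingHom.injective, ?_⟩
  have h := surjective_hom_fpBar hU
    (i.toRingHom.comp ((normalizationIn X₀ K).evaluation (overOpen K U) x hx).hom)
  exact Function.Surjective.of_comp h

include hU in
/-- The pairs over a closed point. -/
lemma exists_eq_ofHom {x₀ : X₀} (hx₀ : x₀ ∈ U) [Finite (X₀.residueField x₀)]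
    [CharP (X₀.residueField x₀) p] {q : CharPoint (normalizationIn X₀ K)}
    (hq : toBase X₀ K q.pt = x₀) :
    ∃ (ψ : Γ(normalizationIn X₀ K, overOpen K U) →+* FpBar p) (χ : (FpBar p)ˣ →* ℂˣ),
      LiesOver ψ x₀ ∧ q = CharPoint.ofHom (isAffineOpen_over hU) ψ χ ∧
      ∃ e : ((normalizationIn X₀ K).residueField q.pt)ˣ ≃* (FpBar p)ˣ, ∀ z, q.char z = χ (e z) := by
  subst hq
  obtain ⟨i, hi⟩ := exists_residueField_bijective (p := p) hU hx₀
  let e := Units.mapEquiv (RingEquiv.ofBijective i hi).toMulEquiv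
  refine ⟨i.comp ((normalizationIn X₀ K).evaluation (overOpen K U) q.pt hx₀).hom,
    q.char.comp e.symm.toMonoidHom, liesOver_toBase hx₀ i, ?_, e, fun z => ?_⟩
  · have hmem : q.pt ∈ overOpen K U := hx₀
    refine CharPoint.ext_of_eval (isAffineOpen_over hU) hmem (CharPoint.ofHom_mem _ _ _) fun b => ?_
    rw [CharPoint.eval_ofHom, CharPoint.eval_eq, RingHom.comp_apply]
    refine Eq.trans ?_ (extendChar_comp (q.char.comp e.symm.toMonoidHom) i _)
    congr 1
    refine MonoidHom.ext fun z => ?_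
    exact congrArg q.char (e.symm_apply_apply z).symm
  · exact congrArg q.char (e.symm_apply_apply z).symm

include hU in
lemma exists_liesOver {x₀ : X₀} (hx₀ : x₀ ∈ U) [Finite (X₀.residueField x₀)]
    [CharP (X₀.residueField x₀) p] :
    ∃ ψ : Γ(normalizationIn X₀ K, overOpen K U) →+* FpBar p, LiesOver ψ x₀ := by
  obtain ⟨x, hx⟩ := toBase_surjective (K := K) x₀
  obtain ⟨ψ, -, hψ, -⟩ := exists_eq_ofHom (p := p) hU hx₀
    (q := (⟨x, 1⟩ : CharPoint (normalizationIn X₀ K))) hx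
  exact ⟨ψ, hψ⟩

include hX₀ hU in
/-- The Galois group and the automorphisms of the algebraic closure of the prime field act
transitively on the homomorphisms over a given point. -/
lemma LiesOver.exists_eq {x₀ : X₀} {ψ ψ' : Γ(normalizationIn X₀ K, overOpen K U) →+* FpBar p}
    (h : LiesOver ψ x₀) (h' : LiesOver ψ' x₀) :
    ∃ (σ : PerfGalGroup X₀ K) (τ : RingAut (FpBar p)),
      ∀ b, ψ' b = τ (ψ (ArithmeticFlow.galRingHom U σ.toGal b)) := by
  obtain ⟨hx, h⟩ := h
  obtain ⟨_, h'⟩ := h'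
  obtain ⟨σ, hσ⟩ := exists_galRingHom_ker_eq hX₀ hU ψ ψ' fun r => by rw [h, h']
  obtain ⟨τ, hτ⟩ := exists_ringAut_of_ker_eq
    (surjective_hom_fpBar hU (ψ.comp (ArithmeticFlow.galRingHom U σ.toGal)))
    (surjective_hom_fpBar hU ψ') fun b => (hσ b).symm
  exact ⟨σ, τ, hτ⟩

include hX₀ hU in
-- The assumption on `γ` says that it fixes the image of the residue field of `x₀`, which is the set
-- of roots of `X ^ q - X`. Such automorphisms come from the decomposition group.
lemma LiesOver.exists_galRingHom_apply_eq {x₀ : X₀} [Finite (X₀.residueField x₀)]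
    {ψ : Γ(normalizationIn X₀ K, overOpen K U) →+* FpBar p} (h : LiesOver ψ x₀)
    (γ : RingAut (FpBar p)) (hγ : ∀ y, y ^ Nat.card (X₀.residueField x₀) = y → γ y = y) :
    ∃ σ : PerfGalGroup X₀ K, ∀ b, ψ (ArithmeticFlow.galRingHom U σ.toGal b) = γ (ψ b) := by
  obtain ⟨hx, j, hj⟩ := h.exists_residueField_hom hU
  refine ArithmeticFlow.exists_galRingHom_apply_eq hX₀ hU (surjective_hom_fpBar hU ψ) γ fun r =>
    hγ _ ?_
  rw [hj, FpBar.pow_card_eq_iff p j]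
  exact ⟨_, rfl⟩

omit [IsAlgClosure X₀.functionField K] in
include hU in
lemma LiesOver.apply_eq {x₀ : X₀} [Finite (X₀.residueField x₀)]
    {ψ : Γ(normalizationIn X₀ K, overOpen K U) →+* FpBar p} (h : LiesOver ψ x₀)
    (γ : RingAut (FpBar p)) (σ : GalGroup X₀ K)
    (hγ : ∀ b, ψ (ArithmeticFlow.galRingHom U σ b) = γ (ψ b)) {y : FpBar p}
    (hy : y ^ Nat.card (X₀.residueField x₀) = y) : γ y = y := by
  obtain ⟨hx, j, hj⟩ := h.exists_residueField_hom hU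
  obtain ⟨z, rfl⟩ := (FpBar.pow_card_eq_iff p j y).1 hy
  obtain ⟨b, c, hc, hz⟩ := exists_evaluation_div hU hx z
  have key : ∀ r, γ (j (X₀.evaluation U x₀ hx r)) = j (X₀.evaluation U x₀ hx r) := fun r => by
    rw [← hj, ← hγ, galRingHom_fromBase hU]
  refine mul_right_cancel₀ ((map_ne_zero j).2 hc) ?_
  rw [← map_mul, hz, ← key b, ← key c, ← hz, map_mul, map_mul, key c]

end ClosedPoint

/-! ### Parametrization of a packet by automorphisms and scales -/

section ClosedPoint

attribute [local instance] autUnitsTopology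

local instance (p : ℕ) [Fact p.Prime] : TopologicalSpace (FpBar p)ˣ := ⊥

local instance (p : ℕ) [Fact p.Prime] : DiscreteTopology (FpBar p)ˣ := ⟨rfl⟩

variable {X₀ : Scheme.{0}} [IsIntegral X₀] (hX₀ : IsNormalScheme X₀) {K : Type} [Field K]
  [Algebra X₀.functionField K] [IsAlgClosure X₀.functionField K] (E : AdmissibleCondition X₀ K)
  {U : X₀.Opens} [Nonempty U]
  (hU : IsAffineOpen U) {p : ℕ} [Fact p.Prime] {x₀ : X₀} [hfin : Finite (X₀.residueField x₀)]
  {ψ ψ₀ : Γ(normalizationIn X₀ K, overOpen K U) →+* FpBar p}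
  {χ₀ : (FpBar p)ˣ →* ℂˣ} (hχ₀ : Function.Injective χ₀)

omit [IsAlgClosure X₀.functionField K] [Nonempty U] in
lemma LiesOver.isOfFinOrder (hψ : LiesOver ψ x₀) (χ : (FpBar p)ˣ →* ℂˣ)
    (z : ((normalizationIn X₀ K).residueField
      (CharPoint.ofHom (isAffineOpen_over hU) ψ χ).pt)ˣ) : IsOfFinOrder z := by
  have h := hψ.toBase_eq hU χ
  exact isOfFinOrder_of_finite (by rw [h]; exact hfin) z

omit [IsAlgClosure X₀.functionField K] [Nonempty U] in
/-- A homomorphism over a closed point and a character with finite kernel define an admissible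
pair. -/
lemma LiesOver.ofHom_mem_carrier (hψ : LiesOver ψ x₀) {χ : (FpBar p)ˣ →* ℂˣ}
    (hχ : {z | χ z = 1}.Finite) : CharPoint.ofHom (isAffineOpen_over hU) ψ χ ∈ E.carrier :=
  E.mem_of_torsion _ (hψ.isOfFinOrder hU χ)
    (hχ.preimage (Units.map_injective (fieldPointMap (isAffineOpen_over hU) ψ).injective).injOn)

omit [IsAlgClosure X₀.functionField K] [Nonempty U] in
/-- The pair given by an injective character. -/
def LiesOver.injPoint (hψ : LiesOver ψ x₀) {χ : (FpBar p)ˣ →* ℂˣ} (hχ : Function.Injective χ) :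
    InjPoints E x₀ :=
  ⟨⟨CharPoint.ofHom (isAffineOpen_over hU) ψ χ, hψ.ofHom_mem_carrier E hU
    ((Set.finite_singleton 1).subset fun z hz => (injective_iff_map_eq_one χ).1 hχ z hz)⟩,
    hψ.toBase_eq hU χ,
    (hχ.comp (Units.map_injective (fieldPointMap (isAffineOpen_over hU) ψ).injective)).injOn⟩

include hX₀ in
-- Transitivity turns the homomorphism of `q` into a Galois translate of `ψ₀` followed by a field
-- automorphism. The latter is absorbed into the character, and any two injective characters differ
-- by an automorphism of the units.
lemma LiesOver.exists_injPoint_eq [CharP (X₀.residueField x₀) p] (hψ₀ : LiesOver ψ₀ x₀)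
    (q : InjPoints E x₀) : ∃ (σ : PerfGalGroup X₀ K) (α : MulAut (FpBar p)ˣ),
      (hψ₀.galRingHom hU σ.toGal).injPoint E hU (χ := χ₀.comp α.toMonoidHom)
        (hχ₀.comp α.injective) = q := by
  obtain ⟨ψ, χ, hψ, hq, e, he⟩ := exists_eq_ofHom (p := p) hU hψ₀.choose q.2.1
  have hχ : Function.Injective χ := by
    intro a b hab
    obtain ⟨a, rfl⟩ := e.surjective a
    obtain ⟨b, rfl⟩ := e.surjective b
    rw [← he, ← he] at hab
    have htors := isOfFinOrder_of_finite (x := q.1.1.pt) (by rw [q.2.1]; exact hfin)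
    rw [q.2.2 (htors a) (htors b) hab]
  obtain ⟨σ, τ, hτ⟩ := hψ₀.exists_eq hX₀ hU hψ
  obtain ⟨α, hα⟩ := exists_mulAut_char (FpBar.isOfFinOrder p) hχ₀
    (χ' := χ.comp (autToUnits p τ).toMonoidHom) (hχ.comp (autToUnits p τ).injective)
  refine ⟨σ, α, Subtype.ext (Subtype.ext ?_)⟩
  rw [hq]
  refine CharPoint.ext_of_eval (isAffineOpen_over hU) (CharPoint.ofHom_mem _ _ _)
    (CharPoint.ofHom_mem _ _ _) fun b => ?_
  rw [CharPoint.eval_ofHom, hτ]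
  refine (CharPoint.eval_ofHom (isAffineOpen_over hU) _ _ b).trans ?_
  refine Eq.trans ?_ (extendChar_comp χ (τ : FpBar p →+* FpBar p) _)
  congr 1
  exact MonoidHom.ext fun z => (hα z).symm

/-- The family of all pairs over a closed point. -/
def LiesOver.injPoints (hψ₀ : LiesOver ψ₀ x₀) (z : PerfGalGroup X₀ K × MulAut (FpBar p)ˣ) :
    InjPoints E x₀ :=
  (hψ₀.galRingHom hU z.1.toGal).injPoint E hU (χ := χ₀.comp z.2.toMonoidHom)
    (hχ₀.comp z.2.injective)

omit [IsAlgClosure X₀.functionField K] in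
lemma LiesOver.eval_injPoints (hψ₀ : LiesOver ψ₀ x₀)
    (z : PerfGalGroup X₀ K × MulAut (FpBar p)ˣ) (b : Γ(normalizationIn X₀ K, overOpen K U)) :
    (hψ₀.injPoints E hU hχ₀ z).1.1.eval (overOpen K U) (CharPoint.ofHom_mem _ _ _) b =
      extendChar (χ₀.comp z.2.toMonoidHom) (ψ₀ (ArithmeticFlow.galRingHom U z.1.toGal b)) :=
  CharPoint.eval_ofHom (isAffineOpen_over hU) _ _ b

lemma continuous_extendChar_comp (y : FpBar p) :
    Continuous fun α : MulAut (FpBar p)ˣ => extendChar (χ₀.comp α.toMonoidHom) y := by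
  rcases eq_or_ne y 0 with rfl | hy
  · simp only [extendChar_zero]
    exact continuous_const
  lift y to (FpBar p)ˣ using hy.isUnit
  simp only [extendChar_units]
  exact (continuous_of_discreteTopology (f := fun w : (FpBar p)ˣ => (χ₀ w : ℂ))).comp
    (FpBar.continuous_apply p y)

include hU in
-- The translate of `b` is locally constant in the Galois element, which leaves only continuity in
-- the automorphism.
lemma continuous_extendChar_galRingHom (b : Γ(normalizationIn X₀ K, overOpen K U)) :
    Continuous fun z : PerfGalGroup X₀ K × MulAut (FpBar p)ˣ =>
      extendChar (χ₀.comp z.2.toMonoidHom) (ψ₀ (galRingHom U z.1.toGal b)) := by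
  refine continuous_iff_continuousAt.2 fun ⟨σ, α⟩ => ?_
  have h1 : ∀ᶠ z : PerfGalGroup X₀ K × MulAut (FpBar p)ˣ in 𝓝 (σ, α),
      galRingHom U z.1.toGal b = galRingHom U σ.toGal b :=
    continuous_fst.continuousAt.preimage_mem_nhds ((isOpen_galRingHom_eq hU b _).mem_nhds rfl)
  have h2 : ContinuousAt (fun z : PerfGalGroup X₀ K × MulAut (FpBar p)ˣ =>
      extendChar (χ₀.comp z.2.toMonoidHom) (ψ₀ (galRingHom U σ.toGal b))) (σ, α) :=
    ((continuous_extendChar_comp _).comp continuous_snd).continuousAt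
  refine h2.congr ?_
  filter_upwards [h1] with z hz
  rw [hz]

lemma LiesOver.continuous_injPoints (hψ₀ : LiesOver ψ₀ x₀) :
    Continuous (hψ₀.injPoints E hU hχ₀) := by
  refine Continuous.subtype_mk (Continuous.subtype_mk ?_ _) _
  exact CharPoint.continuous_of_eval (isAffineOpen_over hU)
    (fun _ => CharPoint.ofHom_mem _ _ _) fun b =>
    (continuous_extendChar_galRingHom hU b).congr fun z => (hψ₀.eval_injPoints E hU hχ₀ z b).symm

include hX₀ in
lemma LiesOver.injPoints_surjective [CharP (X₀.residueField x₀) p] (hψ₀ : LiesOver ψ₀ x₀) :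
    Function.Surjective (hψ₀.injPoints E hU hχ₀) := fun q => by
  obtain ⟨σ, α, h⟩ := hψ₀.exists_injPoint_eq hX₀ E hU hχ₀ q
  exact ⟨(σ, α), h⟩

omit [IsAlgClosure X₀.functionField K] [Nonempty U] hfin in
include hU in
lemma InjPoints.t2Space (hx₀ : x₀ ∈ U) : T2Space (InjPoints E x₀) :=
  CharPoint.t2Space_of_isAffineOpen (isAffineOpen_over (K := K) hU)
    (continuous_subtype_val.comp continuous_subtype_val)
    (Subtype.val_injective.comp Subtype.val_injective)
    fun q => show toBase X₀ K q.1.1.pt ∈ U by rw [q.2.1]; exact hx₀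

/-- The class of a pair with values in the algebraic closure of the prime field. -/
def LiesOver.toPacket (hψ₀ : LiesOver ψ₀ x₀) (z : MulAut (FpBar p)ˣ × PosReal) : Packet E x₀ :=
  Packet.ofInj (hψ₀.injPoints E hU hχ₀ (1, z.1), z.2)

lemma LiesOver.continuous_toPacket (hψ₀ : LiesOver ψ₀ x₀) :
    Continuous (hψ₀.toPacket E hU hχ₀) :=
  Packet.continuous_ofInj.comp (((hψ₀.continuous_injPoints E hU hχ₀).comp
    (continuous_const.prodMk continuous_fst)).prodMk continuous_snd)

omit [IsAlgClosure X₀.functionField K] in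
-- The pair with parameter `σ` is the Galois translate by `σ` of the pair with parameter `1`, so the
-- Galois parameter disappears in the packet.
lemma LiesOver.ofInj_injPoints (hψ₀ : LiesOver ψ₀ x₀) (σ : PerfGalGroup X₀ K)
    (α : MulAut (FpBar p)ˣ) (u : PosReal) :
    Packet.ofInj (hψ₀.injPoints E hU hχ₀ (σ, α), u) = hψ₀.toPacket E hU hχ₀ (α, u) := by
  refine Subtype.ext (congrArg (fun w => FlowSpace.mk (Leaf.mk 1 w) u) ?_)
  refine WittPoints.mk_eq_mk_iff.2 ⟨σ.toGal, ?_⟩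
  refine CharPoint.ext_of_eval (isAffineOpen_over hU)
    (map_galHom_mem σ.toGal (CharPoint.ofHom_mem _ _ _)) (CharPoint.ofHom_mem _ _ _) fun b => ?_
  refine (CharPoint.eval_map_galHom U σ.toGal _ (CharPoint.ofHom_mem _ _ _) b).trans ?_
  rw [hψ₀.eval_injPoints E hU hχ₀]
  refine (hψ₀.eval_injPoints E hU hχ₀ (1, α) _).trans ?_
  have h1 : PerfGalGroup.toGal (1 : PerfGalGroup X₀ K) = 1 := rfl
  rw [h1, galRingHom_one hU]

include hU in
-- All units are roots of unity here, so admissibility makes the kernel of `P` finite and `P = F_c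
-- P'` with `P'` injective. Then `[P, u] = [P', u / c]`.
lemma LiesOver.ofInj_surjective [CharP (X₀.residueField x₀) p] (hψ₀ : LiesOver ψ₀ x₀) :
    Function.Surjective (Packet.ofInj : InjPoints E x₀ × PosReal → Packet E x₀) := by
  rintro ⟨z, hz⟩
  obtain ⟨w, u, rfl⟩ := FlowSpace.exists_eq_mk z
  obtain ⟨q, rfl⟩ := WittPoints.mk_surjective w
  have hq : toBase X₀ K q.1.pt = x₀ := hz
  obtain ⟨ψ, χ, hψ, hq', e, he⟩ := exists_eq_ofHom (p := p) hU hψ₀.choose hq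
  have hχ : {z | χ z = 1}.Finite := by
    have htors := isOfFinOrder_of_finite (x := q.1.pt) (by rw [hq]; exact hfin)
    refine ((E.finite_ker q.1 q.2).image e).subset fun z hz => ?_
    exact ⟨e.symm z, ⟨htors _, by rw [he, e.apply_symm_apply]; exact hz⟩, e.apply_symm_apply z⟩
  obtain ⟨c, χ', hχ', h⟩ := FpBar.exists_injective_comp_pow p χ hχ
  refine ⟨(hψ.injPoint E hU hχ', ⟨u.1 / c, div_pos u.2 (by exact_mod_cast c.pos)⟩), Subtype.ext ?_⟩
  refine FlowSpace.mk_eq_mk_iff.2 ⟨1, c, ?_, ?_⟩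
  · rw [WittPoints.frob_one]
    refine congrArg WittPoints.mk (Subtype.ext ?_)
    refine hq'.trans ?_
    refine CharPoint.ext_of_eval (isAffineOpen_over hU) (CharPoint.ofHom_mem _ _ _)
      (CharPoint.ofHom_mem (isAffineOpen_over hU) ψ χ') fun b => ?_
    rw [CharPoint.eval_ofHom]
    refine Eq.trans ?_ (CharPoint.eval_frob (CharPoint.ofHom (isAffineOpen_over hU) ψ χ') c _ (CharPoint.ofHom_mem _ _ _) b).symm
    rw [CharPoint.eval_ofHom, ← extendChar_comp_pow χ' c c.ne_zero]
    congr 1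
    exact MonoidHom.ext h
  · have : (c : ℝ) ≠ 0 := by exact_mod_cast c.ne_zero
    simp only [PNat.one_coe, Nat.cast_one, one_mul]
    field_simp

include hX₀ in
-- The packet topology comes from all injective pairs, and these are parametrized by a compact
-- group. That parametrization is proper, since its target is Hausdorff; properness survives the
-- product with the noncompact factor `PosReal` and yields a quotient map. The Galois factor is then
-- dropped.
lemma LiesOver.isQuotientMap_toPacket [CharP (X₀.residueField x₀) p] (hψ₀ : LiesOver ψ₀ x₀) :
    IsQuotientMap (hψ₀.toPacket E hU hχ₀) := by
  have : IsAlgClosed K := IsAlgClosure.isAlgClosed X₀.functionField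
  have : Algebra.IsAlgebraic X₀.functionField K := IsAlgClosure.isAlgebraic
  have := InjPoints.t2Space E hU hψ₀.choose
  have h1 : IsProperMap (hψ₀.injPoints E hU hχ₀) :=
    (hψ₀.continuous_injPoints E hU hχ₀).isProperMap
  have h2 : IsProperMap (Prod.map (hψ₀.injPoints E hU hχ₀) (id : PosReal → PosReal)) :=
    h1.prodMap isProperMap_id
  have h3 : IsQuotientMap (Prod.map (hψ₀.injPoints E hU hχ₀) (id : PosReal → PosReal)) :=
    h2.isClosedMap.isQuotientMap h2.continuous
      ((hψ₀.injPoints_surjective hX₀ E hU hχ₀).prodMap Function.surjective_id)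
  have h4 : IsQuotientMap (Packet.ofInj : InjPoints E x₀ × PosReal → Packet E x₀) :=
    ⟨⟨rfl⟩, hψ₀.ofInj_surjective E hU⟩
  have h5 := h4.comp h3
  refine IsQuotientMap.of_comp
    (f := fun z : (PerfGalGroup X₀ K × MulAut (FpBar p)ˣ) × PosReal => (z.1.2, z.2))
    (by fun_prop) (hψ₀.continuous_toPacket E hU hχ₀) ?_
  convert! h5 using 1
  funext ⟨⟨σ, α⟩, u⟩
  exact (hψ₀.ofInj_injPoints E hU hχ₀ σ α u).symm

end ClosedPoint

/-! ### Frobenius powers and the packet relation -/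

section FrobeniusPowers

variable (p : ℕ) [hp : Fact p.Prime]

/-- Powers of the Frobenius automorphism. -/
def FpBar.frobPow (i : ℕ) : RingAut (FpBar p) := iterateFrobeniusEquiv (FpBar p) p i

lemma FpBar.frobPow_apply (i : ℕ) (y : FpBar p) : frobPow p i y = y ^ p ^ i :=
  iterateFrobeniusEquiv_apply ..

lemma FpBar.autToUnits_frobPow (i : ℕ) (z : (FpBar p)ˣ) : autToUnits p (frobPow p i) z = z ^ p ^ i :=
  Units.ext (by rw [Units.val_pow_eq_pow_val]; exact frobPow_apply p i z)

/-- The relation between points of a packet, in terms of automorphisms, up to scaling. -/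
def PacketRel (q : ℕ) (α β : MulAut (FpBar p)ˣ) (i j : ℕ) : Prop :=
  ∃ γ : RingAut (FpBar p), (∀ y, y ^ q = y → γ y = y) ∧
    ∀ z, β z ^ p ^ i = α (autToUnits p γ z) ^ p ^ j

variable {p}

/-- Raising to the power `p ^ i` is a field automorphism, so `β` is `α` composed with `γ` and
Frobenius to the power `j - i`. -/
lemma PacketRel.mk_eq {q : ℕ} {α β : MulAut (FpBar p)ˣ} {i j : ℕ} (h : PacketRel p q α β i j) :
    AutQuotient.mk p α = AutQuotient.mk p β := by
  obtain ⟨γ, -, h⟩ := h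
  refine (AutQuotient.mk_eq_mk_iff p).2 ⟨γ * FpBar.frobPow p j * (FpBar.frobPow p i)⁻¹, ?_⟩
  ext1 z
  obtain ⟨w, rfl⟩ := (autToUnits p (FpBar.frobPow p i)).surjective z
  rw [map_mul, map_mul, map_inv]
  change β _ = α (autToUnits p γ (autToUnits p (FpBar.frobPow p j)
    ((autToUnits p (FpBar.frobPow p i))⁻¹ (autToUnits p (FpBar.frobPow p i) w))))
  rw [MulAut.inv_apply_self, FpBar.autToUnits_frobPow, FpBar.autToUnits_frobPow, map_pow, map_pow,
    map_pow, h]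

lemma PacketRel.pow_eq {q : ℕ} {α β : MulAut (FpBar p)ˣ} {i j : ℕ} (h : PacketRel p q α β i j)
    {z : (FpBar p)ˣ} (hz : z ^ q = z) : β z ^ p ^ i = α z ^ p ^ j := by
  obtain ⟨γ, hγ, h⟩ := h
  rw [h]
  congr 2
  exact Units.ext (hγ z (by rw [← Units.val_pow_eq_pow_val, hz]))

/-- Write `β = α ∘ g`. On the subfield with `p ^ f` elements `g` is the `d`-th power of Frobenius,
so removing `d` Frobenius steps, up to multiples of `f`, leaves an automorphism that fixes it. The
free multiples `k₁`, `k₂` later realize shifts of either sign. -/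
lemma packetRel_of_mk_eq {f : ℕ} (hf : 0 < f) {α β : MulAut (FpBar p)ˣ}
    (h : AutQuotient.mk p α = AutQuotient.mk p β) :
    ∃ d : ℕ, (∀ z, z ^ p ^ f = z → β z = α z ^ p ^ d) ∧
      ∀ k₁ k₂ : ℕ, PacketRel p (p ^ f) α β (k₂ * f) (d + k₁ * f) := by
  obtain ⟨g, rfl⟩ := (AutQuotient.mk_eq_mk_iff p).1 h
  obtain ⟨d, hd⟩ := FpBar.exists_ringAut_eq_pow p g hf
  have hd' : ∀ z : (FpBar p)ˣ, z ^ p ^ f = z → autToUnits p g z = z ^ p ^ d := fun z hz =>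
    Units.ext (by rw [Units.val_pow_eq_pow_val]; exact hd z hz)
  have hk : ∀ (k : ℕ) (y : FpBar p), y ^ p ^ f = y → y ^ p ^ (k * f) = y := by
    intro k y hy
    induction k with
    | zero => simp
    | succ k ih => rw [Nat.succ_mul, pow_add, pow_mul, ih, hy]
  refine ⟨d, fun z hz => ?_, fun k₁ k₂ =>
    ⟨g * FpBar.frobPow p (k₂ * f) * (FpBar.frobPow p (d + k₁ * f))⁻¹, fun y hy => ?_, fun z => ?_⟩⟩
  · rw [← map_pow, ← hd' z hz]
    rfl
  · obtain ⟨w, rfl⟩ := (FpBar.frobPow p (d + k₁ * f)).surjective y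
    have hw : w ^ p ^ f = w := (FpBar.frobPow p (d + k₁ * f)).injective (by rw [map_pow, hy])
    change g (FpBar.frobPow p (k₂ * f) ((FpBar.frobPow p (d + k₁ * f))⁻¹
      (FpBar.frobPow p (d + k₁ * f) w))) = _
    have h1 : (FpBar.frobPow p (d + k₁ * f))⁻¹ (FpBar.frobPow p (d + k₁ * f) w) = w :=
      (FpBar.frobPow p (d + k₁ * f)).symm_apply_apply w
    rw [h1, FpBar.frobPow_apply, FpBar.frobPow_apply, hk k₂ w hw, pow_add, mul_comm, pow_mul,
      hk k₁ w hw]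
    rcases eq_or_ne w 0 with rfl | hw0
    · rw [map_zero, zero_pow (pow_ne_zero _ hp.out.ne_zero)]
    · exact hd (Units.mk0 w hw0) (Units.ext (by simpa using hw))
  · obtain ⟨w, rfl⟩ := (autToUnits p (FpBar.frobPow p (d + k₁ * f))).surjective z
    rw [map_mul, map_mul, map_inv]
    change α (autToUnits p g _) ^ _ = α (autToUnits p g (autToUnits p (FpBar.frobPow p (k₂ * f))
      ((autToUnits p (FpBar.frobPow p (d + k₁ * f)))⁻¹
        (autToUnits p (FpBar.frobPow p (d + k₁ * f)) w)))) ^ _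
    rw [MulAut.inv_apply_self]
    simp only [FpBar.autToUnits_frobPow, map_pow]
    rw [pow_right_comm]

end FrobeniusPowers

/-! ### Equality of points in a packet -/

section ClosedPoint

variable {X₀ : Scheme.{0}} [IsIntegral X₀] (hX₀ : IsNormalScheme X₀) {K : Type} [Field K]
  [Algebra X₀.functionField K] [IsAlgClosure X₀.functionField K] (E : AdmissibleCondition X₀ K)
  {U : X₀.Opens} [Nonempty U]
  (hU : IsAffineOpen U) {p : ℕ} [hp : Fact p.Prime] {x₀ : X₀} [hfin : Finite (X₀.residueField x₀)]
  {ψ₀ : Γ(normalizationIn X₀ K, overOpen K U) →+* FpBar p}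
  {χ₀ : (FpBar p)ˣ →* ℂˣ} (hχ₀ : Function.Injective χ₀)

omit [IsAlgClosure X₀.functionField K] in
lemma LiesOver.injPoints_mem (hψ₀ : LiesOver ψ₀ x₀) (z : PerfGalGroup X₀ K × MulAut (FpBar p)ˣ) :
    (hψ₀.injPoints E hU hχ₀ z).1.1.pt ∈ overOpen K U :=
  CharPoint.ofHom_mem _ _ _

include hχ₀ in
lemma extendChar_comp_pow_eq_iff {α β : MulAut (FpBar p)ˣ} {z w : (FpBar p)ˣ} {m n : ℕ} :
    extendChar (χ₀.comp α.toMonoidHom) (z : FpBar p) ^ n =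
      extendChar (χ₀.comp β.toMonoidHom) (w : FpBar p) ^ m ↔ α z ^ n = β w ^ m := by
  rw [extendChar_units, extendChar_units, ← Units.val_pow_eq_pow_val, ← Units.val_pow_eq_pow_val,
    Units.val_inj]
  change χ₀ (α z) ^ n = χ₀ (β w) ^ m ↔ _
  rw [← map_pow χ₀, ← map_pow χ₀, hχ₀.eq_iff]

include hX₀ in
-- Comparing zeros of values shows that the Galois element preserves the kernel of `ψ₀`, so it
-- induces `γ` on `FpBar p`. The exponents `m`, `n` are then powers of `p` up to a common factor,
-- which cancels. Conversely, `γ` lifts to the Galois group.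
lemma LiesOver.toPacket_eq_iff (hψ₀ : LiesOver ψ₀ x₀) {α β : MulAut (FpBar p)ˣ} {u v : PosReal} :
    hψ₀.toPacket E hU hχ₀ (α, u) = hψ₀.toPacket E hU hχ₀ (β, v) ↔
      ∃ i j : ℕ, PacketRel p (Nat.card (X₀.residueField x₀)) α β i j ∧
        (p : ℝ) ^ j * u.1 = (p : ℝ) ^ i * v.1 := by
  have heval : ∀ (α : MulAut (FpBar p)ˣ) (n : ℕ+) (b : Γ(normalizationIn X₀ K, overOpen K U)),
      ((hψ₀.injPoints E hU hχ₀ (1, α)).1.1.frob n).eval (overOpen K U)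
        (hψ₀.injPoints_mem E hU hχ₀ (1, α)) b = extendChar (χ₀.comp α.toMonoidHom) (ψ₀ b) ^ (n : ℕ) := by
    intro α n b
    refine (CharPoint.eval_frob _ n _ (hψ₀.injPoints_mem E hU hχ₀ (1, α)) b).trans ?_
    rw [hψ₀.eval_injPoints E hU hχ₀ (1, α)]
    exact congrArg (fun y => extendChar (χ₀.comp α.toMonoidHom) (ψ₀ y) ^ (n : ℕ))
      (galRingHom_one hU b)
  have hgal : ∀ (α : MulAut (FpBar p)ˣ) (n : ℕ+) (σ : GalGroup X₀ K)
      (b : Γ(normalizationIn X₀ K, overOpen K U)),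
      (((hψ₀.injPoints E hU hχ₀ (1, α)).1.1.frob n).map (galHom σ)).eval (overOpen K U)
        (map_galHom_mem σ (hψ₀.injPoints_mem E hU hχ₀ (1, α))) b =
        extendChar (χ₀.comp α.toMonoidHom) (ψ₀ (ArithmeticFlow.galRingHom U σ b)) ^ (n : ℕ) :=
    fun α n σ b => (CharPoint.eval_map_galHom U σ
      ((hψ₀.injPoints E hU hχ₀ (1, α)).1.1.frob n) (hψ₀.injPoints_mem E hU hχ₀ (1, α)) b).trans
      (heval α n _)
  constructor
  · intro h
    obtain ⟨m, n, h1, h2⟩ := FlowSpace.mk_eq_mk_iff.1 (congrArg Subtype.val h)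
    obtain ⟨σ, hσ⟩ := WittPoints.mk_eq_mk_iff.1 h1
    have h3 : ∀ b, extendChar (χ₀.comp α.toMonoidHom)
        (ψ₀ (ArithmeticFlow.galRingHom U σ b)) ^ (n : ℕ) =
        extendChar (χ₀.comp β.toMonoidHom) (ψ₀ b) ^ (m : ℕ) := fun b => by
      rw [← hgal, ← heval]
      congr 1
    have hker : ∀ b, ψ₀ b = 0 ↔ ψ₀ (ArithmeticFlow.galRingHom U σ b) = 0 := fun b => by
      rw [← extendChar_eq_zero (χ₀.comp β.toMonoidHom), ← pow_eq_zero_iff m.ne_zero, ← h3,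
        pow_eq_zero_iff n.ne_zero, extendChar_eq_zero]
    obtain ⟨γ, hγ⟩ := exists_ringAut_of_ker_eq (surjective_hom_fpBar hU ψ₀)
      (surjective_hom_fpBar hU (ψ₀.comp (ArithmeticFlow.galRingHom U σ))) hker
    have h4 : ∀ z : (FpBar p)ˣ, β z ^ (m : ℕ) = (α.toMonoidHom.comp (autToUnits p γ).toMonoidHom) z ^ (n : ℕ) := by
      intro z
      obtain ⟨b, hb⟩ := surjective_hom_fpBar hU ψ₀ z
      have h5 := h3 b
      have h6 : ψ₀ (ArithmeticFlow.galRingHom U σ b) = (autToUnits p γ z : (FpBar p)ˣ) := by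
        rw [← RingHom.comp_apply, hγ, hb]
        rfl
      rw [h6, hb] at h5
      exact ((extendChar_comp_pow_eq_iff hχ₀).1 h5).symm
    obtain ⟨i, j, k, hk, hm, hn, h5⟩ := FpBar.exists_pow_prime_of_pow_eq_pow p
      (β := β.toMonoidHom) β.injective (α.injective.comp (autToUnits p γ).injective)
      m.pos n.pos h4
    refine ⟨i, j, ⟨γ, fun y hy => hψ₀.apply_eq hU γ σ hγ hy, h5⟩, ?_⟩
    rw [hm, hn] at h2
    push_cast at h2
    have hk' : (k : ℝ) ≠ 0 := by exact_mod_cast hk.ne'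
    refine mul_left_cancel₀ hk' ?_
    linarith
  · rintro ⟨i, j, ⟨γ, hγ, h⟩, huv⟩
    obtain ⟨σ, hσ⟩ := hψ₀.exists_galRingHom_apply_eq hX₀ hU γ hγ
    obtain ⟨m, hm⟩ : ∃ m : ℕ+, (m : ℕ) = p ^ i := ⟨⟨p ^ i, pow_pos hp.out.pos i⟩, rfl⟩
    obtain ⟨n, hn⟩ : ∃ n : ℕ+, (n : ℕ) = p ^ j := ⟨⟨p ^ j, pow_pos hp.out.pos j⟩, rfl⟩
    refine Subtype.ext (FlowSpace.mk_eq_mk_iff.2 ⟨m, n, ?_, by rw [hm, hn]; push_cast; exact huv⟩)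
    refine WittPoints.mk_eq_mk_iff.2 ⟨σ.toGal, ?_⟩
    refine CharPoint.ext_of_eval (isAffineOpen_over hU)
      (map_galHom_mem σ.toGal (hψ₀.injPoints_mem E hU hχ₀ (1, α)))
      (hψ₀.injPoints_mem E hU hχ₀ (1, β)) fun b => ?_
    refine (hgal α _ σ.toGal b).trans (Eq.trans ?_ (heval β _ b).symm)
    rw [hσ]
    rcases eq_or_ne (ψ₀ b) 0 with h0 | h0
    · rw [h0, map_zero, extendChar_zero, extendChar_zero, zero_pow n.ne_zero, zero_pow m.ne_zero]
    · refine (extendChar_comp_pow_eq_iff hχ₀ (z := autToUnits p γ (Units.mk0 _ h0))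
        (w := Units.mk0 _ h0)).2 ?_
      rw [hm, hn, h]

end ClosedPoint

/-! ### Coordinates on a packet -/

section ClosedPoint

attribute [local instance] autUnitsTopology

variable {X₀ : Scheme.{0}} [IsIntegral X₀] (hX₀ : IsNormalScheme X₀) {K : Type} [Field K]
  [Algebra X₀.functionField K] [IsAlgClosure X₀.functionField K] (E : AdmissibleCondition X₀ K)
  {U : X₀.Opens} [Nonempty U]
  (hU : IsAffineOpen U) {p : ℕ} [hp : Fact p.Prime] {x₀ : X₀} [hfin : Finite (X₀.residueField x₀)]
  {ψ₀ : Γ(normalizationIn X₀ K, overOpen K U) →+* FpBar p}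
  {χ₀ : (FpBar p)ˣ →* ℂˣ} (hχ₀ : Function.Injective χ₀)

lemma log_eq_of_pow_mul_eq {u v : PosReal} {i j : ℕ} :
    (p : ℝ) ^ j * u.1 = (p : ℝ) ^ i * v.1 ↔
      j * Real.log p + Real.log u.1 = i * Real.log p + Real.log v.1 := by
  have hp0 : (0 : ℝ) < p := by exact_mod_cast hp.out.pos
  rw [← Real.log_injOn_pos.eq_iff (mul_pos (pow_pos hp0 j) u.2) (mul_pos (pow_pos hp0 i) v.2),
    Real.log_mul (pow_pos hp0 j).ne' u.2.ne', Real.log_mul (pow_pos hp0 i).ne' v.2.ne',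
    Real.log_pow, Real.log_pow]

include hX₀ in
/-- The coordinates on a packet: the class of the automorphism and the phase. -/
lemma LiesOver.exists_coordinates [CharP (X₀.residueField x₀) p] (hψ₀ : LiesOver ψ₀ x₀) :
    ∃ c : MulAut (FpBar p)ˣ → AddCircle (Real.log (Nat.card (X₀.residueField x₀))), Continuous c ∧
      ∀ α β u v, hψ₀.toPacket E hU hχ₀ (α, u) = hψ₀.toPacket E hU hχ₀ (β, v) ↔
        AutQuotient.mk p α = AutQuotient.mk p β ∧
          (Real.log u.1 : AddCircle (Real.log (Nat.card (X₀.residueField x₀)))) - c α =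
            (Real.log v.1 : AddCircle (Real.log (Nat.card (X₀.residueField x₀)))) - c β := by
  obtain ⟨f, hf, hq⟩ : ∃ f : ℕ, 0 < f ∧ Nat.card (X₀.residueField x₀) = p ^ f := by
    have := Fintype.ofFinite (X₀.residueField x₀)
    obtain ⟨n, -, hn⟩ := FiniteField.card (X₀.residueField x₀) p
    exact ⟨n, n.pos, by rw [Nat.card_eq_fintype_card, hn]⟩
  obtain ⟨c, hc, hc'⟩ := FpBar.exists_phase p hf hq
  refine ⟨c, hc, fun α β u v => ?_⟩
  rw [hψ₀.toPacket_eq_iff hX₀]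
  constructor
  · rintro ⟨i, j, h, huv⟩
    refine ⟨h.mk_eq, ?_⟩
    have h1 := hc' α β i j fun z hz => h.pow_eq hz
    have h2 := congrArg (fun t : ℝ => (t : AddCircle (Real.log (Nat.card (X₀.residueField x₀)))))
      (log_eq_of_pow_mul_eq.1 huv)
    simp only [AddCircle.coe_add] at h2
    rw [sub_eq_sub_iff_add_eq_add]
    have h3 := congrArg₂ (· + ·) h1 h2
    refine add_right_cancel (b := ((i * Real.log p : ℝ) : AddCircle _) + ((j * Real.log p : ℝ) : AddCircle _)) ?_
    refine Eq.trans ?_ (h3.trans ?_) <;> abel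
  · rintro ⟨h, huv⟩
    obtain ⟨d, hd, hrel⟩ := packetRel_of_mk_eq hf h
    have h1 := hc' α β 0 d fun z hz => by
      rw [pow_zero, pow_one]
      exact hd z (hq ▸ hz)
    simp only [Nat.cast_zero, zero_mul, AddCircle.coe_zero, add_zero] at h1
    rw [h1] at huv
    have h2 : ((Real.log v.1 - Real.log u.1 - d * Real.log p : ℝ) :
        AddCircle (Real.log (Nat.card (X₀.residueField x₀)))) = 0 := by
      rw [AddCircle.coe_sub, AddCircle.coe_sub]
      rw [sub_eq_sub_iff_add_eq_add] at huv
      rw [sub_eq_zero, sub_eq_iff_eq_add]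
      refine add_right_cancel (b := c α) (Eq.trans ?_ (huv.symm.trans ?_)) <;> abel
    obtain ⟨k, hk⟩ := AddCircle.coe_eq_zero_iff _ |>.1 h2
    -- The exponents are natural numbers, so the positive and the negative part of `k` go to
    -- opposite sides.
    refine ⟨(-k).toNat * f, d + k.toNat * f, hq ▸ hrel _ _, log_eq_of_pow_mul_eq.2 ?_⟩
    have hk' : (k : ℝ) = (k.toNat : ℝ) - ((-k).toNat : ℝ) := by
      have : k = (k.toNat : ℤ) - ((-k).toNat : ℤ) := by omega
      exact_mod_cast this
    rw [zsmul_eq_mul, hq, Nat.cast_pow, Real.log_pow, hk'] at hk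
    push_cast
    linarith

include hX₀ hU hχ₀ in
-- The coordinate map `Φ` has the same fibres as the quotient map `toPacket`, so it descends to a
-- continuous bijection. The packet is compact because `u = exp r` with `0 ≤ r ≤ log q` already
-- reaches every point.
lemma LiesOver.exists_homeomorph [CharP (X₀.residueField x₀) p] (hψ₀ : LiesOver ψ₀ x₀) :
    ∃ e : Packet E x₀ ≃ₜ AutQuotient p × AddCircle (Real.log (Nat.card (X₀.residueField x₀))),
      ∀ t z, e (z.flow t) = ((e z).1, (e z).2 + (t : AddCircle _)) := by
  obtain ⟨c, hc, hiff⟩ := hψ₀.exists_coordinates hX₀ E hU hχ₀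
  let Φ : MulAut (FpBar p)ˣ × PosReal →
      AutQuotient p × AddCircle (Real.log (Nat.card (X₀.residueField x₀))) :=
    fun z => (AutQuotient.mk p z.1, (Real.log z.2.1 : AddCircle _) - c z.1)
  have hlog : 0 < Real.log (Nat.card (X₀.residueField x₀)) :=
    Real.log_pos (by exact_mod_cast Finite.one_lt_card)
  have hΦ : Continuous Φ := by
    refine ((AutQuotient.continuous_mk p).comp continuous_fst).prodMk (Continuous.sub ?_ (hc.comp continuous_fst))
    refine (AddCircle.continuous_mk' _).comp (Continuous.log ?_ fun z => z.2.2.ne')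
    exact continuous_subtype_val.comp continuous_snd
  have hT := hψ₀.isQuotientMap_toPacket hX₀ E hU hχ₀
  have hiff' : ∀ x y, hψ₀.toPacket E hU hχ₀ x = hψ₀.toPacket E hU hχ₀ y ↔ Φ x = Φ y := fun x y =>
    (hiff x.1 y.1 x.2 y.2).trans (Prod.ext_iff (x := Φ x) (y := Φ y)).symm
  let g : Packet E x₀ → AutQuotient p × AddCircle (Real.log (Nat.card (X₀.residueField x₀))) :=
    fun z => Φ (Function.surjInv hT.surjective z)
  have hg : ∀ x, g (hψ₀.toPacket E hU hχ₀ x) = Φ x := fun x =>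
    (hiff' _ _).1 (Function.surjInv_eq hT.surjective _)
  have hgc : Continuous g := by
    rw [hT.continuous_iff]
    convert! hΦ using 1
    exact funext hg
  have hbij : Function.Bijective g := by
    constructor
    · intro y z h
      obtain ⟨y, rfl⟩ := hT.surjective y
      obtain ⟨z, rfl⟩ := hT.surjective z
      rw [hg, hg] at h
      exact (hiff' _ _).2 h
    · rintro ⟨b, θ⟩
      obtain ⟨α, rfl⟩ := AutQuotient.mk_surjective p b
      obtain ⟨t, ht⟩ := QuotientAddGroup.mk_surjective (θ + c α)
      refine ⟨hψ₀.toPacket E hU hχ₀ (α, ⟨Real.exp t, Real.exp_pos t⟩), ?_⟩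
      rw [hg]
      refine Prod.ext rfl ?_
      change (Real.log (Real.exp t) : AddCircle _) - c α = θ
      rw [Real.log_exp, sub_eq_iff_eq_add]
      exact ht
  have hcomp : CompactSpace (Packet E x₀) := by
    have : Fact (0 < Real.log (Nat.card (X₀.residueField x₀))) := ⟨hlog⟩
    let H : MulAut (FpBar p)ˣ × ℝ → Packet E x₀ := fun z =>
      hψ₀.toPacket E hU hχ₀ (z.1, ⟨Real.exp z.2, Real.exp_pos _⟩)
    have hH : Continuous H := (hψ₀.continuous_toPacket E hU hχ₀).comp
      (continuous_fst.prodMk (Continuous.subtype_mk (Real.continuous_exp.comp continuous_snd) _))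
    have hK : IsCompact (H '' (Set.univ ×ˢ Set.Icc 0 (0 + Real.log (Nat.card (X₀.residueField x₀))))) :=
      (isCompact_univ.prod isCompact_Icc).image hH
    refine ⟨?_⟩
    convert hK
    refine (Set.eq_univ_of_forall fun z => ?_).symm
    obtain ⟨⟨α, u⟩, rfl⟩ := hT.surjective z
    obtain ⟨r, hr, hr'⟩ : (Real.log u.1 : AddCircle (Real.log (Nat.card (X₀.residueField x₀)))) ∈
        ((↑) : ℝ → AddCircle (Real.log (Nat.card (X₀.residueField x₀)))) ''
          Set.Icc 0 (0 + Real.log (Nat.card (X₀.residueField x₀))) := by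
      rw [AddCircle.coe_image_Icc_eq]
      trivial
    refine ⟨(α, r), ⟨trivial, hr⟩, (hiff' _ _).2 (Prod.ext rfl ?_)⟩
    change (Real.log (Real.exp r) : AddCircle _) - c α = _
    rw [Real.log_exp, hr']
  refine ⟨Continuous.homeoOfEquivCompactToT2 (f := Equiv.ofBijective g hbij) hgc, fun t z => ?_⟩
  obtain ⟨⟨α, u⟩, rfl⟩ := hT.surjective z
  change g (hψ₀.toPacket E hU hχ₀ (α, ⟨Real.exp t * u.1, mul_pos (Real.exp_pos t) u.2⟩)) =
    ((g (hψ₀.toPacket E hU hχ₀ (α, u))).1, (g (hψ₀.toPacket E hU hχ₀ (α, u))).2 + _)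
  rw [hg, hg]
  refine Prod.ext rfl ?_
  change (Real.log (Real.exp t * u.1) : AddCircle _) - c α = (Real.log u.1 : AddCircle _) - c α + (t : AddCircle _)
  rw [Real.log_mul (Real.exp_pos t).ne' u.2.ne', Real.log_exp, AddCircle.coe_add]
  abel

end ClosedPoint

/-! ### Periodic points lie over closed points -/

section RootsOfUnity

variable {B L : Type} [CommRing B] [Field L] [CharZero L]

/-- If a power of a character at one point equals another power at another point, then the exponents
are equal up to divisibility. -/
lemma dvd_of_extendChar_pow_eq {ev ev' : B →+* L} {P : Lˣ →* ℂˣ} {c m n : ℕ} (hc0 : 0 < c)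
    (hc : ∀ z, IsOfFinOrder z → (P z = 1 ↔ z ^ c = 1)) (hn : 0 < n)
    (hroot : ∀ (ψ : B →+* AlgebraicClosure L) (N : ℕ) (y : AlgebraicClosure L), 0 < N → y ^ N = 1 →
      ∃ b, ψ b = y ∧ b ^ N = 1)
    (h : ∀ b, extendChar P (ev b) ^ m = extendChar P (ev' b) ^ n) : n ∣ m := by
  have hN : 0 < n * c := Nat.mul_pos hn hc0
  have : NeZero ((n * c : ℕ) : AlgebraicClosure L) := ⟨by exact_mod_cast hN.ne'⟩
  -- A lift `b` of `y` to `B` with `b ^ (n * c) = 1` shows that `y` lies in `L`. At `ev'` its value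
  -- `w` has `w ^ n` among the `c`-th roots of unity, which `P` kills. Hence `P` kills `z ^ m` too,
  -- so `y ^ (m * c) = 1` and `n * c` divides `m * c`.
  obtain ⟨y, hy⟩ := HasEnoughRootsOfUnity.exists_primitiveRoot (AlgebraicClosure L) (n * c)
  obtain ⟨b, hb, hb1⟩ := hroot ((algebraMap L (AlgebraicClosure L)).comp ev) (n * c) y hN hy.pow_eq_one
  have hunit : ∀ φ : B →+* L, ∃ z : Lˣ, (z : L) = φ b ∧ z ^ (n * c) = 1 := fun φ => by
    have h1 : φ b ^ (n * c) = 1 := by rw [← map_pow, hb1, map_one]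
    have h0 : φ b ≠ 0 := by
      intro h0
      rw [h0, zero_pow hN.ne'] at h1
      exact zero_ne_one h1
    exact ⟨Units.mk0 _ h0, rfl, Units.ext (by simpa using h1)⟩
  obtain ⟨z, hz, hz1⟩ := hunit ev
  obtain ⟨w, hw, hw1⟩ := hunit ev'
  have hfin : ∀ {z : Lˣ}, z ^ (n * c) = 1 → IsOfFinOrder z := fun h1 =>
    isOfFinOrder_iff_pow_eq_one.2 ⟨n * c, hN, h1⟩
  have h1 := h b
  rw [← hz, ← hw, extendChar_units, extendChar_units, ← Units.val_pow_eq_pow_val,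
    ← Units.val_pow_eq_pow_val, Units.val_inj, ← map_pow, ← map_pow,
    (hc _ (hfin hw1).pow).2 (by rw [← pow_mul, hw1]), hc _ (hfin hz1).pow, ← pow_mul] at h1
  have hy' : algebraMap L (AlgebraicClosure L) z = y := by
    rw [hz, ← hb]
    rfl
  have h2 : y ^ (m * c) = 1 := by
    rw [← hy', ← map_pow, ← Units.val_pow_eq_pow_val, h1, Units.val_one, map_one]
  exact Nat.dvd_of_mul_dvd_mul_right hc0 (hy.dvd_of_pow_eq_one _ h2)

end RootsOfUnity

section Periodic

variable {X₀ : Scheme.{0}} [IsIntegral X₀] {K : Type} [Field K]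
  [Algebra X₀.functionField K] [IsAlgClosure X₀.functionField K] (E : AdmissibleCondition X₀ K)

variable {E}

lemma isOfFinOrder_of_pow_eq_pow {G : Type*} [Group G] {g : G} {a b : ℕ} (hab : a ≠ b)
    (h : g ^ a = g ^ b) : IsOfFinOrder g := by
  by_contra hg
  exact hab (injective_pow_iff_not_isOfFinOrder.2 hg h)

/-- If two different Frobenius maps agree on the class of a pair, then the multiplicative group of
the residue field is torsion. -/
lemma isOfFinOrder_of_frob_eq (q : E.Points) {m n : ℕ+} (hmn : m ≠ n)
    (h : (WittPoints.mk q).frob m = (WittPoints.mk q).frob n)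
    (z : ((normalizationIn X₀ K).residueField q.1.pt)ˣ) : IsOfFinOrder z := by
  obtain ⟨σ, hσ⟩ : ∃ σ : GalGroup X₀ K, (q.1.frob n).map (galHom σ) = q.1.frob m :=
    WittPoints.mk_eq_mk_iff.1 h
  obtain ⟨_, ⟨U, hU, rfl⟩, hxU, -⟩ := X₀.isBasis_affineOpens.exists_subset_of_mem_open
    (Set.mem_univ (toBase X₀ K q.1.pt)) isOpen_univ
  have : Nonempty U := ⟨⟨_, hxU⟩⟩
  have hW := isAffineOpen_over (K := K) hU
  have hx : q.1.pt ∈ overOpen K U := hxU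
  let ev := ((normalizationIn X₀ K).evaluation (overOpen K U) q.1.pt hx).hom
  have hev : ∀ b, extendChar q.1.char (ev b) ^ (m : ℕ) =
      extendChar q.1.char (ev (galRingHom U σ b)) ^ (n : ℕ) := by
    intro b
    have h1 : (q.1.frob m).eval (overOpen K U) hx b =
        ((q.1.frob n).map (galHom σ)).eval (overOpen K U) (map_galHom_mem σ hx) b := by
      congr 1
      exact hσ.symm
    exact (CharPoint.eval_frob q.1 m _ hx b).symm.trans (h1.trans
      ((CharPoint.eval_map_galHom U σ (q.1.frob n) hx b).trans (CharPoint.eval_frob q.1 n _ hx _)))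
  by_cases hchar : ringChar ((normalizationIn X₀ K).residueField q.1.pt) = 0
  · exfalso
    have : CharZero ((normalizationIn X₀ K).residueField q.1.pt) :=
      (CharP.ringChar_zero_iff_CharZero _).1 hchar
    obtain ⟨c, hc0, hc⟩ := exists_pow_eq_one_iff_of_finite q.1.char (E.finite_ker q.1 q.2)
    have hroot : ∀ (ψ : Γ(normalizationIn X₀ K, overOpen K U) →+*
        AlgebraicClosure ((normalizationIn X₀ K).residueField q.1.pt)) (N : ℕ)
        (y : AlgebraicClosure ((normalizationIn X₀ K).residueField q.1.pt)), 0 < N → y ^ N = 1 →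
        ∃ b, ψ b = y ∧ b ^ N = 1 := by
      intro ψ N y hN hy
      obtain ⟨b, hb, hb'⟩ := exists_section_root hU ψ (Polynomial.monic_X_pow_sub_C 1 hN.ne')
        (y := y) (by simp [hy])
      exact ⟨b, hb, by simpa [sub_eq_zero] using hb'⟩
    have h1 : (n : ℕ) ∣ m := dvd_of_extendChar_pow_eq (ev := ev) (ev' := ev.comp (galRingHom U σ))
      hc0 hc n.pos hroot hev
    have h2 : (m : ℕ) ∣ n := dvd_of_extendChar_pow_eq (ev := ev.comp (galRingHom U σ)) (ev' := ev)
      hc0 hc m.pos hroot fun b => (hev b).symm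
    exact hmn (PNat.coe_injective (Nat.dvd_antisymm h2 h1))
  · refine E.not_torsion q.1 q.2 hchar (fun z => ?_) z
    -- Some power `σ ^ r` with `r > 0` fixes `b`. The iterated relation then equates two different
    -- powers of the value of `P` at `b`, so that value is torsion.
    have hiter : ∀ (k : ℕ) b, extendChar q.1.char (ev b) ^ (m : ℕ) ^ k =
        extendChar q.1.char (ev (galRingHom U (σ ^ k) b)) ^ (n : ℕ) ^ k := by
      intro k
      induction k with
      | zero =>
        intro b
        rw [pow_zero σ, galRingHom_one hU, pow_zero, pow_zero]
      | succ k ih =>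
        intro b
        rw [pow_succ, pow_mul, ih, pow_right_comm, hev, ← galRingHom_mul hU, ← pow_succ', ← pow_mul,
          mul_comm, ← pow_succ]
    have hfin : ∀ b (hb : ev b ≠ 0), IsOfFinOrder (q.1.char (Units.mk0 (ev b) hb)) := by
      intro b hb
      obtain ⟨r, hr, hr'⟩ := exists_galRingHom_pow_eq hU σ b
      have h1 := hiter r b
      have h2 : ev b = (Units.mk0 (ev b) hb : ((normalizationIn X₀ K).residueField q.1.pt)ˣ) := rfl
      rw [hr', h2, extendChar_units, ← Units.val_pow_eq_pow_val, ← Units.val_pow_eq_pow_val,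
        Units.val_inj] at h1
      refine isOfFinOrder_of_pow_eq_pow (fun h3 => hmn ?_) h1
      exact PNat.coe_injective (Nat.pow_left_injective hr.ne' h3)
    obtain ⟨b, c, hc, hz⟩ := exists_evaluation_div hW hx (z : (normalizationIn X₀ K).residueField q.1.pt)
    have hb : ev b ≠ 0 := fun h0 => mul_ne_zero z.ne_zero hc (hz.trans h0)
    have h3 : z = Units.mk0 (ev b) hb * (Units.mk0 (ev c) hc)⁻¹ := by
      rw [eq_mul_inv_iff_mul_eq]
      exact Units.ext hz
    rw [h3, map_mul, map_inv]
    exact (hfin b hb).mul (hfin c hc).inv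

/-- Periodic points lie over closed points. -/
lemma FlowSpace.base_mem_closedPoints {z : FlowSpace E} {t : ℝ} (ht : 0 < t) (h : z.flow t = z) :
    z.base ∈ closedPoints X₀ := by
  obtain ⟨w, u, rfl⟩ := exists_eq_mk z
  obtain ⟨q, rfl⟩ := WittPoints.mk_surjective w
  obtain ⟨m, n, h1, h2⟩ := mk_eq_mk_iff.1 h
  have hmn : m ≠ n := by
    rintro rfl
    have hm : (0 : ℝ) < m := by exact_mod_cast m.pos
    have h3 : Real.exp t * u.1 = u.1 := mul_left_cancel₀ hm.ne' h2
    have h4 : Real.exp t = 1 := mul_right_cancel₀ u.2.ne' (h3.trans (one_mul _).symm)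
    exact ht.ne' (Real.exp_eq_one_iff t |>.1 h4)
  have h3 := isOfFinOrder_of_frob_eq q hmn h1
  refine isClosed_singleton_of_isOfFinOrder (x := toBase X₀ K q.1.pt) fun z => ?_
  have h4 := h3 (Units.map ((toBase X₀ K).residueFieldMap q.1.pt).hom.toMonoidHom z)
  exact (Function.Injective.isOfFinOrder_iff (Units.map_injective
    ((toBase X₀ K).residueFieldMap q.1.pt).hom.injective)).1 h4

end Periodic

/-! ### Packets as trivial circle bundles -/

section Main

variable {X₀ : Scheme.{0}} [IsIntegral X₀] (hX₀ : IsNormalScheme X₀)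
  {K : Type} [Field K]
  [Algebra X₀.functionField K] [IsAlgClosure X₀.functionField K] (E : AdmissibleCondition X₀ K)

include hX₀ in
/-- The packet over a closed point is a product with a circle. -/
lemma exists_packet_homeomorph {x₀ : X₀} [Finite (X₀.residueField x₀)] :
    ∃ (p : ℕ) (_ : Fact p.Prime) (_ : CharP (X₀.residueField x₀) p)
      (e : Packet E x₀ ≃ₜ AutQuotient p × AddCircle (Real.log (Nat.card (X₀.residueField x₀)))),
      ∀ t z, e (z.flow t) = ((e z).1, (e z).2 + (t : AddCircle _)) := by
  obtain ⟨p, hp⟩ := CharP.exists (X₀.residueField x₀)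
  have hprime : Fact p.Prime := ⟨CharP.char_is_prime (X₀.residueField x₀) p⟩
  obtain ⟨_, ⟨U, hU, rfl⟩, hx, -⟩ :=
    X₀.isBasis_affineOpens.exists_subset_of_mem_open (Set.mem_univ x₀) isOpen_univ
  have : Nonempty U := ⟨⟨_, hx⟩⟩
  obtain ⟨ψ₀, hψ₀⟩ := exists_liesOver (K := K) (p := p) hU hx
  obtain ⟨χ₀, hχ₀⟩ := FpBar.exists_injective_char p
  exact ⟨p, hprime, hp, hψ₀.exists_homeomorph hX₀ E hU hχ₀⟩

end Main

/-- A homeomorphism to a product as a trivialization. -/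
def trivializationOfHomeomorph {Z B F : Type*} [TopologicalSpace Z] [TopologicalSpace B]
    [TopologicalSpace F] (e : Z ≃ₜ B × F) : Bundle.Trivialization F fun z => (e z).1 where
  toOpenPartialHomeomorph := e.toOpenPartialHomeomorph
  baseSet := Set.univ
  open_baseSet := isOpen_univ
  source_eq := by simp
  target_eq := by simp
  proj_toFun _ _ := rfl

end ArithmeticFlow

end

theorem theorem4p2 (X₀ : Scheme.{0}) [IsIntegral X₀] (hX₀ : ArithmeticFlow.IsNormalScheme X₀)
    (s : X₀ ⟶ Spec (.of ℤ)) [LocallyOfFiniteType s] [QuasiCompact s]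
    (K : Type) [Field K] [Algebra X₀.functionField K] [IsAlgClosure X₀.functionField K]
    (E : ArithmeticFlow.AdmissibleCondition X₀ K) :
    -- the set of periodic points is the disjoint union of the packets over the closed points
    {z : ArithmeticFlow.FlowSpace E | ∃ t : ℝ, 0 < t ∧ z.flow t = z} =
        ⋃ x₀ ∈ closedPoints X₀, ArithmeticFlow.packet E x₀ ∧
    (closedPoints X₀).PairwiseDisjoint (ArithmeticFlow.packet E) ∧
    ∀ x₀ ∈ closedPoints X₀,
      -- the packets are compact, and consist of periodic orbits of length `log N x₀`
      IsCompact (ArithmeticFlow.packet E x₀) ∧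
      Finite (X₀.residueField x₀) ∧
      (∀ z ∈ ArithmeticFlow.packet E x₀, ∀ t : ℝ, z.flow t = z ↔
        ∃ k : ℤ, t = k * Real.log (Nat.card (X₀.residueField x₀))) ∧
      -- the packet with its quotient topology
      CompactSpace (ArithmeticFlow.Packet E x₀) ∧ T2Space (ArithmeticFlow.Packet E x₀) ∧
      Continuous (ArithmeticFlow.Packet.incl : ArithmeticFlow.Packet E x₀ → _) ∧
      -- the fibration, where `p` is the residue characteristic
      ∃ (p : ℕ) (_ : Fact p.Prime) (_ : CharP (X₀.residueField x₀) p),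
        (ArithmeticFlow.autToUnits p).range.Normal ∧
        CompactSpace (ArithmeticFlow.AutQuotient p) ∧ T2Space (ArithmeticFlow.AutQuotient p) ∧
        ∃ π : ArithmeticFlow.Packet E x₀ → ArithmeticFlow.AutQuotient p,
          Continuous π ∧ Function.Surjective π ∧
          -- the fibres are the orbits
          (∀ y z, π y = π z ↔ ∃ t : ℝ, y.flow t = z) ∧
          -- locally over the base, the packet is the product with a circle of length `log N x₀`
          ∀ b, ∃ e : Bundle.Trivialization
              (AddCircle (Real.log (Nat.card (X₀.residueField x₀)))) π,
            b ∈ e.baseSet ∧ ∀ y ∈ e.source, ∀ t : ℝ, (e (y.flow t)).2 = (e y).2 + (t : AddCircle _) := by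
  -- In the product coordinates, `t` fixes a point exactly when its class in the circle is zero.
  have hper : ∀ x₀, Finite (X₀.residueField x₀) → ∀ z ∈ ArithmeticFlow.packet E x₀, ∀ t : ℝ,
      z.flow t = z ↔ ∃ k : ℤ, t = k * Real.log (Nat.card (X₀.residueField x₀)) := by
    intro x₀ hfin z hz t
    obtain ⟨p, _, _, e, he⟩ := ArithmeticFlow.exists_packet_homeomorph hX₀ E (x₀ := x₀)
    let y : ArithmeticFlow.Packet E x₀ := ⟨z, hz⟩
    have h1 : z.flow t = z ↔ y.flow t = y :=
      ⟨fun h => Subtype.ext h, fun h => congrArg Subtype.val h⟩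
    rw [h1, ← e.injective.eq_iff, he, Prod.ext_iff]
    simp only [true_and, add_eq_left, AddCircle.coe_eq_zero_iff, zsmul_eq_mul]
    simp only [eq_comm]
  refine ⟨?_, ?_, fun x₀ hx₀ => ?_⟩
  · ext z
    simp only [Set.mem_ofPred_eq, Set.mem_iUnion, exists_prop]
    constructor
    · rintro ⟨t, ht, h⟩
      exact ⟨z.base, ArithmeticFlow.FlowSpace.base_mem_closedPoints ht h, rfl⟩
    · rintro ⟨x₀, hx₀, hz⟩
      have hfin := ArithmeticFlow.finite_residueField s hx₀
      exact ⟨Real.log (Nat.card (X₀.residueField x₀)),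
        Real.log_pos (by exact_mod_cast Finite.one_lt_card),
        (hper x₀ hfin z hz _).2 ⟨1, by rw [Int.cast_one, one_mul]⟩⟩
  · intro x _ y _ hxy
    refine Set.disjoint_left.2 fun z hz hz' => hxy ?_
    exact (show z.base = x from hz).symm.trans hz'
  · have hfin := ArithmeticFlow.finite_residueField s hx₀
    obtain ⟨p, hp, hchar, e, he⟩ := ArithmeticFlow.exists_packet_homeomorph hX₀ E (x₀ := x₀)
    have : Fact (0 < Real.log (Nat.card (X₀.residueField x₀))) :=
      ⟨Real.log_pos (by exact_mod_cast Finite.one_lt_card)⟩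
    have hcomp : CompactSpace (ArithmeticFlow.Packet E x₀) := e.symm.compactSpace
    refine ⟨?_, hfin, hper x₀ hfin, hcomp, e.symm.t2Space, ArithmeticFlow.Packet.continuous_incl,
      p, hp, hchar, inferInstance, inferInstance, inferInstance, fun z => (e z).1,
      continuous_fst.comp e.continuous, Prod.fst_surjective.comp e.surjective, fun y z => ?_,
      fun b => ⟨ArithmeticFlow.trivializationOfHomeomorph e, Set.mem_univ b, fun y _ t => ?_⟩⟩
    · rw [← ArithmeticFlow.Packet.range_incl]
      exact isCompact_range ArithmeticFlow.Packet.continuous_incl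
    · constructor
      · intro h
        obtain ⟨t, ht⟩ := QuotientAddGroup.mk_surjective ((e z).2 - (e y).2)
        refine ⟨t, e.injective ?_⟩
        rw [he]
        refine Prod.ext h ?_
        exact (congrArg ((e y).2 + ·) ht).trans (add_sub_cancel _ _)
      · rintro ⟨t, rfl⟩
        simp only [he]
    · exact congrArg Prod.snd (he t y)
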